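/- Write $\mathbb T=\mathbb R/2\pi\mathbb Z$. Let $\Theta\in C^\infty(\mathbb R)$ be a mollifier: $\Theta\ge 0$, $\Theta=0$ off $(-1,1)$, $\int\Theta=1$, and put $\Theta_\kappa(z)=\kappa^{-1}\Theta(z/\kappa)$. For $0<\varepsilon<1$ and $0<\kappa<1$ let $$\psi_\kappa'(z)=\int_{-1+\kappa}^{1-\kappa}\Theta_\kappa(z-t)\,dt,\qquad \varphi_\kappa(z)=1-\frac{\int_{-1}^z\psi'_\kappa}{\int_{-1}^1\psi'_\kappa},$$ and let $\varpi=\varpi_{\varepsilon,\kappa}$ be the even function with $\varpi(y)=\varepsilon$ for $|y|<1-\varepsilon$, $\varpi(y)=\varepsilon\,\varphi_\kappa\big(\tfrac{|y|-1}{\varepsilon}\big)$ for $1-\varepsilon\le|y|\le1+\varepsilon$, and $\varpi(y)=0$ for $|y|>1+\varepsilon$. Put $I_\varepsilon=[-1-\varepsilon,-1+\varepsilon]\cup[1-\varepsilon,1+\varepsilon]$ and $D_\varepsilon=\mathbb T\times I_\varepsilon$. Let $H^{4,3}(D_\varepsilon)$ be the space with norm $\sum_{j\le 3,\ i+j\le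 4}\|\partial_x^i\partial_y^j g\|_{L^2(D_\varepsilon)}$ (weak derivatives), whose elements are identified with their continuous representatives, and let $X(D_\varepsilon)$ be the subspace of those $g\in H^{4,3}(D_\varepsilon)$ that are even in $x$ with $\int_{-\pi}^{\pi}g(x,y)\,dx=0$ for every $y\in I_\varepsilon$. With $\mathbf x=(x,y)$ and $\bar{\mathbf x}=(\bar x,\bar y)$, define $$F[\lambda,\mathsf f](\mathbf x)=\lambda\,\partial_x\mathsf f(\mathbf x)+(y+\mathsf f(\mathbf x))\,\partial_x\mathsf f(\mathbf x)-\frac1{4\pi}\int_{D_\varepsilon}\varpi'(\bar y)\log\big[\cosh(y-\bar y+\mathsf f(\mathbf x)-\mathsf f(\bar{\mathbf x}))-\cos(x-\bar x)\big]\,\big(\partial_x\mathsf f(\mathbf x)-\partial_x\mathsf f(\bar{\mathbf x})\big)\,d\bar{\mathbf x},$$ and let $\mathcal L[\lambda]=D_{\mathsf f}F[\lambda,0]$, that is, $$\mathcal L[\lambda]h(\mathbf x)=(\lambda+y)\,\partial_xh(\mathbf x)-\frac1{4\pi}\int_{D_\varepsilon}\varpi'(\bar y)\log\big[\cosh(y-\bar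 y)-\cos(x-\bar x)\big]\,\big(\partial_xh(\mathbf x)-\partial_xh(\bar{\mathbf x})\big)\,d\bar{\mathbf x}.$$ Let $m\ge1$ be an integer, let $\lambda_{\varepsilon,\kappa,m}\in\mathbb R$, and let $h_{\varepsilon,\kappa,m}\in X(D_\varepsilon)$ be $\tfrac{2\pi}m$-periodic in $x$ and not identically zero, with $\mathcal L[\lambda_{\varepsilon,\kappa,m}]h_{\varepsilon,\kappa,m}=0$ in the interior of $D_\varepsilon$. Let $(\lambda^\sigma,\mathsf f^\sigma)_{|\sigma|<\sigma_0}$, $\sigma_0>0$, be any branch of traveling waves bifurcating from it: $\mathsf f^\sigma\in X(D_\varepsilon)$ is $\tfrac{2\pi}m$-periodic in $x$, $F[\lambda^\sigma,\mathsf f^\sigma]=0$ in the interior of $D_\varepsilon$, $\mathsf f^\sigma=\sigma h_{\varepsilon,\kappa,m}+o(\sigma)$ in $H^{4,3}(D_\varepsilon)$, and $\lambda^\sigma\to\lambda_{\varepsilon,\kappa,m}$ as $\sigma\to0$. Then there is $\sigma_1\in(0,\sigma_0]$ such that for every $|\sigma|<\sigma_1$ the conditions * $\omega^\sigma(x,\,y+\mathsf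 f^\sigma(x,y))=\varpi(y)$ for $x\in\mathbb T$, $y\in I_\varepsilon$; * $\omega^\sigma(x,z)=\varepsilon$ whenever $-1+\varepsilon+\mathsf f^\sigma(x,-1+\varepsilon)<z<1-\varepsilon+\mathsf f^\sigma(x,1-\varepsilon)$; * $\omega^\sigma(x,z)=0$ whenever $z>1+\varepsilon+\mathsf f^\sigma(x,1+\varepsilon)$ or $z<-1-\varepsilon+\mathsf f^\sigma(x,-1-\varepsilon)$ determine exactly one function $\omega^\sigma=\omega^\sigma_{\varepsilon,\kappa,m}$ on $\mathbb T\times\mathbb R$, and $\omega^\sigma\in C^\infty(\mathbb T\times\mathbb R)$. -/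

import Mathlib

open scoped ContDiff ENNReal Topology
open MeasureTheory Set Filter

namespace CouetteWave

noncomputable section

/-! Functions on `𝕋 × ℝ` (or on part of it) are functions of `(x, y) : ℝ × ℝ` that are
`2π`-periodic in `x`. -/

/-- A mollifier on `ℝ`: smooth, nonnegative, vanishing off `(-1, 1)`, with integral one. -/
structure IsMollifier (Θ : ℝ → ℝ) : Prop where
  smooth : ContDiff ℝ ∞ Θ
  nonneg : ∀ z, 0 ≤ Θ z
  support_subset : Function.support Θ ⊆ Ioo (-1) 1
  integral_eq_one : ∫ z, Θ z = 1

/-- `Θ_κ(z) = κ⁻¹ Θ(z / κ)`. -/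
def mollify (Θ : ℝ → ℝ) (κ z : ℝ) : ℝ := κ⁻¹ * Θ (z / κ)

/-- `ψ'_κ(z) = ∫_{-1+κ}^{1-κ} Θ_κ(z - t) dt`. -/
def psi' (Θ : ℝ → ℝ) (κ z : ℝ) : ℝ := ∫ t in (-1 + κ)..(1 - κ), mollify Θ κ (z - t)

/-- `φ_κ(z) = 1 - (∫_{-1}^z ψ'_κ) / (∫_{-1}^1 ψ'_κ)`. -/
def phi (Θ : ℝ → ℝ) (κ z : ℝ) : ℝ :=
  1 - (∫ t in (-1)..z, psi' Θ κ t) / ∫ t in (-1)..1, psi' Θ κ t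

/-- The even profile `ϖ_{ε,κ}`: equal to `ε` for `|y| < 1 - ε`, to `0` for `|y| > 1 + ε`, and to
`ε φ_κ((|y| - 1) / ε)` in between. -/
def profile (Θ : ℝ → ℝ) (ε κ y : ℝ) : ℝ :=
  if 1 + ε < |y| then 0
  else if 1 - ε ≤ |y| then ε * phi Θ κ ((|y| - 1) / ε)
  else ε

/-- `I_ε = [-1-ε, -1+ε] ∪ [1-ε, 1+ε]`. -/
def bands (ε : ℝ) : Set ℝ := Icc (-1 - ε) (-1 + ε) ∪ Icc (1 - ε) (1 + ε)

/-- One period `(-π, π) × I_ε` of `D_ε = 𝕋 × I_ε`. -/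
def cell (ε : ℝ) : Set (ℝ × ℝ) := Ioo (-Real.pi) Real.pi ×ˢ bands ε

/-- The (periodic lift of the) interior of `D_ε`. -/
def openStrips (ε : ℝ) : Set (ℝ × ℝ) := univ ×ˢ interior (bands ε)

/-- The classical partial derivative `∂ₓ g`. -/
def dx (g : ℝ × ℝ → ℝ) (p : ℝ × ℝ) : ℝ := deriv (fun s => g (s, p.2)) p.1

/-- The classical mixed derivative `∂ₓⁱ ∂ᵧʲ φ`, used for test functions. -/
def mixedDeriv (i j : ℕ) (φ : ℝ × ℝ → ℝ) (p : ℝ × ℝ) : ℝ :=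
  iteratedDeriv i (fun s => iteratedDeriv j (fun t => φ (s, t)) p.2) p.1

/-- `d` is the weak derivative `∂ₓⁱ ∂ᵧʲ g` in the interior of `D_ε`. -/
def IsWeakDeriv (ε : ℝ) (i j : ℕ) (g d : ℝ × ℝ → ℝ) : Prop :=
  LocallyIntegrableOn g (openStrips ε) ∧ LocallyIntegrableOn d (openStrips ε) ∧
    ∀ φ : ℝ × ℝ → ℝ, ContDiff ℝ ∞ φ → HasCompactSupport φ → tsupport φ ⊆ openStrips ε →
      ∫ p, g p * mixedDeriv i j φ p = (-1) ^ (i + j) * ∫ p, d p * φ p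

/-- The orders `(i, j)` of the derivatives `∂ₓⁱ ∂ᵧʲ` in the `H^{4,3}` norm: `i + j ≤ 4`, `j ≤ 3`. -/
def h43Orders : Finset (ℕ × ℕ) :=
  (Finset.range 5 ×ˢ Finset.range 4).filter (fun n => n.1 + n.2 ≤ 4)

/-- The `H^{4,3}(D_ε)` norm, `∑ ‖∂ₓⁱ ∂ᵧʲ g‖_{L²(D_ε)}` over the orders above. Weak derivatives are
unique almost everywhere, so all terms of the infimum agree; it is `∞` when some weak derivative
does not exist. -/
def h43Norm (ε : ℝ) (g : ℝ × ℝ → ℝ) : ℝ≥0∞ :=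
  ⨅ (d : ℕ × ℕ → ℝ × ℝ → ℝ) (_ : ∀ n ∈ h43Orders, IsWeakDeriv ε n.1 n.2 g (d n)),
    ∑ n ∈ h43Orders, eLpNorm (d n) 2 (volume.restrict (cell ε))

/-- The space `X(D_ε)`: functions in `H^{4,3}(D_ε)`, even and of zero mean in `x`. An element of
`H^{4,3}(D_ε)` is identified with its representative that is continuous on `D_ε`; values off `D_ε`
play no role. -/
structure MemX (ε : ℝ) (g : ℝ × ℝ → ℝ) : Prop where
  continuousOn : ContinuousOn g (univ ×ˢ bands ε)
  periodic : ∀ x, ∀ y ∈ bands ε, g (x + 2 * Real.pi, y) = g (x, y)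
  even : ∀ x, ∀ y ∈ bands ε, g (-x, y) = g (x, y)
  mean_zero : ∀ y ∈ bands ε, ∫ x in (-Real.pi)..Real.pi, g (x, y) = 0
  norm_lt_top : h43Norm ε g < ⊤

/-- The functional
`F[λ, f](x, y) = λ ∂ₓf + (y + f) ∂ₓf - (4π)⁻¹ ∫_{D_ε} ϖ'(y') log(cosh(y - y' + f(x, y) - f(x', y'))
  - cos(x - x')) (∂ₓf(x, y) - ∂ₓf(x', y')) dx' dy'`. -/
def waveF (Θ : ℝ → ℝ) (ε κ lam : ℝ) (f : ℝ × ℝ → ℝ) (p : ℝ × ℝ) : ℝ :=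
  lam * dx f p + (p.2 + f p) * dx f p
    - 1 / (4 * Real.pi) * ∫ q in cell ε, deriv (profile Θ ε κ) q.2
        * Real.log (Real.cosh (p.2 - q.2 + f p - f q) - Real.cos (p.1 - q.1))
        * (dx f p - dx f q)

/-- The linearization `L[λ] = D_f F[λ, 0]`. -/
def waveL (Θ : ℝ → ℝ) (ε κ lam : ℝ) (h : ℝ × ℝ → ℝ) (p : ℝ × ℝ) : ℝ :=
  (lam + p.2) * dx h p
    - 1 / (4 * Real.pi) * ∫ q in cell ε, deriv (profile Θ ε κ) q.2
        * Real.log (Real.cosh (p.2 - q.2) - Real.cos (p.1 - q.1))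
        * (dx h p - dx h q)

/-- `g` is `2π/m`-periodic in `x` on `D_ε`. -/
def FoldPeriodic (ε : ℝ) (m : ℕ) (g : ℝ × ℝ → ℝ) : Prop :=
  ∀ x, ∀ y ∈ bands ε, g (x + 2 * Real.pi / m, y) = g (x, y)

/-- `(λ₀, h)` is a bifurcation pair: `h ∈ X(D_ε)` is `2π/m`-periodic, not identically zero on `D_ε`,
and in the kernel of `L[λ₀]`. -/
structure IsBifurcationPair (Θ : ℝ → ℝ) (ε κ : ℝ) (m : ℕ) (lam₀ : ℝ) (h : ℝ × ℝ → ℝ) : Prop where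
  memX : MemX ε h
  fold : FoldPeriodic ε m h
  ne_zero : ∃ x, ∃ y ∈ bands ε, h (x, y) ≠ 0
  kernel : ∀ p ∈ openStrips ε, waveL Θ ε κ lam₀ h p = 0

/-- `σ ↦ (λ^σ, f^σ)`, `|σ| < σ₀`, is a branch of `2π/m`-periodic solutions in `X(D_ε)` of
`F[λ^σ, f^σ] = 0` in the interior of `D_ε`, which bifurcates from `(λ₀, 0)` in the direction `h`:
`f^σ = σ h + o(σ)` in `H^{4,3}(D_ε)` and `λ^σ → λ₀` as `σ → 0`. -/
structure IsBranch (Θ : ℝ → ℝ) (ε κ : ℝ) (m : ℕ) (lam₀ : ℝ) (h : ℝ × ℝ → ℝ) (σ₀ : ℝ)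
    (lam : ℝ → ℝ) (f : ℝ → ℝ × ℝ → ℝ) : Prop where
  memX : ∀ σ, |σ| < σ₀ → MemX ε (f σ)
  fold : ∀ σ, |σ| < σ₀ → FoldPeriodic ε m (f σ)
  solves : ∀ σ, |σ| < σ₀ → ∀ p ∈ openStrips ε, waveF Θ ε κ (lam σ) (f σ) p = 0
  tangent : ∀ η : ℝ, 0 < η →
    ∀ᶠ σ in 𝓝 (0 : ℝ), h43Norm ε (fun p => f σ p - σ * h p) ≤ ENNReal.ofReal (η * |σ|)
  speed : Tendsto lam (𝓝 0) (𝓝 lam₀)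

/-- `w` is the vorticity on `𝕋 × ℝ` whose level curves on the bands are the graphs of
`x ↦ y + f(x, y)`, carrying the value `ϖ(y)`; between the two bands it is `ε`, and above and below
them it is `0`. -/
structure IsVorticity (Θ : ℝ → ℝ) (ε κ : ℝ) (f w : ℝ × ℝ → ℝ) : Prop where
  on_bands : ∀ x, ∀ y ∈ bands ε, w (x, y + f (x, y)) = profile Θ ε κ y
  between : ∀ x z, -1 + ε + f (x, -1 + ε) < z → z < 1 - ε + f (x, 1 - ε) → w (x, z) = ε
  outside : ∀ x z, 1 + ε + f (x, 1 + ε) < z ∨ z < -1 - ε + f (x, -1 - ε) → w (x, z) = 0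

end

end CouetteWave

open CouetteWave

namespace CouetteWave
noncomputable section

/-! ### The profile -/

/-! Extend `f^σ` from the bands to a function `E` on the plane, small together with its Lipschitz
constant in `y`, and let `ζ(x, ·)` be the inverse of the increasing map `y ↦ y + E(x, y)`. Since `ϖ`
is constant on each component of the complement of the bands, the three conditions force `ω = ϖ ∘ ζ`
(`exists_layering`, `Layering.isVorticity`, `Layering.unique`). This construction only shows that
`ω` is continuous; smoothness comes from the equation.

Let `Φ = λ z + z²/2 - (4π)⁻¹ log(cosh - cos) ∗ ω` be the stream function in the moving frame. After
an integration by parts in the vertical variable, `F[λ, f](x, y)` is the `x`-derivative of `Φ(x, y +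
f(x, y))`. Thus `F = 0` says that `Φ` is constant on each curve `z = y + f(x, y)`
(`Layering.hasDerivAt_stream`, `Layering.stream_eq`). If `∂_z Φ ≠ 0` near the bands, the level set
of value `s` is there a graph `z = Z(x, s)` with `Z` as smooth as `Φ`. Because `f` has zero mean in
`x`, the label `y` of a curve is the mean of `Z(·, s)`, so `y = M(Φ(x, z))` with `M` as smooth as
`Φ` (`exists_label`). Differentiability of `f` in `y` is not needed. Hence `ω = ϖ ∘ M ∘ Φ` near the
bands is as smooth as `Φ`, while `Φ` has one derivative more than `ω`, the gradient of the kernel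
being locally integrable (`contDiff_succ_conv_logKer`). Induction gives `C^∞`
(`Layering.contDiff_profile`).

It remains to see that `∂_z Φ ≠ 0`. For small `σ` it is uniformly close to the shear speed `U(y) =
λ₀ + y - ½ ∫ ϖ'(t) |y - t| dt` (`exists_streamY_bound`), and `U' = 1 - ϖ ≥ 1 - ε > 0`. Suppose
`U(y₀) = 0` with `y₀` in the bands. The `n`-th cosine coefficient `c` of `h` satisfies `U c = η` on
the bands, where `η'' - n² η = -ϖ' c` and `η` decays exponentially outside them. As `U'' = -ϖ'`, the
function `P = U η' - U' η` satisfies `P' = n² U η`. To the right of `y₀` the quantity `P η / U` is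
nondecreasing, starts from `0` and ends nonpositive, so `η = 0` there; reflection treats the left
side (`eq_zero_of_rayleigh`, `cosCoeff_eq_zero`). Then all coefficients of `h` vanish and `h = 0`, a
contradiction (`shearSpeed_ne_zero`).

The `H^{4,3}` norm controls the supremum of `f`, its Lipschitz constant in `y` and a continuous `∂ₓ
f`. This embedding is `exists_regular`, proved by mollification. -/

lemma contDiff_primitive {g : ℝ → ℝ} (hg : ContDiff ℝ ∞ g) (a : ℝ) :
    ContDiff ℝ ∞ (fun z => ∫ t in a..z, g t) := by
  have hd : ∀ z, HasDerivAt (fun z => ∫ t in a..z, g t) (g z) z := fun z =>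
    intervalIntegral.integral_hasDerivAt_right (hg.continuous.intervalIntegrable _ _)
      hg.continuous.stronglyMeasurable.stronglyMeasurableAtFilter hg.continuous.continuousAt
  rw [contDiff_infty_iff_deriv]
  refine ⟨fun z => (hd z).differentiableAt, ?_⟩
  rwa [show deriv (fun z => ∫ t in a..z, g t) = g from funext fun z => (hd z).deriv]

variable {Θ : ℝ → ℝ} {ε κ : ℝ}

/-- A change of variables exhibits `ψ'_κ(z)` as the mass of `Θ` in a moving window, from which
smoothness, sign and support are read off. -/
lemma psi'_eq (hκ : 0 < κ) (z : ℝ) :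
    psi' Θ κ z = ∫ t in ((z - (1 - κ)) / κ)..((z - (-1 + κ)) / κ), Θ t := by
  unfold psi' mollify
  rw [intervalIntegral.integral_comp_sub_left (fun t => κ⁻¹ * Θ (t / κ)) z,
    intervalIntegral.integral_const_mul, intervalIntegral.integral_comp_div _ hκ.ne', smul_eq_mul,
    ← mul_assoc, inv_mul_cancel₀ hκ.ne', one_mul]

lemma contDiff_psi' (hΘ : IsMollifier Θ) (hκ : 0 < κ) : ContDiff ℝ ∞ (psi' Θ κ) := by
  have h : psi' Θ κ = fun z => (∫ t in (0 : ℝ)..((z - (-1 + κ)) / κ), Θ t)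
      - ∫ t in (0 : ℝ)..((z - (1 - κ)) / κ), Θ t := by
    funext z
    rw [psi'_eq hκ, intervalIntegral.integral_interval_sub_left] <;>
      exact hΘ.smooth.continuous.intervalIntegrable _ _
  rw [h]
  have hP := contDiff_primitive hΘ.smooth 0
  refine ContDiff.sub ?_ ?_
  · exact hP.comp ((contDiff_id.sub contDiff_const).div_const κ)
  · exact hP.comp ((contDiff_id.sub contDiff_const).div_const κ)

lemma psi'_nonneg (hΘ : IsMollifier Θ) (hκ : 0 < κ) (hκ₁ : κ < 1) (z : ℝ) : 0 ≤ psi' Θ κ z := by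
  rw [psi'_eq hκ]
  refine intervalIntegral.integral_nonneg ?_ fun _ _ => hΘ.nonneg _
  gcongr
  linarith

lemma IsMollifier.eq_zero (hΘ : IsMollifier Θ) {z : ℝ} (hz : 1 ≤ |z|) : Θ z = 0 := by
  by_contra h
  have := hΘ.support_subset h
  rw [mem_Ioo, ← abs_lt] at this
  linarith

/-- For `z ≥ 1` the window starts at or to the right of `1`, for `z ≤ -1` it ends at or to the left
of `-1`; either way it misses the support of `Θ`. -/
lemma psi'_eq_zero (hΘ : IsMollifier Θ) (hκ : 0 < κ) (hκ₁ : κ < 1) {z : ℝ} (hz : 1 ≤ |z|) :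
    psi' Θ κ z = 0 := by
  rw [psi'_eq hκ, ← intervalIntegral.integral_zero (a := (z - (1 - κ)) / κ) (b := (z - (-1 + κ)) / κ)]
  refine intervalIntegral.integral_congr fun t ht => ?_
  rw [uIcc_of_le (by gcongr; linarith)] at ht
  refine hΘ.eq_zero ?_
  obtain ⟨h1, h2⟩ := ht
  rw [div_le_iff₀ hκ] at h1
  rw [le_div_iff₀ hκ] at h2
  rcases le_abs'.1 hz with h | h
  · refine le_abs'.2 (Or.inl ?_)
    nlinarith
  · refine le_abs'.2 (Or.inr ?_)
    nlinarith

lemma integral_psi'_pos (hΘ : IsMollifier Θ) (hκ : 0 < κ) (hκ₁ : κ < 1) :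
    0 < ∫ t in (-1 : ℝ)..1, psi' Θ κ t := by
  obtain ⟨z₀, hz₀⟩ : ∃ z, Θ z ≠ 0 := by
    by_contra! h
    have := hΘ.integral_eq_one
    simp [h] at this
  have hz₁ := hΘ.support_subset hz₀
  have hpos : 0 < Θ z₀ := lt_of_le_of_ne (hΘ.nonneg _) (Ne.symm hz₀)
  -- At `κ z₀` the window contains `z₀` in its interior, precisely because `κ < 1`.
  have h1 : 0 < psi' Θ κ (κ * z₀) := by
    rw [psi'_eq hκ]
    have e1 : (κ * z₀ - (1 - κ)) / κ < z₀ := by rw [div_lt_iff₀ hκ]; linarith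
    have e2 : z₀ < (κ * z₀ - (-1 + κ)) / κ := by rw [lt_div_iff₀ hκ]; linarith
    exact intervalIntegral.integral_pos (e1.trans e2) hΘ.smooth.continuous.continuousOn
      (fun _ _ => hΘ.nonneg _) ⟨z₀, ⟨e1.le, e2.le⟩, hpos⟩
  refine intervalIntegral.integral_pos (by norm_num) (contDiff_psi' hΘ hκ).continuous.continuousOn
      (fun _ _ => psi'_nonneg hΘ hκ hκ₁ _) ⟨κ * z₀, ⟨?_, ?_⟩, h1⟩ <;> nlinarith [hz₁.1, hz₁.2]

lemma contDiff_phi (hΘ : IsMollifier Θ) (hκ : 0 < κ) : ContDiff ℝ ∞ (phi Θ κ) :=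
  contDiff_const.sub ((contDiff_primitive (contDiff_psi' hΘ hκ) _).div_const _)

lemma phi_of_le (hΘ : IsMollifier Θ) (hκ : 0 < κ) (hκ₁ : κ < 1) {z : ℝ} (hz : z ≤ -1) :
    phi Θ κ z = 1 := by
  have : ∫ t in (-1)..z, psi' Θ κ t = 0 := by
    rw [← intervalIntegral.integral_zero (a := -1) (b := z)]
    refine intervalIntegral.integral_congr fun t ht => ?_
    rw [uIcc_of_ge hz] at ht
    exact psi'_eq_zero hΘ hκ hκ₁ (le_abs'.2 (Or.inl ht.2))
  simp [phi, this]

lemma phi_of_ge (hΘ : IsMollifier Θ) (hκ : 0 < κ) (hκ₁ : κ < 1) {z : ℝ} (hz : 1 ≤ z) :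
    phi Θ κ z = 0 := by
  have hc := (contDiff_psi' hΘ hκ).continuous
  have : ∫ t in (1)..z, psi' Θ κ t = 0 := by
    rw [← intervalIntegral.integral_zero (a := 1) (b := z)]
    refine intervalIntegral.integral_congr fun t ht => ?_
    rw [uIcc_of_le hz] at ht
    exact psi'_eq_zero hΘ hκ hκ₁ (le_abs'.2 (Or.inr ht.1))
  rw [phi, ← intervalIntegral.integral_add_adjacent_intervals (b := 1)
    (hc.intervalIntegrable _ _) (hc.intervalIntegrable _ _), this, add_zero,
    div_self (integral_psi'_pos hΘ hκ hκ₁).ne', sub_self]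

lemma antitone_phi (hΘ : IsMollifier Θ) (hκ : 0 < κ) (hκ₁ : κ < 1) : Antitone (phi Θ κ) := by
  intro a b hab
  have hc := (contDiff_psi' hΘ hκ).continuous
  unfold phi
  have : 0 ≤ ∫ t in a..b, psi' Θ κ t :=
    intervalIntegral.integral_nonneg hab fun _ _ => psi'_nonneg hΘ hκ hκ₁ _
  have h0 := integral_psi'_pos hΘ hκ hκ₁
  rw [← intervalIntegral.integral_add_adjacent_intervals (a := -1) (b := a) (c := b)
    (hc.intervalIntegrable _ _) (hc.intervalIntegrable _ _), add_div]
  have := div_nonneg this h0.le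
  linarith

lemma phi_mem (hΘ : IsMollifier Θ) (hκ : 0 < κ) (hκ₁ : κ < 1) (z : ℝ) :
    phi Θ κ z ∈ Icc (0 : ℝ) 1 := by
  constructor
  · rw [← phi_of_ge hΘ hκ hκ₁ (le_max_right z 1)]
    exact antitone_phi hΘ hκ hκ₁ (le_max_left _ _)
  · rw [← phi_of_le hΘ hκ hκ₁ (min_le_right z (-1))]
    exact antitone_phi hΘ hκ hκ₁ (min_le_left _ _)

/-- The parameters are admissible. -/
structure Admissible (Θ : ℝ → ℝ) (ε κ : ℝ) : Prop where
  moll : IsMollifier Θ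
  ε_pos : 0 < ε
  ε_lt : ε < 1
  κ_pos : 0 < κ
  κ_lt : κ < 1

/-- `φ_κ` is already `1` left of `-1` and `0` right of `1`, so the three cases of the definition are
one formula, smooth across the edges of the bands. -/
lemma profile_eq (H : Admissible Θ ε κ) (y : ℝ) :
    profile Θ ε κ y = ε * phi Θ κ ((|y| - 1) / ε) := by
  unfold profile
  split_ifs with h1 h2
  · rw [phi_of_ge H.moll H.κ_pos H.κ_lt, mul_zero]
    rw [le_div_iff₀ H.ε_pos]; linarith
  · rfl
  · rw [phi_of_le H.moll H.κ_pos H.κ_lt, mul_one]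
    rw [div_le_iff₀ H.ε_pos]; linarith

lemma profile_mem (H : Admissible Θ ε κ) (y : ℝ) : profile Θ ε κ y ∈ Icc 0 ε := by
  rw [profile_eq H]
  have := phi_mem H.moll H.κ_pos H.κ_lt ((|y| - 1) / ε)
  exact ⟨mul_nonneg H.ε_pos.le this.1, mul_le_of_le_one_right H.ε_pos.le this.2⟩

lemma profile_inner (H : Admissible Θ ε κ) {y : ℝ} (hy : |y| ≤ 1 - ε) :
    profile Θ ε κ y = ε := by
  rw [profile_eq H, phi_of_le H.moll H.κ_pos H.κ_lt, mul_one]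
  rw [div_le_iff₀ H.ε_pos]; linarith

lemma profile_outer (H : Admissible Θ ε κ) {y : ℝ} (hy : 1 + ε ≤ |y|) :
    profile Θ ε κ y = 0 := by
  rw [profile_eq H, phi_of_ge H.moll H.κ_pos H.κ_lt, mul_zero]
  rw [le_div_iff₀ H.ε_pos]; linarith

lemma contDiff_profile (H : Admissible Θ ε κ) : ContDiff ℝ ∞ (profile Θ ε κ) := by
  rw [contDiff_iff_contDiffAt]
  intro y
  -- The only obstruction is `|y|` at the origin, and there `ϖ` is locally the constant `ε`.
  by_cases hy : y = 0
  · have : profile Θ ε κ =ᶠ[𝓝 y] fun _ => ε := by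
      have : {z : ℝ | |z| < 1 - ε} ∈ 𝓝 y := by
        refine (isOpen_lt continuous_abs continuous_const).mem_nhds ?_
        simp [hy, H.ε_lt]
      filter_upwards [this] with z hz using profile_inner H (le_of_lt hz)
    exact contDiffAt_const.congr_of_eventuallyEq this
  · rw [show profile Θ ε κ = fun y => ε * phi Θ κ ((|y| - 1) / ε) from funext (profile_eq H)]
    refine contDiffAt_const.mul ((contDiff_phi H.moll H.κ_pos).contDiffAt.comp y ?_)
    exact ((contDiffAt_abs hy).sub contDiffAt_const).div_const _

lemma hasDerivAt_profile (H : Admissible Θ ε κ) (y : ℝ) :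
    HasDerivAt (profile Θ ε κ) (deriv (profile Θ ε κ) y) y :=
  ((contDiff_profile H).differentiable (by simp) y).hasDerivAt

lemma continuous_deriv_profile (H : Admissible Θ ε κ) : Continuous (deriv (profile Θ ε κ)) :=
  (contDiff_profile H).continuous_deriv (by simp)

lemma mem_bands_iff (H : Admissible Θ ε κ) {y : ℝ} : y ∈ bands ε ↔ 1 - ε ≤ |y| ∧ |y| ≤ 1 + ε := by
  have := H.ε_lt
  have := H.ε_pos
  simp only [bands, mem_union, mem_Icc]
  constructor
  · rintro (h | h)
    · rw [abs_of_neg (by linarith)]; constructor <;> linarith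
    · rw [abs_of_pos (by linarith)]; constructor <;> linarith
  · rintro ⟨h1, h2⟩
    rcases le_total 0 y with h | h
    · rw [abs_of_nonneg h] at *; right; constructor <;> linarith
    · rw [abs_of_nonpos h] at *; left; constructor <;> linarith

lemma interior_bands (H : Admissible Θ ε κ) :
    interior (bands ε) = Ioo (-1 - ε) (-1 + ε) ∪ Ioo (1 - ε) (1 + ε) := by
  have := H.ε_lt
  have := H.ε_pos
  unfold bands
  rw [interior_union_of_disjoint_closure, interior_Icc, interior_Icc]
  rw [isClosed_Icc.closure_eq, isClosed_Icc.closure_eq, Set.disjoint_left]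
  rintro x ⟨_, h1⟩ ⟨h2, _⟩
  linarith

/-- Off the bands `ϖ` is locally constant; the edges follow by continuity of `ϖ'`. Integrals against
`ϖ'` may thus be taken over the open bands, where weak derivatives live. -/
lemma deriv_profile_eq_zero (H : Admissible Θ ε κ) {y : ℝ} (hy : y ∉ interior (bands ε)) :
    deriv (profile Θ ε κ) y = 0 := by
  have he := H.ε_lt
  have he0 := H.ε_pos
  have key : ∀ y ∉ bands ε, deriv (profile Θ ε κ) y = 0 := by
    intro y hy
    rw [mem_bands_iff H, not_and_or, not_le, not_le] at hy
    rcases hy with h | h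
    · have : profile Θ ε κ =ᶠ[𝓝 y] fun _ => ε := by
        filter_upwards [(isOpen_lt continuous_abs continuous_const).mem_nhds h] with z hz using
          profile_inner H (le_of_lt hz)
      rw [this.deriv_eq, deriv_const]
    · have : profile Θ ε κ =ᶠ[𝓝 y] fun _ => 0 := by
        filter_upwards [(isOpen_lt continuous_const continuous_abs).mem_nhds h] with z hz using
          profile_outer H (le_of_lt hz)
      rw [this.deriv_eq, deriv_const]
  have hcl : y ∈ closure (bands ε)ᶜ := by rwa [closure_compl]
  have hclosed : IsClosed {y | deriv (profile Θ ε κ) y = 0} :=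
    isClosed_eq (continuous_deriv_profile H) continuous_const
  exact hclosed.closure_subset_iff.2 (fun y hy => key y hy) hcl

lemma bands_subset (H : Admissible Θ ε κ) : bands ε ⊆ Ioo (-2) 2 := by
  have := H.ε_lt
  have := H.ε_pos
  rintro y (h | h) <;> constructor <;> linarith [h.1, h.2]

lemma isCompact_bands : IsCompact (bands ε) := isCompact_Icc.union isCompact_Icc

lemma exists_lipschitz_profile (H : Admissible Θ ε κ) :
    ∃ C, 0 ≤ C ∧ (∀ y, |deriv (profile Θ ε κ) y| ≤ C) ∧
      ∀ a b, |profile Θ ε κ a - profile Θ ε κ b| ≤ C * |a - b| := by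
  obtain ⟨C, hC⟩ := (isCompact_bands (ε := ε)).exists_bound_of_continuousOn
    (continuous_deriv_profile H).continuousOn
  have hb : ∀ y, ‖deriv (profile Θ ε κ) y‖ ≤ max C 0 := by
    intro y
    by_cases hy : y ∈ bands ε
    · exact (hC y hy).trans (le_max_left _ _)
    · rw [deriv_profile_eq_zero H (fun h => hy (interior_subset h))]
      simp
  refine ⟨max C 0, le_max_right _ _, hb, fun a b => ?_⟩
  have := convex_univ.norm_image_sub_le_of_norm_deriv_le (f := profile Θ ε κ) (x := b) (y := a)
    (fun x _ => (hasDerivAt_profile H x).differentiableAt) (fun x _ => hb x) (mem_univ _)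
    (mem_univ _)
  simpa using this

end

noncomputable section

/-! ### Mollification by product kernels -/

/-- The convolution of `g` with the product kernel `A(x) B(y)`. -/
def smear (g : ℝ × ℝ → ℝ) (A B : ℝ → ℝ) (p : ℝ × ℝ) : ℝ :=
  ∫ q, g q * (A (p.1 - q.1) * B (p.2 - q.2))

lemma integrable_smear {g : ℝ × ℝ → ℝ} (hg : Integrable g) {A B : ℝ → ℝ} (hA : Continuous A)
    (hB : Continuous B) {CA CB : ℝ} (hCA : ∀ t, |A t| ≤ CA) (hCB : ∀ t, |B t| ≤ CB) (p : ℝ × ℝ) :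
    Integrable fun q : ℝ × ℝ => g q * (A (p.1 - q.1) * B (p.2 - q.2)) := by
  refine hg.mul_bdd (c := CA * CB) (by fun_prop) (ae_of_all _ fun q => ?_)
  rw [norm_mul]
  exact mul_le_mul (hCA _) (hCB _) (norm_nonneg _) ((abs_nonneg _).trans (hCA 0))

lemma continuous_smear {g : ℝ × ℝ → ℝ} (hg : Integrable g) {A B : ℝ → ℝ} (hA : Continuous A)
    (hB : Continuous B) {CA CB : ℝ} (hCA : ∀ t, |A t| ≤ CA) (hCB : ∀ t, |B t| ≤ CB) :
    Continuous (smear g A B) := by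
  refine continuous_of_dominated (bound := fun q => ‖g q‖ * (CA * CB))
    (fun p => (integrable_smear hg hA hB hCA hCB p).aestronglyMeasurable) (fun p => ae_of_all _ fun q => ?_)
    (hg.norm.mul_const _) (ae_of_all _ fun q => by fun_prop)
  rw [norm_mul, norm_mul]
  gcongr
  · exact (abs_nonneg _).trans (hCA 0)
  · exact hCA _
  · exact hCB _

lemma hasDerivAt_smear_fst {g : ℝ × ℝ → ℝ} (hg : Integrable g) {A A' B : ℝ → ℝ}
    (hA : ∀ t, HasDerivAt A (A' t) t) (hA' : Continuous A') (hB : Continuous B) {CA CA' CB : ℝ}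
    (hCA : ∀ t, |A t| ≤ CA) (hCA' : ∀ t, |A' t| ≤ CA') (hCB : ∀ t, |B t| ≤ CB) (x y : ℝ) :
    HasDerivAt (fun s => smear g A B (s, y)) (smear g A' B (x, y)) x := by
  have hAc : Continuous A := continuous_iff_continuousAt.2 fun t => (hA t).continuousAt
  refine (hasDerivAt_integral_of_dominated_loc_of_deriv_le (bound := fun q => ‖g q‖ * (CA' * CB))
    (F' := fun s q => g q * (A' (s - q.1) * B (y - q.2))) (s := univ) univ_mem
    (Eventually.of_forall fun s => (integrable_smear hg hAc hB hCA hCB (s, y)).aestronglyMeasurable)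
    (integrable_smear hg hAc hB hCA hCB (x, y))
    (integrable_smear hg hA' hB hCA' hCB (x, y)).aestronglyMeasurable
    (ae_of_all _ fun q s _ => ?_) (hg.norm.mul_const _) (ae_of_all _ fun q s _ => ?_)).2
  · rw [norm_mul, norm_mul]
    gcongr
    · exact (abs_nonneg _).trans (hCA' 0)
    · exact hCA' _
    · exact hCB _
  · exact (((hA (s - q.1)).comp_sub_const s q.1).mul_const (B (y - q.2))).const_mul (g q)

lemma hasDerivAt_smear_snd {g : ℝ × ℝ → ℝ} (hg : Integrable g) {A B B' : ℝ → ℝ}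
    (hB : ∀ t, HasDerivAt B (B' t) t) (hB' : Continuous B') (hA : Continuous A) {CA CB CB' : ℝ}
    (hCA : ∀ t, |A t| ≤ CA) (hCB' : ∀ t, |B' t| ≤ CB') (hCB : ∀ t, |B t| ≤ CB) (x y : ℝ) :
    HasDerivAt (fun s => smear g A B (x, s)) (smear g A B' (x, y)) y := by
  have hBc : Continuous B := continuous_iff_continuousAt.2 fun t => (hB t).continuousAt
  refine (hasDerivAt_integral_of_dominated_loc_of_deriv_le (bound := fun q => ‖g q‖ * (CA * CB'))
    (F' := fun s q => g q * (A (x - q.1) * B' (s - q.2))) (s := univ) univ_mem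
    (Eventually.of_forall fun s => (integrable_smear hg hA hBc hCA hCB (x, s)).aestronglyMeasurable)
    (integrable_smear hg hA hBc hCA hCB (x, y))
    (integrable_smear hg hA hB' hCA hCB' (x, y)).aestronglyMeasurable
    (ae_of_all _ fun q s _ => ?_) (hg.norm.mul_const _) (ae_of_all _ fun q s _ => ?_)).2
  · rw [norm_mul, norm_mul]
    gcongr
    · exact (abs_nonneg _).trans (hCA 0)
    · exact hCA _
    · exact hCB' _
  · exact (((hB (s - q.2)).comp_sub_const s q.2).const_mul (A (x - q.1))).const_mul (g q)

/-- Pointwise bound by `W^{1,1}` in one variable. -/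
lemma abs_le_integral_add {v v' : ℝ → ℝ} {a b K : ℝ} (hab : a < b) (hK : 1 ≤ K * (b - a))
    (hK1 : 1 ≤ K) (hv : ∀ t, HasDerivAt v (v' t) t) (hv' : Continuous v') {x : ℝ}
    (hx : x ∈ Icc a b) : |v x| ≤ K * ∫ s in a..b, (|v s| + |v' s|) := by
  have hvc : Continuous v := continuous_iff_continuousAt.2 fun t => (hv t).continuousAt
  have h1 : ∀ s ∈ Icc a b, |v x| ≤ |v s| + ∫ s in a..b, |v' s| := by
    intro s hs
    have e : v x - v s = ∫ t in s..x, v' t :=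
      (intervalIntegral.integral_eq_sub_of_hasDerivAt (fun t _ => hv t)
        (hv'.intervalIntegrable _ _)).symm
    have e2 : |∫ t in s..x, v' t| ≤ ∫ s in a..b, |v' s| := by
      refine (intervalIntegral.norm_integral_le_abs_integral_norm (f := v')).trans ?_
      rw [abs_le]
      have hm : ∀ c d, a ≤ c → d ≤ b → c ≤ d →
          ∫ t in c..d, |v' t| ≤ ∫ t in a..b, |v' t| := fun c d h1 h2 h3 =>
        intervalIntegral.integral_mono_interval h1 h3 h2 (ae_of_all _ fun _ => abs_nonneg _)
          (hv'.abs.intervalIntegrable _ _)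
      have h0 : 0 ≤ ∫ t in a..b, |v' t| :=
        intervalIntegral.integral_nonneg hab.le fun _ _ => abs_nonneg _
      rcases le_total s x with h | h
      · have hn : 0 ≤ ∫ t in s..x, |v' t| :=
          intervalIntegral.integral_nonneg h fun _ _ => abs_nonneg _
        exact ⟨by simp only [Real.norm_eq_abs]; linarith, hm _ _ hs.1 hx.2 h⟩
      · have hn : 0 ≤ ∫ t in x..s, |v' t| :=
          intervalIntegral.integral_nonneg h fun _ _ => abs_nonneg _
        have := hm _ _ hx.1 hs.2 h
        rw [intervalIntegral.integral_symm x s]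
        simp only [Real.norm_eq_abs]
        exact ⟨by linarith, by linarith⟩
    have : v x = v s + ∫ t in s..x, v' t := by linarith
    rw [this]
    exact (abs_add_le _ _).trans (by linarith)
  -- Averaging over the reference point `s` replaces the unknown value `|v s|` by an `L¹` norm.
  have h2 : (b - a) * |v x| ≤ ∫ s in a..b, (|v s| + ∫ s in a..b, |v' s|) := by
    have := intervalIntegral.integral_mono_on (μ := volume) hab.le (f := fun _ => |v x|)
      (g := fun s => |v s| + ∫ s in a..b, |v' s|) (by simp)
      ((hvc.abs.add continuous_const).intervalIntegrable _ _) h1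
    simpa using this
  rw [intervalIntegral.integral_add (hvc.abs.intervalIntegrable _ _) (by simp)] at h2
  rw [intervalIntegral.integral_add (hvc.abs.intervalIntegrable _ _)
    (hv'.abs.intervalIntegrable _ _)]
  have hba : 0 < b - a := by linarith
  simp only [intervalIntegral.integral_const, smul_eq_mul] at h2
  have hi1 : 0 ≤ ∫ t in a..b, |v t| :=
    intervalIntegral.integral_nonneg hab.le fun _ _ => abs_nonneg _
  have hi2 : 0 ≤ ∫ t in a..b, |v' t| :=
    intervalIntegral.integral_nonneg hab.le fun _ _ => abs_nonneg _
  have hKp : 0 < K := by linarith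
  set I := ∫ t in a..b, |v t|
  set I' := ∫ t in a..b, |v' t|
  have h3 : |v x| - I' ≤ K * I := by
    have : (b - a) * (|v x| - I') ≤ I := by linarith
    by_cases hs : |v x| - I' ≤ 0
    · exact hs.trans (by positivity)
    · push Not at hs
      nlinarith
  nlinarith

/-- Pointwise bound by the `L¹` norms of the function, its first derivatives and its mixed
derivative. -/
lemma abs_le_integral_integral {u ux uy uxy : ℝ × ℝ → ℝ} {a b c d K : ℝ} (hab : a < b) (hcd : c < d)
    (hK1 : 1 ≤ K) (hKab : 1 ≤ K * (b - a)) (hKcd : 1 ≤ K * (d - c))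
    (hx : ∀ x y, HasDerivAt (fun s => u (s, y)) (ux (x, y)) x)
    (hy : ∀ x y, HasDerivAt (fun s => u (x, s)) (uy (x, y)) y)
    (hxy : ∀ x y, HasDerivAt (fun s => ux (x, s)) (uxy (x, y)) y)
    (hu : Continuous u) (hux : Continuous ux) (huy : Continuous uy) (huxy : Continuous uxy)
    {x y : ℝ} (hxm : x ∈ Icc a b) (hym : y ∈ Icc c d) :
    |u (x, y)| ≤ K ^ 2 * ∫ s in a..b, ∫ t in c..d,
      (|u (s, t)| + |uy (s, t)| + |ux (s, t)| + |uxy (s, t)|) := by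
  refine (abs_le_integral_add (v' := fun s => ux (s, y)) hab hKab hK1 (fun t => hx t y)
    (by fun_prop) hxm).trans ?_
  rw [pow_two, mul_assoc]
  refine mul_le_mul_of_nonneg_left ?_ (by linarith)
  rw [← intervalIntegral.integral_const_mul]
  refine intervalIntegral.integral_mono_on hab.le (Continuous.intervalIntegrable (by fun_prop) _ _)
    (Continuous.intervalIntegrable ?_ _ _) fun s hs => ?_
  · exact continuous_const.mul (intervalIntegral.continuous_parametric_intervalIntegral_of_continuous'
      (f := fun s t => |u (s, t)| + |uy (s, t)| + |ux (s, t)| + |uxy (s, t)|) (by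
        simp only [Function.uncurry_def]; fun_prop) _ _)
  · have h1 := abs_le_integral_add (v := fun t => u (s, t)) (v' := fun t => uy (s, t)) hcd hKcd hK1
      (fun t => hy s t) (by fun_prop) hym
    have h2 := abs_le_integral_add (v := fun t => ux (s, t)) (v' := fun t => uxy (s, t)) hcd hKcd hK1
      (fun t => hxy s t) (by fun_prop) hym
    refine (add_le_add h1 h2).trans (le_of_eq ?_)
    rw [← mul_add, ← intervalIntegral.integral_add]
    · simp only [add_assoc]
    · exact Continuous.intervalIntegrable (by fun_prop) _ _
    · exact Continuous.intervalIntegrable (by fun_prop) _ _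

/-- `L¹` bound for a mollification. -/
lemma integral_integral_abs_smear_le {g : ℝ × ℝ → ℝ} (hg : Integrable g) {A : ℝ → ℝ}
    (hA : Continuous A) {CA : ℝ} (hCA : ∀ t, |A t| ≤ CA) (hA0 : ∀ t, 0 ≤ A t) (hAi : Integrable A)
    (hA1 : ∫ t, A t = 1) {a b c d : ℝ} (hab : a ≤ b) (hcd : c ≤ d) :
    ∫ s in a..b, ∫ t in c..d, |smear g A A (s, t)| ≤ ∫ q, |g q| := by
  have hc := continuous_smear hg hA hA hCA hCA
  have hprod : Integrable fun q : ℝ × ℝ => A q.1 * A q.2 := hAi.mul_prod hAi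
  have hconv : Integrable fun z : (ℝ × ℝ) × (ℝ × ℝ) =>
      |g z.2| * (A (z.1.1 - z.2.1) * A (z.1.2 - z.2.2)) := by
    have := Integrable.convolution_integrand (ContinuousLinearMap.mul ℝ ℝ) hg.abs hprod
    simp only [ContinuousLinearMap.mul_apply', Prod.fst_sub, Prod.snd_sub] at this
    exact this
  calc ∫ s in a..b, ∫ t in c..d, |smear g A A (s, t)|
      = ∫ p in Ioc a b ×ˢ Ioc c d, |smear g A A p| := by
        rw [intervalIntegral.integral_of_le hab, Measure.volume_eq_prod, setIntegral_prod]
        · simp only [intervalIntegral.integral_of_le hcd]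
        · have : IntegrableOn (fun p => |smear g A A p|) (Icc a b ×ˢ Icc c d)
              (volume.prod volume) :=
            hc.abs.continuousOn.integrableOn_compact (isCompact_Icc.prod isCompact_Icc)
          exact this.mono_set (prod_mono Ioc_subset_Icc_self Ioc_subset_Icc_self)
    _ ≤ ∫ p in Ioc a b ×ˢ Ioc c d, ∫ q, |g q| * (A (p.1 - q.1) * A (p.2 - q.2)) := by
        refine integral_mono_of_nonneg (ae_of_all _ fun _ => abs_nonneg _)
          hconv.integral_prod_left.integrableOn (ae_of_all _ fun p => ?_)
        refine (abs_integral_le_integral_abs).trans (le_of_eq ?_)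
        refine integral_congr_ae (ae_of_all _ fun q => ?_)
        simp only [abs_mul, abs_of_nonneg (hA0 _)]
    _ ≤ ∫ p : ℝ × ℝ, ∫ q, |g q| * (A (p.1 - q.1) * A (p.2 - q.2)) := by
        refine setIntegral_le_integral hconv.integral_prod_left (ae_of_all _ fun p => ?_)
        exact integral_nonneg fun q => mul_nonneg (abs_nonneg _) (mul_nonneg (hA0 _) (hA0 _))
    _ = ∫ q, |g q| := by
        rw [integral_integral_swap hconv]
        refine integral_congr_ae (ae_of_all _ fun q => ?_)
        simp only
        rw [integral_const_mul, Measure.volume_eq_prod,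
          integral_prod_mul (fun x => A (x - q.1)) (fun y => A (y - q.2)),
          integral_sub_right_eq_self, integral_sub_right_eq_self, hA1]
        simp

end

noncomputable section

/-! ### Interior Sobolev estimates -/

lemma exists_abs_iteratedDeriv_le {A : ℝ → ℝ} (hA : ContDiff ℝ ∞ A) (hc : HasCompactSupport A)
    (n : ℕ) : ∃ C, ∀ t, |iteratedDeriv n A t| ≤ C := by
  have : HasCompactSupport (iteratedDeriv n A) := by
    induction n with
    | zero => simpa using hc
    | succ n ih => rw [iteratedDeriv_succ]; exact ih.deriv
  exact this.exists_bound_of_continuous (hA.continuous_iteratedDeriv n (by exact_mod_cast le_top))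

lemma hasDerivAt_iteratedDeriv {A : ℝ → ℝ} (hA : ContDiff ℝ ∞ A) (n : ℕ) (t : ℝ) :
    HasDerivAt (iteratedDeriv n A) (iteratedDeriv (n + 1) A t) t := by
  rw [iteratedDeriv_succ]
  exact (hA.differentiable_iteratedDeriv n (by exact_mod_cast WithTop.coe_lt_top _) t).hasDerivAt

lemma iteratedDeriv_const_sub_comp (n : ℕ) (A : ℝ → ℝ) (x s : ℝ) :
    iteratedDeriv n (fun s => A (x - s)) s = (-1) ^ n * iteratedDeriv n A (x - s) := by
  have h : (fun s => A (x - s)) = fun s => (fun u => A (x + u)) (-s) := by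
    funext s; simp [sub_eq_add_neg]
  rw [h, iteratedDeriv_comp_neg n (fun u => A (x + u)), iteratedDeriv_comp_const_add, smul_eq_mul,
    sub_eq_add_neg]

lemma mixedDeriv_prod (A : ℝ → ℝ) (i j : ℕ) (p q : ℝ × ℝ) :
    mixedDeriv i j (fun q => A (p.1 - q.1) * A (p.2 - q.2)) q
      = (-1) ^ (i + j) * (iteratedDeriv i A (p.1 - q.1) * iteratedDeriv j A (p.2 - q.2)) := by
  unfold mixedDeriv
  simp only [iteratedDeriv_const_mul_field]
  rw [show (fun s => A (p.1 - s) * iteratedDeriv j (fun t => A (p.2 - t)) q.2)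
    = fun s => iteratedDeriv j (fun t => A (p.2 - t)) q.2 * A (p.1 - s) from
      funext fun s => mul_comm _ _, iteratedDeriv_const_mul_field,
    iteratedDeriv_const_sub_comp, iteratedDeriv_const_sub_comp, pow_add]
  ring

/-- The weak derivative relation on an open set `W`. -/
def WeakOn (W : Set (ℝ × ℝ)) (i j : ℕ) (g d : ℝ × ℝ → ℝ) : Prop :=
  ∀ φ : ℝ × ℝ → ℝ, ContDiff ℝ ∞ φ → HasCompactSupport φ → tsupport φ ⊆ W →
      ∫ p, g p * mixedDeriv i j φ p = (-1) ^ (i + j) * ∫ p, d p * φ p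

lemma mixedDeriv_eq_zero {φ : ℝ × ℝ → ℝ} {p : ℝ × ℝ} (hp : p ∉ tsupport φ) (i j : ℕ) :
    mixedDeriv i j φ p = 0 := by
  have h0 : φ =ᶠ[𝓝 p] 0 := notMem_tsupport_iff_eventuallyEq.1 hp
  have h1 : ∀ᶠ s in 𝓝 p.1, iteratedDeriv j (fun t => φ (s, t)) p.2 = 0 := by
    have h0' : ∀ᶠ z in 𝓝 p.1 ×ˢ 𝓝 p.2, φ z = 0 := by rw [← nhds_prod_eq]; exact h0
    filter_upwards [h0'.curry] with s hs
    have : (fun t => φ (s, t)) =ᶠ[𝓝 p.2] fun _ => 0 := hs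
    rw [this.iteratedDeriv_eq]
    simp
  have h2 : (fun s => iteratedDeriv j (fun t => φ (s, t)) p.2) =ᶠ[𝓝 p.1] fun _ => 0 := h1
  unfold mixedDeriv
  rw [h2.iteratedDeriv_eq]
  simp

/-- Mollification turns weak derivatives into classical ones. -/
lemma smear_iteratedDeriv {W : Set (ℝ × ℝ)} {i j : ℕ} {g d : ℝ × ℝ → ℝ}
    (hw : WeakOn W i j g d) (φ : ContDiffBump (0 : ℝ)) {p : ℝ × ℝ}
    (hp : Metric.closedBall p φ.rOut ⊆ W) :
    smear (W.indicator g) (iteratedDeriv i (φ.normed volume)) (iteratedDeriv j (φ.normed volume)) p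
      = smear (W.indicator d) (φ.normed volume) (φ.normed volume) p := by
  set A := φ.normed volume
  -- Mollification at `p` is testing against this reflected kernel. The sign `(-1)^(i+j)` produced
  -- by the reflection cancels the one in the definition of the weak derivative.
  set T : ℝ × ℝ → ℝ := fun q => A (p.1 - q.1) * A (p.2 - q.2)
  have hAs : ContDiff ℝ ∞ A := φ.contDiff_normed
  have hT : ContDiff ℝ ∞ T :=
    (hAs.comp (contDiff_const.sub contDiff_fst)).mul (hAs.comp (contDiff_const.sub contDiff_snd))
  have hsupp : Function.support T ⊆ Metric.closedBall p φ.rOut := by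
    intro q hq
    have h1 : A (p.1 - q.1) ≠ 0 := left_ne_zero_of_mul hq
    have h2 : A (p.2 - q.2) ≠ 0 := right_ne_zero_of_mul hq
    have e1 : p.1 - q.1 ∈ Metric.ball (0 : ℝ) φ.rOut := by
      rw [← φ.support_normed_eq (μ := volume)]; exact h1
    have e2 : p.2 - q.2 ∈ Metric.ball (0 : ℝ) φ.rOut := by
      rw [← φ.support_normed_eq (μ := volume)]; exact h2
    rw [mem_ball_zero_iff, Real.norm_eq_abs, abs_sub_comm] at e1 e2
    rw [Metric.mem_closedBall, Prod.dist_eq, Real.dist_eq, Real.dist_eq]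
    exact max_le e1.le e2.le
  have hts : tsupport T ⊆ Metric.closedBall p φ.rOut :=
    closure_minimal hsupp Metric.isClosed_closedBall
  have hcs : HasCompactSupport T :=
    (isCompact_closedBall p φ.rOut).of_isClosed_subset (isClosed_tsupport _) hts
  have key := hw T hT hcs (hts.trans hp)
  have e1 : ∫ q, g q * mixedDeriv i j T q
      = (-1) ^ (i + j) * smear (W.indicator g) (iteratedDeriv i A) (iteratedDeriv j A) p := by
    unfold smear
    rw [← integral_const_mul]
    refine integral_congr_ae (ae_of_all _ fun q => ?_)
    simp only
    by_cases hq : q ∈ W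
    · rw [indicator_of_mem hq, mixedDeriv_prod]; ring
    · rw [indicator_of_notMem hq, mixedDeriv_eq_zero (fun h => hq (hp (hts h)))]; ring
  have e2 : ∫ q, d q * T q = smear (W.indicator d) A A p := by
    unfold smear
    refine integral_congr_ae (ae_of_all _ fun q => ?_)
    simp only
    by_cases hq : q ∈ W
    · rw [indicator_of_mem hq]
    · rw [indicator_of_notMem hq, image_eq_zero_of_notMem_tsupport (fun h => hq (hp (hts h)))]; ring
  rw [e1, e2] at key
  exact mul_left_cancel₀ (pow_ne_zero _ (by norm_num)) key

/-- The kernel is a probability density supported in the ball of radius `rOut`, so the mollification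
is an average of nearby values. -/
lemma smear_sub_abs_le {g : ℝ × ℝ → ℝ} (hg : Integrable g) (φ : ContDiffBump (0 : ℝ)) {p : ℝ × ℝ}
    {η : ℝ} (hη : ∀ q ∈ Metric.ball p φ.rOut, |g q - g p| ≤ η) :
    |smear g (φ.normed volume) (φ.normed volume) p - g p| ≤ η := by
  set A := φ.normed volume
  have hAc : Continuous A := φ.continuous_normed
  have hA0 : ∀ t, 0 ≤ A t := fun t => φ.nonneg_normed t
  obtain ⟨C, hC⟩ := φ.hasCompactSupport_normed (μ := volume).exists_bound_of_continuous hAc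
  have hAi : Integrable A := φ.integrable_normed
  have h1 : Integrable fun q : ℝ × ℝ => A (p.1 - q.1) * A (p.2 - q.2) :=
    (hAi.comp_sub_left p.1).mul_prod (hAi.comp_sub_left p.2)
  have h2 : ∫ q : ℝ × ℝ, A (p.1 - q.1) * A (p.2 - q.2) = 1 := by
    rw [Measure.volume_eq_prod, integral_prod_mul (fun x => A (p.1 - x)) (fun y => A (p.2 - y)),
      integral_sub_left_eq_self, integral_sub_left_eq_self, φ.integral_normed, mul_one]
  have h3 : smear g A A p - g p = ∫ q : ℝ × ℝ, (g q - g p) * (A (p.1 - q.1) * A (p.2 - q.2)) := by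
    simp only [sub_mul]
    rw [integral_sub (integrable_smear hg hAc hAc hC hC p) (h1.const_mul _), integral_const_mul, h2,
      mul_one]
    rfl
  rw [h3, ← Real.norm_eq_abs]
  refine (norm_integral_le_of_norm_le (h1.const_mul η) (ae_of_all _ fun q => ?_)).trans
    (by rw [integral_const_mul, h2, mul_one])
  have hnn : 0 ≤ A (p.1 - q.1) * A (p.2 - q.2) := mul_nonneg (hA0 _) (hA0 _)
  rw [norm_mul, Real.norm_of_nonneg hnn]
  by_cases hq : q ∈ Metric.ball p φ.rOut
  · exact mul_le_mul_of_nonneg_right (hη q hq) hnn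
  · have : A (p.1 - q.1) * A (p.2 - q.2) = 0 := by
      by_contra hne
      apply hq
      have e1 : p.1 - q.1 ∈ Metric.ball (0 : ℝ) φ.rOut := by
        rw [← φ.support_normed_eq (μ := volume)]; exact left_ne_zero_of_mul hne
      have e2 : p.2 - q.2 ∈ Metric.ball (0 : ℝ) φ.rOut := by
        rw [← φ.support_normed_eq (μ := volume)]; exact right_ne_zero_of_mul hne
      rw [mem_ball_zero_iff, Real.norm_eq_abs, abs_sub_comm] at e1 e2
      rw [Metric.mem_ball, Prod.dist_eq, Real.dist_eq, Real.dist_eq]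
      exact max_lt e1 e2
    rw [this]; simp

end

/-! ### Sobolev estimates in one strip, uniform in the mollification radius. -/

noncomputable section

/-- Three periods of a strip. -/
def window (α β : ℝ) : Set (ℝ × ℝ) := Ioo (-(3 * Real.pi)) (3 * Real.pi) ×ˢ Ioo α β

lemma measurableSet_window (α β : ℝ) : MeasurableSet (window α β) :=
  measurableSet_Ioo.prod measurableSet_Ioo

/-- The `L¹` bound for a function, its first derivatives and its mixed derivative is applied to
derivatives of the mollification on a slightly smaller rectangle. There each of them is the
mollification of a weak derivative, hence has `L¹` norm at most `N`; there are four. Since `rOut ≤ ε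
/ 4`, the height `2ε - 4 rOut` is at least `ε`, which gives the factor `1 / ε`. The margin `2 rOut`
keeps closed balls of radius `rOut` inside the open window. -/
lemma abs_smear_le {ε α β N : ℝ} (hε : 0 < ε) (hε1 : ε < 1) (hαβ : β - α = 2 * ε)
    {g : ℝ × ℝ → ℝ} {d : ℕ × ℕ → ℝ × ℝ → ℝ} (hg : IntegrableOn g (window α β))
    (hd : ∀ n ∈ h43Orders, IntegrableOn (d n) (window α β))
    (hN : ∀ n ∈ h43Orders, ∫ q in window α β, |d n q| ≤ N)
    (hw : ∀ n ∈ h43Orders, WeakOn (window α β) n.1 n.2 g (d n)) (φ : ContDiffBump (0 : ℝ))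
    (hφ : φ.rOut ≤ ε / 4) {i j : ℕ} (h00 : (i, j) ∈ h43Orders) (h01 : (i, j + 1) ∈ h43Orders)
    (h10 : (i + 1, j) ∈ h43Orders) (h11 : (i + 1, j + 1) ∈ h43Orders) {x y : ℝ}
    (hx : x ∈ Icc (-(2 * Real.pi)) (2 * Real.pi)) (hy : y ∈ Icc (α + 2 * φ.rOut) (β - 2 * φ.rOut)) :
    |smear ((window α β).indicator g) (iteratedDeriv i (φ.normed volume))
      (iteratedDeriv j (φ.normed volume)) (x, y)| ≤ (1 / ε) ^ 2 * (4 * N) := by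
  have hpi := Real.pi_gt_three
  have hr := φ.rOut_pos
  set A := φ.normed volume with hA
  have hAs : ContDiff ℝ ∞ A := φ.contDiff_normed
  have hAc : Continuous A := φ.continuous_normed
  have hg0 : Integrable ((window α β).indicator g) := hg.integrable_indicator (measurableSet_window _ _)
  choose C hC using exists_abs_iteratedDeriv_le hAs φ.hasCompactSupport_normed
  have hAn : ∀ n, Continuous (iteratedDeriv n A) := fun n =>
    hAs.continuous_iteratedDeriv n (by exact_mod_cast le_top)
  set u : ℕ → ℕ → ℝ × ℝ → ℝ := fun i j =>
    smear ((window α β).indicator g) (iteratedDeriv i A) (iteratedDeriv j A) with hu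
  have huc : ∀ i j, Continuous (u i j) := fun i j =>
    continuous_smear hg0 (hAn i) (hAn j) (hC i) (hC j)
  have hux : ∀ i j x y, HasDerivAt (fun s => u i j (s, y)) (u (i + 1) j (x, y)) x := fun i j x y =>
    hasDerivAt_smear_fst hg0 (hasDerivAt_iteratedDeriv hAs i) (hAn _) (hAn j) (hC i) (hC _) (hC j) x y
  have huy : ∀ i j x y, HasDerivAt (fun s => u i j (x, s)) (u i (j + 1) (x, y)) y := fun i j x y =>
    hasDerivAt_smear_snd hg0 (hasDerivAt_iteratedDeriv hAs j) (hAn _) (hAn i) (hC i) (hC _) (hC j) x y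
  have hl1 : -(2 * Real.pi) < 2 * Real.pi := by linarith
  have hl2 : α + 2 * φ.rOut < β - 2 * φ.rOut := by linarith
  have hK1 : 1 ≤ 1 / ε := by rw [le_div_iff₀ hε]; linarith
  have hK2 : 1 ≤ 1 / ε * (2 * Real.pi - -(2 * Real.pi)) := by nlinarith
  have hK3 : 1 ≤ 1 / ε * (β - 2 * φ.rOut - (α + 2 * φ.rOut)) := by
    rw [one_div, inv_mul_eq_div, le_div_iff₀ hε]; linarith
  have main := abs_le_integral_integral hl1 hl2 hK1 hK2 hK3 (hux i j) (huy i j) (huy (i + 1) j)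
    (huc _ _) (huc _ _) (huc _ _) (huc _ _) hx hy
  refine main.trans (mul_le_mul_of_nonneg_left ?_ (by positivity))
  have hone : ∀ n ∈ h43Orders, ∫ s in (-(2 * Real.pi))..(2 * Real.pi),
      ∫ t in (α + 2 * φ.rOut)..(β - 2 * φ.rOut), |u n.1 n.2 (s, t)| ≤ N := by
    intro n hn
    have hd0 : Integrable ((window α β).indicator (d n)) :=
      (hd n hn).integrable_indicator (measurableSet_window _ _)
    have hCA : ∀ t, |A t| ≤ C 0 := by simpa using hC 0
    calc _ = ∫ s in (-(2 * Real.pi))..(2 * Real.pi), ∫ t in (α + 2 * φ.rOut)..(β - 2 * φ.rOut),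
          |smear ((window α β).indicator (d n)) A A (s, t)| := by
          refine intervalIntegral.integral_congr fun s hs => intervalIntegral.integral_congr fun t ht => ?_
          rw [uIcc_of_le hl1.le] at hs
          rw [uIcc_of_le hl2.le] at ht
          show |smear ((window α β).indicator g) (iteratedDeriv n.1 A) (iteratedDeriv n.2 A) (s, t)| = _
          rw [smear_iteratedDeriv (hw n hn) φ]
          intro q hq
          rw [Metric.mem_closedBall, Prod.dist_eq, max_le_iff, Real.dist_eq, Real.dist_eq, abs_le,
            abs_le] at hq
          simp only at hq
          refine ⟨⟨?_, ?_⟩, ⟨?_, ?_⟩⟩ <;> linarith [hs.1, hs.2, ht.1, ht.2, hq.1.1, hq.1.2, hq.2.1, hq.2.2]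
      _ ≤ ∫ q, |(window α β).indicator (d n) q| :=
          integral_integral_abs_smear_le hd0 hAc hCA (fun t => φ.nonneg_normed t) φ.integrable_normed
            φ.integral_normed hl1.le hl2.le
      _ ≤ N := by
          refine le_trans (le_of_eq ?_) (hN n hn)
          rw [← integral_indicator (measurableSet_window _ _)]
          refine integral_congr_ae (ae_of_all _ fun q => ?_)
          by_cases hq : q ∈ window α β <;> simp [hq]
  have hc : ∀ i j s, IntervalIntegrable (fun t => |u i j (s, t)|) volume
      (α + 2 * φ.rOut) (β - 2 * φ.rOut) := fun i j s =>
    Continuous.intervalIntegrable (((huc i j).comp (by fun_prop)).abs) _ _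
  have hc2 : ∀ i j, IntervalIntegrable (fun s => ∫ t in (α + 2 * φ.rOut)..(β - 2 * φ.rOut),
      |u i j (s, t)|) volume (-(2 * Real.pi)) (2 * Real.pi) := fun i j =>
    Continuous.intervalIntegrable (intervalIntegral.continuous_parametric_intervalIntegral_of_continuous'
      (f := fun s t => |u i j (s, t)|) ((huc i j).abs) _ _) _ _
  have e : ∀ s, ∫ t in (α + 2 * φ.rOut)..(β - 2 * φ.rOut), (|u i j (s, t)| + |u i (j + 1) (s, t)|
      + |u (i + 1) j (s, t)| + |u (i + 1) (j + 1) (s, t)|)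
      = (∫ t in (α + 2 * φ.rOut)..(β - 2 * φ.rOut), |u i j (s, t)|)
      + (∫ t in (α + 2 * φ.rOut)..(β - 2 * φ.rOut), |u i (j + 1) (s, t)|)
      + (∫ t in (α + 2 * φ.rOut)..(β - 2 * φ.rOut), |u (i + 1) j (s, t)|)
      + (∫ t in (α + 2 * φ.rOut)..(β - 2 * φ.rOut), |u (i + 1) (j + 1) (s, t)|) := by
    intro s
    rw [intervalIntegral.integral_add (((hc _ _ s).add (hc _ _ s)).add (hc _ _ s)) (hc _ _ s),
      intervalIntegral.integral_add ((hc _ _ s).add (hc _ _ s)) (hc _ _ s),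
      intervalIntegral.integral_add (hc _ _ s) (hc _ _ s)]
  simp only [e]
  rw [intervalIntegral.integral_add (((hc2 _ _).add (hc2 _ _)).add (hc2 _ _)) (hc2 _ _),
      intervalIntegral.integral_add ((hc2 _ _).add (hc2 _ _)) (hc2 _ _),
      intervalIntegral.integral_add (hc2 _ _) (hc2 _ _)]
  have := hone _ h00
  have := hone _ h01
  have := hone _ h10
  have := hone _ h11
  simp only at *
  linarith

/-- The bumps of radius `1 / (k + 1)`. -/
def bump (k : ℕ) : ContDiffBump (0 : ℝ) where
  rIn := 1 / (k + 1) / 2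
  rOut := 1 / (k + 1)
  rIn_pos := by positivity
  rIn_lt_rOut := half_lt_self (by positivity)

lemma eventually_bump_lt {r : ℝ} (hr : 0 < r) : ∀ᶠ k in atTop, (bump k).rOut < r :=
  tendsto_one_div_add_atTop_nhds_zero_nat.eventually_lt_const hr

lemma abs_sub_le_of_hasDerivAt {v v' : ℝ → ℝ} {C : ℝ} {s t : ℝ}
    (hv : ∀ r ∈ uIcc s t, HasDerivAt v (v' r) r) (hC : ∀ r ∈ uIcc s t, |v' r| ≤ C) :
    |v t - v s| ≤ C * |t - s| := by
  have := (convex_uIcc s t).norm_image_sub_le_of_norm_hasDerivWithin_le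
    (fun r hr => (hv r hr).hasDerivWithinAt) hC left_mem_uIcc right_mem_uIcc
  simpa using this

/-- A first-order expansion whose error depends only on a bound for `v''`: it survives pointwise
limits of `v` and `v'`, and so identifies the limit of `v'` as a derivative. -/
lemma abs_taylor_le {v v' v'' : ℝ → ℝ} {C : ℝ} {s t : ℝ}
    (hv : ∀ r ∈ uIcc s t, HasDerivAt v (v' r) r) (hv' : ∀ r ∈ uIcc s t, HasDerivAt v' (v'' r) r)
    (hC : ∀ r ∈ uIcc s t, |v'' r| ≤ C) :
    |v t - v s - v' s * (t - s)| ≤ C * |t - s| ^ 2 := by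
  have h0 : 0 ≤ C := (abs_nonneg _).trans (hC s left_mem_uIcc)
  have h1 : ∀ r ∈ uIcc s t, |v' r - v' s| ≤ C * |t - s| := by
    intro r hr
    have hsub : uIcc s r ⊆ uIcc s t := uIcc_subset_uIcc left_mem_uIcc hr
    refine (abs_sub_le_of_hasDerivAt (fun q hq => hv' q (hsub hq)) (fun q hq => hC q (hsub hq))).trans ?_
    exact mul_le_mul_of_nonneg_left (abs_sub_left_of_mem_uIcc hr) h0
  have h2 := abs_sub_le_of_hasDerivAt (v := fun r => v r - v' s * (r - s)) (v' := fun r => v' r - v' s)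
    (C := C * |t - s|) (s := s) (t := t) (fun r hr => by
      have := (hv r hr).sub (((hasDerivAt_id r).sub_const s).const_mul (v' s))
      rw [mul_one] at this
      exact this) h1
  simp only [sub_self, mul_zero, sub_zero] at h2
  calc _ = |v t - v' s * (t - s) - v s| := by congr 1; ring
    _ ≤ _ := h2.trans (le_of_eq (by ring))

/-- Interior Sobolev embedding in a strip, `W^{4,1} ⊂ C^{1,1}` in the directions that are needed. -/
lemma sobolev_window {ε α β N : ℝ} (hε : 0 < ε) (hε1 : ε < 1) (hαβ : β - α = 2 * ε)
    {g : ℝ × ℝ → ℝ} {d : ℕ × ℕ → ℝ × ℝ → ℝ} (hg : IntegrableOn g (window α β))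
    (hgc : ContinuousOn g (window α β))
    (hd : ∀ n ∈ h43Orders, IntegrableOn (d n) (window α β))
    (hN : ∀ n ∈ h43Orders, ∫ q in window α β, |d n q| ≤ N)
    (hw : ∀ n ∈ h43Orders, WeakOn (window α β) n.1 n.2 g (d n)) :
    (∀ x ∈ Ioo (-(2 * Real.pi)) (2 * Real.pi), ∀ y ∈ Ioo α β, |g (x, y)| ≤ (1 / ε) ^ 2 * (4 * N)) ∧
    (∀ x ∈ Ioo (-(2 * Real.pi)) (2 * Real.pi), ∀ y ∈ Ioo α β, ∀ y' ∈ Ioo α β,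
      |g (x, y') - g (x, y)| ≤ (1 / ε) ^ 2 * (4 * N) * |y' - y|) ∧
    ∃ gx : ℝ × ℝ → ℝ, ∀ x ∈ Ioo (-(2 * Real.pi)) (2 * Real.pi), ∀ y ∈ Ioo α β,
      HasDerivAt (fun s => g (s, y)) (gx (x, y)) x ∧ |gx (x, y)| ≤ (1 / ε) ^ 2 * (4 * N) ∧
      ∀ x' ∈ Ioo (-(2 * Real.pi)) (2 * Real.pi), ∀ y' ∈ Ioo α β,
        |gx (x', y') - gx (x, y)| ≤ (1 / ε) ^ 2 * (4 * N) * (|x' - x| + |y' - y|) := by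
  have hpi := Real.pi_gt_three
  set M := (1 / ε) ^ 2 * (4 * N) with hM
  have hg0 : Integrable ((window α β).indicator g) := hg.integrable_indicator (measurableSet_window _ _)
  set u : ℕ → ℕ → ℕ → ℝ × ℝ → ℝ := fun k i j =>
    smear ((window α β).indicator g) (iteratedDeriv i ((bump k).normed volume))
      (iteratedDeriv j ((bump k).normed volume)) with hu
  have hAs : ∀ k, ContDiff ℝ ∞ ((bump k).normed volume) := fun k => (bump k).contDiff_normed
  choose C hC using fun k => exists_abs_iteratedDeriv_le (hAs k) (bump k).hasCompactSupport_normed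
  have hAn : ∀ k n, Continuous (iteratedDeriv n ((bump k).normed volume)) := fun k n =>
    (hAs k).continuous_iteratedDeriv n (by exact_mod_cast le_top)
  have hux : ∀ k i j x y, HasDerivAt (fun s => u k i j (s, y)) (u k (i + 1) j (x, y)) x :=
    fun k i j x y => hasDerivAt_smear_fst hg0 (hasDerivAt_iteratedDeriv (hAs k) i) (hAn _ _)
      (hAn _ j) (hC _ i) (hC _ _) (hC _ j) x y
  have huy : ∀ k i j x y, HasDerivAt (fun s => u k i j (x, s)) (u k i (j + 1) (x, y)) y :=
    fun k i j x y => hasDerivAt_smear_snd hg0 (hasDerivAt_iteratedDeriv (hAs k) j) (hAn _ _)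
      (hAn _ i) (hC _ i) (hC _ _) (hC _ j) x y
  -- The pointwise bound costs one more derivative in each variable. From `i + j ≤ 2` the largest
  -- order used is `(i + 1, j + 1)`, of total at most `4` and with at most `3` derivatives in `y`,
  -- as `h43Orders` allows.
  have hbd : ∀ i j, i + j ≤ 2 → ∀ k, ∀ y₁ y₂, α < y₁ → y₂ < β → (bump k).rOut < ε / 4 →
      (bump k).rOut < (y₁ - α) / 2 → (bump k).rOut < (β - y₂) / 2 →
      ∀ x ∈ Ioo (-(2 * Real.pi)) (2 * Real.pi), ∀ y ∈ Icc y₁ y₂, |u k i j (x, y)| ≤ M := by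
    intro i j hij k y₁ y₂ hy₁ hy₂ hk hk1 hk2 x hx y hy
    refine abs_smear_le hε hε1 hαβ hg hd hN hw (bump k) hk.le ?_ ?_ ?_ ?_ ⟨hx.1.le, hx.2.le⟩
      ⟨by linarith [hy.1], by linarith [hy.2]⟩ <;>
    · simp only [h43Orders, Finset.mem_filter, Finset.mem_product, Finset.mem_range]
      omega
  have hev : ∀ y₁ y₂, α < y₁ → y₂ < β → ∀ᶠ k in atTop, ∀ i j, i + j ≤ 2 →
      ∀ x ∈ Ioo (-(2 * Real.pi)) (2 * Real.pi), ∀ y ∈ Icc y₁ y₂, |u k i j (x, y)| ≤ M := by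
    intro y₁ y₂ hy₁ hy₂
    filter_upwards [eventually_bump_lt (r := ε / 4) (by positivity),
      eventually_bump_lt (r := (y₁ - α) / 2) (by linarith),
      eventually_bump_lt (r := (β - y₂) / 2) (by linarith)] with k h1 h2 h3 i j hij
    exact hbd i j hij k y₁ y₂ hy₁ hy₂ h1 h2 h3
  have hconv : ∀ x ∈ Ioo (-(2 * Real.pi)) (2 * Real.pi), ∀ y ∈ Ioo α β,
      Tendsto (fun k => u k 0 0 (x, y)) atTop (𝓝 (g (x, y))) := by
    intro x hx y hy
    have hmem : (x, y) ∈ window α β := ⟨⟨by linarith [hx.1], by linarith [hx.2]⟩, hy⟩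
    have hopen : IsOpen (window α β) := isOpen_Ioo.prod isOpen_Ioo
    rw [Metric.tendsto_atTop']
    intro η hη
    have hc := hgc.continuousAt (hopen.mem_nhds hmem)
    obtain ⟨δ₁, hδ₁, h1⟩ := Metric.continuousAt_iff.1 hc (η / 2) (by positivity)
    obtain ⟨δ₂, hδ₂, h2⟩ := Metric.isOpen_iff.1 hopen _ hmem
    obtain ⟨n, hn⟩ := eventually_atTop.1 (eventually_bump_lt (lt_min hδ₁ hδ₂))
    refine ⟨n, fun k hk => ?_⟩
    have hr := hn k hk.le
    have := smear_sub_abs_le hg0 (bump k) (p := (x, y)) (η := η / 2) (fun q hq => by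
      have hq1 : dist q (x, y) < δ₁ := lt_of_lt_of_le hq (hr.le.trans (min_le_left _ _))
      have hq2 : q ∈ window α β := h2 (lt_of_lt_of_le hq (hr.le.trans (min_le_right _ _)))
      rw [indicator_of_mem hq2, indicator_of_mem hmem]
      exact (h1 hq1).le)
    rw [indicator_of_mem hmem] at this
    rw [Real.dist_eq]
    simp only [hu, iteratedDeriv_zero]
    linarith
  -- Along an ultrafilter all bounded sequences converge, so the `x`-derivatives of the
  -- mollifications have a limit at every point at once, with no extraction of subsequences.
  obtain ⟨F, hF⟩ : ∃ F : Ultrafilter ℕ, (F : Filter ℕ) ≤ atTop := ⟨Ultrafilter.of atTop, Ultrafilter.of_le _⟩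
  have hlim : ∀ p : ℝ × ℝ, ∃ l, p.1 ∈ Ioo (-(2 * Real.pi)) (2 * Real.pi) → p.2 ∈ Ioo α β →
      Tendsto (fun k => u k 1 0 p) F (𝓝 l) := by
    rintro ⟨x, y⟩
    by_cases hx : x ∈ Ioo (-(2 * Real.pi)) (2 * Real.pi)
    swap; · exact ⟨0, fun h => absurd h hx⟩
    by_cases hy : y ∈ Ioo α β
    swap; · exact ⟨0, fun _ h => absurd h hy⟩
    have hmem : ∀ᶠ k in (F : Filter ℕ), u k 1 0 (x, y) ∈ Icc (-M) M := by
      filter_upwards [hF (hev y y hy.1 hy.2)] with k hk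
      exact abs_le.1 (hk 1 0 (by norm_num) x hx y ⟨le_rfl, le_rfl⟩)
    obtain ⟨l, -, hl⟩ := (isCompact_Icc (a := -M) (b := M)).ultrafilter_le_nhds
      (F.map fun k => u k 1 0 (x, y)) (le_principal_iff.2 hmem)
    exact ⟨l, fun _ _ => hl⟩
  choose gx hgx using hlim
  have hM0 : 0 ≤ M := by
    have : ((0 : ℕ), (0 : ℕ)) ∈ h43Orders := by simp [h43Orders]
    have h0 : 0 ≤ N := (integral_nonneg fun _ => abs_nonneg _).trans (hN _ this)
    positivity
  have hconvF : ∀ x ∈ Ioo (-(2 * Real.pi)) (2 * Real.pi), ∀ y ∈ Ioo α β,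
      Tendsto (fun k => u k 0 0 (x, y)) F (𝓝 (g (x, y))) := fun x hx y hy => (hconv x hx y hy).mono_left hF
  have hconv_x : ∀ {x x' : ℝ}, x ∈ Ioo (-(2 * Real.pi)) (2 * Real.pi) →
      x' ∈ Ioo (-(2 * Real.pi)) (2 * Real.pi) → uIcc x x' ⊆ Ioo (-(2 * Real.pi)) (2 * Real.pi) :=
    fun hx hx' => ordConnected_Ioo.uIcc_subset hx hx'
  refine ⟨fun x hx y hy => ?_, fun x hx y hy y' hy' => ?_, gx, fun x hx y hy => ⟨?_, ?_, ?_⟩⟩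
  · refine le_of_tendsto (hconv x hx y hy).abs ?_
    filter_upwards [hev y y hy.1 hy.2] with k hk using hk 0 0 (by norm_num) x hx y ⟨le_rfl, le_rfl⟩
  · refine le_of_tendsto ((hconv x hx y' hy').sub (hconv x hx y hy)).abs ?_
    filter_upwards [hev (min y y') (max y y') (lt_min hy.1 hy'.1) (max_lt hy.2 hy'.2)] with k hk
    exact abs_sub_le_of_hasDerivAt (v := fun s => u k 0 0 (x, s)) (v' := fun s => u k 0 1 (x, s))
      (fun r _ => huy k 0 0 x r) (fun r hr => hk 0 1 (by norm_num) x hx r hr)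
  -- The quadratic Taylor estimate, uniform in `k`, passes to the limit and shows that `gx` is the
  -- derivative of `g`.
  · have key : ∀ t ∈ Ioo (-(2 * Real.pi)) (2 * Real.pi),
        |g (t, y) - g (x, y) - gx (x, y) * (t - x)| ≤ M * |t - x| ^ 2 := by
      intro t ht
      refine le_of_tendsto ((((hconvF t ht y hy).sub (hconvF x hx y hy)).sub
        ((hgx (x, y) hx hy).mul_const (t - x))).abs) ?_
      filter_upwards [hF (hev y y hy.1 hy.2)] with k hk
      exact abs_taylor_le (v := fun s => u k 0 0 (s, y)) (v' := fun s => u k 1 0 (s, y))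
        (v'' := fun s => u k 2 0 (s, y)) (fun r _ => hux k 0 0 r y) (fun r _ => hux k 1 0 r y)
        (fun r hr => hk 2 0 (by norm_num) r (hconv_x hx ht hr) y ⟨le_rfl, le_rfl⟩)
    rw [hasDerivAt_iff_isLittleO]
    have hO : (fun t => g (t, y) - g (x, y) - (t - x) • gx (x, y)) =O[𝓝 x] fun t => (t - x) ^ 2 := by
      refine Asymptotics.IsBigO.of_bound M ?_
      filter_upwards [isOpen_Ioo.mem_nhds hx] with t ht
      have := key t ht
      rw [Real.norm_eq_abs, Real.norm_eq_abs, smul_eq_mul, abs_pow, mul_comm (t - x)]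
      exact this
    refine hO.trans_isLittleO ?_
    have h1 : (fun t : ℝ => t - x) =o[𝓝 x] fun _ => (1 : ℝ) := by
      rw [Asymptotics.isLittleO_one_iff]
      have : Tendsto (fun t : ℝ => t - x) (𝓝 x) (𝓝 (x - x)) := (continuous_sub_right x).tendsto x
      simpa using this
    have := h1.mul_isBigO (Asymptotics.isBigO_refl (fun t : ℝ => t - x) (𝓝 x))
    simpa [pow_two] using this
  · refine le_of_tendsto (hgx (x, y) hx hy).abs ?_
    filter_upwards [hF (hev y y hy.1 hy.2)] with k hk using hk 1 0 (by norm_num) x hx y ⟨le_rfl, le_rfl⟩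
  · intro x' hx' y' hy'
    refine le_of_tendsto ((hgx (x', y') hx' hy').sub (hgx (x, y) hx hy)).abs ?_
    filter_upwards [hF (hev (min y y') (max y y') (lt_min hy.1 hy'.1) (max_lt hy.2 hy'.2))] with k hk
    have e1 := abs_sub_le_of_hasDerivAt (v := fun s => u k 1 0 (s, y')) (v' := fun s => u k 2 0 (s, y'))
      (s := x) (t := x') (C := M)
      (fun r _ => hux k 1 0 r y') (fun r hr => hk 2 0 (by norm_num) r (hconv_x hx hx' hr) y'
        ⟨min_le_right _ _, le_max_right _ _⟩)
    have e2 := abs_sub_le_of_hasDerivAt (v := fun s => u k 1 0 (x, s)) (v' := fun s => u k 1 1 (x, s))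
      (s := y) (t := y') (C := M)
      (fun r _ => huy k 1 0 x r) (fun r hr => hk 1 1 (by norm_num) x hx r hr)
    calc _ = |(u k 1 0 (x', y') - u k 1 0 (x, y')) + (u k 1 0 (x, y') - u k 1 0 (x, y))| := by ring_nf
      _ ≤ _ := (abs_add_le _ _).trans (by linarith)

end

noncomputable section

/-! ### Sobolev embedding on `D_ε` -/

lemma isOpen_openStrips (ε : ℝ) : IsOpen (openStrips ε) := isOpen_univ.prod isOpen_interior

lemma openStrips_subset (ε : ℝ) : openStrips ε ⊆ univ ×ˢ bands ε :=
  prod_mono_right interior_subset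

/-- Translation by one period in `x`. -/
def periodShift : ℝ × ℝ ≃ₜ ℝ × ℝ := (Homeomorph.addRight (2 * Real.pi)).prodCongr (Homeomorph.refl ℝ)

lemma periodShift_apply (q : ℝ × ℝ) : periodShift q = (q.1 + 2 * Real.pi, q.2) := rfl

lemma periodShift_symm_apply (q : ℝ × ℝ) : periodShift.symm q = (q.1 + -(2 * Real.pi), q.2) := rfl

lemma measurePreserving_periodShift : MeasurePreserving periodShift :=
  (measurePreserving_add_right volume (2 * Real.pi)).prod (MeasurePreserving.id volume)

lemma measurableEmbedding_periodShift : MeasurableEmbedding periodShift :=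
  periodShift.measurableEmbedding

/-- The translate of `d` by a period is also a weak derivative of `g`, as one sees by translating
test functions; weak derivatives are unique almost everywhere. This is needed because the norm sees
a single period while the window spans three. -/
lemma IsWeakDeriv.ae_periodic {ε : ℝ} {i j : ℕ} {g d : ℝ × ℝ → ℝ} (hd : IsWeakDeriv ε i j g d)
    (hp : ∀ x, ∀ y ∈ bands ε, g (x + 2 * Real.pi, y) = g (x, y)) :
    ∀ᵐ q, q ∈ openStrips ε → d (periodShift q) = d q := by
  obtain ⟨-, hloc, hw⟩ := hd
  have hloc' : LocallyIntegrableOn (d ∘ periodShift) (openStrips ε) := by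
    rw [locallyIntegrableOn_iff (isOpen_openStrips ε).isLocallyClosed] at hloc ⊢
    intro k hk hkc
    rw [← preimage_image_eq k periodShift.injective,
      measurePreserving_periodShift.integrableOn_comp_preimage measurableEmbedding_periodShift]
    refine hloc _ ?_ (hkc.image periodShift.continuous)
    rintro _ ⟨q, hq, rfl⟩
    exact ⟨mem_univ _, (hk hq).2⟩
  have := (isOpen_openStrips ε).ae_eq_zero_of_integral_contDiff_smul_eq_zero (hloc'.sub hloc) ?_
  · filter_upwards [this] with q hq hqs
    have := hq hqs
    simp only [Pi.sub_apply, Function.comp_apply] at this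
    linarith
  intro φ hφ hφc hφs
  set ψ : ℝ × ℝ → ℝ := φ ∘ periodShift.symm
  have hψ : ContDiff ℝ ∞ ψ := hφ.comp (by
    change ContDiff ℝ ∞ fun q : ℝ × ℝ => (q.1 + -(2 * Real.pi), q.2)
    fun_prop)
  have hψc : HasCompactSupport ψ := hφc.comp_homeomorph _
  have hψs : tsupport ψ ⊆ openStrips ε := by
    rw [tsupport_comp_eq_preimage φ periodShift.symm]
    intro q hq
    exact ⟨mem_univ _, (hφs hq).2⟩
  have hm : ∀ q, mixedDeriv i j ψ (periodShift q) = mixedDeriv i j φ q := by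
    intro q
    unfold mixedDeriv
    simp only [ψ, Function.comp_def, periodShift_symm_apply, periodShift_apply]
    rw [iteratedDeriv_comp_add_const i (fun s => iteratedDeriv j (fun t => φ (s, t)) q.2)
      (-(2 * Real.pi))]
    simp
  have h1 := hw φ hφ hφc hφs
  have h2 := hw ψ hψ hψc hψs
  have e1 : ∫ q, g q * mixedDeriv i j ψ q = ∫ q, g q * mixedDeriv i j φ q := by
    rw [← measurePreserving_periodShift.integral_comp measurableEmbedding_periodShift]
    refine integral_congr_ae (ae_of_all _ fun q => ?_)
    simp only [hm]
    by_cases hq : q ∈ tsupport φ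
    · rw [periodShift_apply, hp _ _ (openStrips_subset ε (hφs hq)).2]
    · rw [mixedDeriv_eq_zero hq]; simp
  have e2 : ∫ q, d q * ψ q = ∫ q, d (periodShift q) * φ q := by
    rw [← measurePreserving_periodShift.integral_comp measurableEmbedding_periodShift]
    simp [ψ]
  rw [e1, h1, e2] at h2
  have h3 := mul_left_cancel₀ (pow_ne_zero _ (by norm_num)) h2
  have hint : ∀ f : ℝ × ℝ → ℝ, LocallyIntegrableOn f (openStrips ε) →
      Integrable fun q => φ q * f q := by
    intro f hf
    refine (integrableOn_iff_integrable_of_support_subset (s := tsupport φ) ?_).1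
      (IntegrableOn.continuousOn_mul hφ.continuous.continuousOn
        (hf.integrableOn_compact_subset hφs hφc) hφc)
    intro q hq
    exact subset_tsupport _ (left_ne_zero_of_mul hq)
  have i1 : Integrable fun q => d (periodShift q) * φ q := by
    simpa [mul_comm] using hint _ hloc'
  have i2 : Integrable fun q => d q * φ q := by
    simpa [mul_comm] using hint _ hloc
  have : ∫ q, φ q • (d ∘ periodShift - d) q = ∫ q, (d (periodShift q) * φ q - d q * φ q) := by
    refine integral_congr_ae (ae_of_all _ fun q => ?_)
    simp; ring
  rw [this, integral_sub i1 i2, h3, sub_self]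

lemma lintegral_shift {ε α β : ℝ} (hαβ : Ioo α β ⊆ interior (bands ε)) {i j : ℕ}
    {g d : ℝ × ℝ → ℝ} (hd : IsWeakDeriv ε i j g d)
    (hp : ∀ x, ∀ y ∈ bands ε, g (x + 2 * Real.pi, y) = g (x, y)) (a b : ℝ) :
    ∫⁻ q in Ioo (a + 2 * Real.pi) (b + 2 * Real.pi) ×ˢ Ioo α β, ‖d q‖ₑ
      = ∫⁻ q in Ioo a b ×ˢ Ioo α β, ‖d q‖ₑ := by
  rw [← measurePreserving_periodShift.setLIntegral_comp_preimage_emb measurableEmbedding_periodShift]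
  have : periodShift ⁻¹' (Ioo (a + 2 * Real.pi) (b + 2 * Real.pi) ×ˢ Ioo α β)
      = Ioo a b ×ˢ Ioo α β := by
    ext q
    simp [periodShift_apply]
  rw [this]
  refine setLIntegral_congr_fun_ae (measurableSet_Ioo.prod measurableSet_Ioo) ?_
  filter_upwards [hd.ae_periodic hp] with q hq hqs
  rw [hq ⟨mem_univ _, hαβ hqs.2⟩]

/-- Up to two vertical lines, which are null, the window consists of three translates of one period,
and each contributes the same. -/
lemma lintegral_window_le {ε α β : ℝ} (hαβ : Ioo α β ⊆ interior (bands ε)) {i j : ℕ}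
    {g d : ℝ × ℝ → ℝ} (hd : IsWeakDeriv ε i j g d)
    (hp : ∀ x, ∀ y ∈ bands ε, g (x + 2 * Real.pi, y) = g (x, y)) :
    ∫⁻ q in window α β, ‖d q‖ₑ ≤ 3 * ∫⁻ q in cell ε, ‖d q‖ₑ := by
  set B := Ioo α β
  have s1 := lintegral_shift hαβ hd hp (-Real.pi) Real.pi
  have s2 := lintegral_shift hαβ hd hp (-(3 * Real.pi)) (-Real.pi)
  rw [show -(3 * Real.pi) + 2 * Real.pi = -Real.pi by ring,
    show -Real.pi + 2 * Real.pi = Real.pi by ring] at s2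
  have hc : ∫⁻ q in Ioo (-Real.pi) Real.pi ×ˢ B, ‖d q‖ₑ ≤ ∫⁻ q in cell ε, ‖d q‖ₑ :=
    lintegral_mono_set (prod_mono_right (hαβ.trans interior_subset))
  have hnull : ∀ c : ℝ, ∫⁻ q in {c} ×ˢ (univ : Set ℝ), ‖d q‖ₑ = 0 := by
    intro c
    refine setLIntegral_measure_zero _ _ ?_
    rw [Measure.volume_eq_prod, Measure.prod_prod]
    simp
  have hsub : window α β ⊆ ((((Ioo (-(3 * Real.pi)) (-Real.pi) ×ˢ B) ∪ (Ioo (-Real.pi) Real.pi ×ˢ B)) ∪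
      (Ioo (-Real.pi + 2 * Real.pi) (Real.pi + 2 * Real.pi) ×ˢ B)) ∪ ({-Real.pi} ×ˢ univ)) ∪
      ({Real.pi} ×ˢ univ) := by
    rintro ⟨x, y⟩ ⟨⟨h1, h2⟩, h3⟩
    simp only [mem_union, mem_prod, mem_Ioo, mem_singleton_iff, mem_univ, and_true] at *
    rcases lt_trichotomy x (-Real.pi) with h | h | h
    · exact Or.inl (Or.inl (Or.inl (Or.inl ⟨⟨h1, h⟩, h3⟩)))
    · exact Or.inl (Or.inr h)
    · rcases lt_trichotomy x Real.pi with h' | h' | h'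
      · exact Or.inl (Or.inl (Or.inl (Or.inr ⟨⟨h, h'⟩, h3⟩)))
      · exact Or.inr h'
      · exact Or.inl (Or.inl (Or.inr ⟨⟨by linarith, by linarith⟩, h3⟩))
  calc _ ≤ _ := lintegral_mono_set hsub
    _ ≤ ((∫⁻ q in Ioo (-(3 * Real.pi)) (-Real.pi) ×ˢ B, ‖d q‖ₑ)
        + (∫⁻ q in Ioo (-Real.pi) Real.pi ×ˢ B, ‖d q‖ₑ)
        + ∫⁻ q in Ioo (-Real.pi + 2 * Real.pi) (Real.pi + 2 * Real.pi) ×ˢ B, ‖d q‖ₑ) := by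
        refine (lintegral_union_le _ _ _).trans ?_
        rw [hnull, add_zero]
        refine (lintegral_union_le _ _ _).trans ?_
        rw [hnull, add_zero]
        refine (lintegral_union_le _ _ _).trans ?_
        gcongr
        exact lintegral_union_le _ _ _
    _ = 3 * ∫⁻ q in Ioo (-Real.pi) Real.pi ×ˢ B, ‖d q‖ₑ := by rw [s1, ← s2]; ring
    _ ≤ _ := by gcongr

/-- The square root of the area of `D_ε`. -/
def rootArea (ε : ℝ) : ℝ≥0∞ := volume (cell ε) ^ (1 / 2 : ℝ)

lemma rootArea_ne_top (ε : ℝ) : rootArea ε ≠ ⊤ := by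
  refine ENNReal.rpow_ne_top_of_nonneg (by norm_num) ?_
  rw [cell, Measure.volume_eq_prod, Measure.prod_prod]
  exact ENNReal.mul_ne_top (by simp) isCompact_bands.measure_lt_top.ne

/-- Strict inequality provides a competitor in the infimum defining the norm, and each of its terms
is at most the sum. -/
lemma exists_weakDeriv {ε N : ℝ} {g : ℝ × ℝ → ℝ} (hN : h43Norm ε g < ENNReal.ofReal N) :
    ∃ d : ℕ × ℕ → ℝ × ℝ → ℝ, (∀ n ∈ h43Orders, IsWeakDeriv ε n.1 n.2 g (d n)) ∧
      ∀ n ∈ h43Orders, eLpNorm (d n) 2 (volume.restrict (cell ε)) ≤ ENNReal.ofReal N := by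
  obtain ⟨d, hd⟩ := iInf_lt_iff.1 hN
  obtain ⟨hw, hd⟩ := iInf_lt_iff.1 hd
  exact ⟨d, hw, fun n hn => (Finset.single_le_sum (f := fun n => eLpNorm (d n) 2
    (volume.restrict (cell ε))) (fun _ _ => zero_le) hn).trans hd.le⟩

lemma cell_ae_eq {ε : ℝ} : (cell ε : Set (ℝ × ℝ)) =ᵐ[volume]
    (Ioo (-Real.pi) Real.pi ×ˢ interior (bands ε) : Set (ℝ × ℝ)) := by
  refine Measure.set_prod_ae_eq (ae_eq_refl _) ?_
  refine (interior_ae_eq_of_null_frontier ?_).symm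
  refine measure_mono_null ((frontier_union_subset _ _).trans
    (union_subset_union inter_subset_left inter_subset_right)) (measure_union_null ?_ ?_) <;>
  exact (convex_Icc _ _).addHaar_frontier volume

/-- The Cauchy–Schwarz inequality on `D_ε` passes from `L²` to `L¹` at the price of the square root
of the area. -/
lemma lintegral_window_le_norm {ε α β N : ℝ} (hαβ : Ioo α β ⊆ interior (bands ε)) {i j : ℕ}
    {g d : ℝ × ℝ → ℝ} (hd : IsWeakDeriv ε i j g d)
    (hp : ∀ x, ∀ y ∈ bands ε, g (x + 2 * Real.pi, y) = g (x, y))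
    (hN : eLpNorm d 2 (volume.restrict (cell ε)) ≤ ENNReal.ofReal N) :
    ∫⁻ q in window α β, ‖d q‖ₑ ≤ 3 * (ENNReal.ofReal N * rootArea ε) := by
  refine (lintegral_window_le hαβ hd hp).trans ?_
  have hm : AEStronglyMeasurable d (volume.restrict (cell ε)) := by
    rw [Measure.restrict_congr_set cell_ae_eq]
    exact hd.2.1.aestronglyMeasurable.mono_set (prod_mono_left (subset_univ _))
  have := eLpNorm_le_eLpNorm_mul_rpow_measure_univ (p := 1) (q := 2) (by norm_num) hm
  rw [eLpNorm_one_eq_lintegral_enorm, Measure.restrict_apply_univ] at this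
  gcongr
  refine this.trans ?_
  rw [rootArea]
  norm_num
  gcongr

/-- Bounds for `g`, for its Lipschitz constant in `y` on each band and for its continuous
derivative in `x`. -/
structure Regular (ε M : ℝ) (g : ℝ × ℝ → ℝ) : Prop where
  bound : ∀ x, ∀ y ∈ bands ε, |g (x, y)| ≤ M
  lip : ∀ x y y', uIcc y y' ⊆ bands ε → |g (x, y') - g (x, y)| ≤ M * |y' - y|
  hasDerivAt : ∀ p ∈ openStrips ε, HasDerivAt (fun s => g (s, p.2)) (dx g p) p.1
  dx_bound : ∀ p ∈ openStrips ε, |dx g p| ≤ M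
  dx_continuousOn : ContinuousOn (dx g) (openStrips ε)

lemma abs_le_on_Icc {v : ℝ → ℝ} {α β M : ℝ} (hαβ : α < β) (hc : ContinuousOn v (Icc α β))
    (h : ∀ y ∈ Ioo α β, |v y| ≤ M) : ∀ y ∈ Icc α β, |v y| ≤ M := by
  intro y hy
  rw [← closure_Ioo hαβ.ne] at hy hc
  exact ContinuousWithinAt.closure_le hy ((hc y hy).mono subset_closure).abs
    continuousWithinAt_const h

lemma abs_sub_le_on_Icc {v : ℝ → ℝ} {α β M : ℝ} (hM : 0 ≤ M) (hαβ : α < β)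
    (hc : ContinuousOn v (Icc α β))
    (h : ∀ y ∈ Ioo α β, ∀ y' ∈ Ioo α β, |v y' - v y| ≤ M * |y' - y|) :
    ∀ y ∈ Icc α β, ∀ y' ∈ Icc α β, |v y' - v y| ≤ M * |y' - y| := by
  have h1 : LipschitzOnWith (Real.toNNReal M) v (Ioo α β) := by
    refine LipschitzOnWith.of_dist_le_mul fun a ha b hb => ?_
    rw [Real.coe_toNNReal _ hM, Real.dist_eq, Real.dist_eq]
    exact h b hb a ha
  have h2 := LipschitzOnWith.closure (by rwa [closure_Ioo hαβ.ne]) h1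
  rw [closure_Ioo hαβ.ne] at h2
  intro y hy y' hy'
  have := h2.dist_le_mul y' hy' y hy
  rwa [Real.coe_toNNReal _ hM, Real.dist_eq, Real.dist_eq] at this

lemma exists_period_shift (x : ℝ) : ∃ k : ℤ, x + k * (2 * Real.pi) ∈ Ioo (-(2 * Real.pi)) (2 * Real.pi) := by
  have hpi := Real.pi_pos
  obtain ⟨k, hk, -⟩ := existsUnique_add_zsmul_mem_Ico (by positivity : 0 < 2 * Real.pi) x 0
  refine ⟨k, ?_⟩
  simp only [zsmul_eq_mul, zero_add] at hk
  exact ⟨by linarith [hk.1], hk.2⟩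

lemma periodic_int {ε : ℝ} {g : ℝ × ℝ → ℝ}
    (hp : ∀ x, ∀ y ∈ bands ε, g (x + 2 * Real.pi, y) = g (x, y)) (k : ℤ) {y : ℝ}
    (hy : y ∈ bands ε) (x : ℝ) : g (x + k * (2 * Real.pi), y) = g (x, y) := by
  have : Function.Periodic (fun x => g (x, y)) (2 * Real.pi) := fun x => hp x y hy
  simpa using this.int_mul k x

/-- The estimates of `sobolev_window` on each band, transported to every `x` by periodicity. The
bounds on `g` and its increments reach the closed bands by continuity, whereas those on `∂ₓ g`
remain on the open ones. -/
lemma exists_regular {ε : ℝ} (hε : 0 < ε) (hε1 : ε < 1) :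
    ∃ C, 0 ≤ C ∧ ∀ (g : ℝ × ℝ → ℝ) (N : ℝ), ContinuousOn g (univ ×ˢ bands ε) →
      (∀ x, ∀ y ∈ bands ε, g (x + 2 * Real.pi, y) = g (x, y)) →
      h43Norm ε g < ENNReal.ofReal N → Regular ε (C * N) g := by
  have hpi := Real.pi_pos
  set R := (rootArea ε).toReal
  -- The factor `3` counts the periods of the window and `R` comes from the Cauchy–Schwarz
  -- inequality; the rest is the constant of `sobolev_window`.
  refine ⟨(1 / ε) ^ 2 * (4 * (3 * R)), by positivity, fun g N hgc hp hgN => ?_⟩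
  obtain ⟨d, hw, hdN⟩ := exists_weakDeriv hgN
  have hN0 : 0 < N := ENNReal.ofReal_pos.1 (lt_of_le_of_lt zero_le hgN)
  set M := (1 / ε) ^ 2 * (4 * (3 * R)) * N with hM
  have hM0 : 0 ≤ M := by positivity
  have hMeq : (1 / ε) ^ 2 * (4 * (3 * (N * R))) = M := by rw [hM]; ring
  have main : ∀ α β, β - α = 2 * ε → Icc α β ⊆ bands ε → _ := fun α β hαβ hsub => by
    have hsubi : Ioo α β ⊆ interior (bands ε) :=
      interior_maximal (Ioo_subset_Icc_self.trans hsub) isOpen_Ioo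
    have hWs : window α β ⊆ openStrips ε := fun q hq => ⟨mem_univ _, hsubi hq.2⟩
    have hfin : ∀ n ∈ h43Orders, ∫⁻ q in window α β, ‖d n q‖ₑ ≤ ENNReal.ofReal (3 * (N * R)) := by
      intro n hn
      refine (lintegral_window_le_norm hsubi (hw n hn) hp (hdN n hn)).trans (le_of_eq ?_)
      rw [ENNReal.ofReal_mul (by norm_num), ENNReal.ofReal_mul hN0.le,
        ENNReal.ofReal_toReal (rootArea_ne_top ε)]
      simp
    have hdi : ∀ n ∈ h43Orders, IntegrableOn (d n) (window α β) := fun n hn =>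
      ⟨(hw n hn).2.1.aestronglyMeasurable.mono_set hWs, (hfin n hn).trans_lt ENNReal.ofReal_lt_top⟩
    refine sobolev_window (N := 3 * (N * R)) (g := g) (d := d) hε hε1 hαβ ?_
      (hgc.mono (hWs.trans (openStrips_subset ε))) hdi (fun n hn => ?_) (fun n hn => ?_)
    · refine IntegrableOn.mono_set (t := Icc (-(3 * Real.pi)) (3 * Real.pi) ×ˢ Icc α β) ?_
        (prod_mono Ioo_subset_Icc_self Ioo_subset_Icc_self)
      exact (hgc.mono (prod_mono (subset_univ _) hsub)).integrableOn_compact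
        (isCompact_Icc.prod isCompact_Icc)
    · have h1 : ∫ q in window α β, ‖d n q‖ = (∫⁻ q in window α β, ‖d n q‖ₑ).toReal :=
        integral_norm_eq_lintegral_enorm (hdi n hn).1
      simp only [Real.norm_eq_abs] at h1
      rw [h1]
      exact ENNReal.toReal_le_of_le_ofReal (by positivity) (hfin n hn)
    · intro φ h1 h2 h3
      exact (hw n hn).2.2 φ h1 h2 (h3.trans hWs)
  simp only [hMeq] at main
  have hband : ∀ α β, β - α = 2 * ε → Icc α β ⊆ bands ε →
      (∀ x, ∀ y ∈ Icc α β, |g (x, y)| ≤ M) ∧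
      (∀ x, ∀ y ∈ Icc α β, ∀ y' ∈ Icc α β, |g (x, y') - g (x, y)| ≤ M * |y' - y|) ∧
      (∀ x, ∀ y ∈ Ioo α β, HasDerivAt (fun s => g (s, y)) (dx g (x, y)) x ∧ |dx g (x, y)| ≤ M ∧
        ContinuousAt (dx g) (x, y)) := by
    intro α β hαβ hsub
    obtain ⟨h1, h2, gx, h3⟩ := main α β hαβ hsub
    have hlt : α < β := by linarith
    have hcy : ∀ x, ContinuousOn (fun y => g (x, y)) (Icc α β) := fun x =>
      hgc.comp (by fun_prop) fun y hy => ⟨mem_univ _, hsub hy⟩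
    have hdx : ∀ x ∈ Ioo (-(2 * Real.pi)) (2 * Real.pi), ∀ y ∈ Ioo α β, dx g (x, y) = gx (x, y) :=
      fun x hx y hy => (h3 x hx y hy).1.deriv
    have hdxp : ∀ (k : ℤ) x, ∀ y ∈ Ioo α β, dx g (x + k * (2 * Real.pi), y) = dx g (x, y) := by
      intro k x y hy
      have hyb := hsub (Ioo_subset_Icc_self hy)
      unfold dx
      simp only
      rw [← deriv_comp_add_const (fun s => g (s, y)) (k * (2 * Real.pi)) x]
      congr 1
      funext s
      exact periodic_int hp k hyb s
    refine ⟨fun x => ?_, fun x => ?_, fun x y hy => ?_⟩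
    · obtain ⟨k, hk⟩ := exists_period_shift x
      refine abs_le_on_Icc hlt (hcy x) fun y hy => ?_
      rw [← periodic_int hp k (hsub (Ioo_subset_Icc_self hy))]
      exact h1 _ hk y hy
    · obtain ⟨k, hk⟩ := exists_period_shift x
      refine abs_sub_le_on_Icc hM0 hlt (hcy x) fun y hy y' hy' => ?_
      rw [← periodic_int hp k (hsub (Ioo_subset_Icc_self hy)),
        ← periodic_int hp k (hsub (Ioo_subset_Icc_self hy'))]
      exact h2 _ hk y hy y' hy'
    · have hyb := hsub (Ioo_subset_Icc_self hy)
      obtain ⟨k, hk⟩ := exists_period_shift x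
      obtain ⟨hd1, hd2, hd3⟩ := h3 _ hk y hy
      refine ⟨?_, ?_, ?_⟩
      · have := (hd1.comp_add_const x (k * (2 * Real.pi)))
        have e : (fun s => g (s + k * (2 * Real.pi), y)) = fun s => g (s, y) :=
          funext fun s => periodic_int hp k hyb s
        rw [e] at this
        exact this.differentiableAt.hasDerivAt
      · rw [← hdxp k x y hy, hdx _ hk y hy]; exact hd2
      · have hc : ContinuousAt (dx g) (x + k * (2 * Real.pi), y) := by
          rw [Metric.continuousAt_iff]
          intro η hη
          have hopen : IsOpen (Ioo (-(2 * Real.pi)) (2 * Real.pi) ×ˢ Ioo α β) :=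
            isOpen_Ioo.prod isOpen_Ioo
          obtain ⟨δ, hδ, hball⟩ := Metric.isOpen_iff.1 hopen (x + k * (2 * Real.pi), y) ⟨hk, hy⟩
          refine ⟨min δ (η / (2 * M + 1)), lt_min hδ (by positivity), fun q hq => ?_⟩
          have hqm := hball (lt_of_lt_of_le hq (min_le_left _ _))
          have hq2 := lt_of_lt_of_le hq (min_le_right _ _)
          obtain ⟨a, b⟩ := q
          rw [hdx _ hqm.1 _ hqm.2, hdx _ hk y hy, Real.dist_eq]
          refine (hd3 a hqm.1 b hqm.2).trans_lt ?_
          rw [Prod.dist_eq, max_lt_iff, Real.dist_eq, Real.dist_eq] at hq2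
          rw [lt_div_iff₀ (by positivity), lt_div_iff₀ (by positivity)] at hq2
          nlinarith [hq2.1, hq2.2, abs_nonneg (a - (x + k * (2 * Real.pi))), abs_nonneg (b - y)]
        have hcomp : ContinuousAt (fun q : ℝ × ℝ => dx g (q.1 + k * (2 * Real.pi), q.2)) (x, y) :=
          ContinuousAt.comp (f := fun q : ℝ × ℝ => (q.1 + k * (2 * Real.pi), q.2)) (x := (x, y)) hc
            (by fun_prop)
        refine hcomp.congr ?_
        have : univ ×ˢ Ioo α β ∈ 𝓝 (x, y) := (isOpen_univ.prod isOpen_Ioo).mem_nhds ⟨mem_univ _, hy⟩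
        filter_upwards [this] with q hq using hdxp k q.1 q.2 hq.2
  have b1 := hband (-1 - ε) (-1 + ε) (by ring) subset_union_left
  have b2 := hband (1 - ε) (1 + ε) (by ring) subset_union_right
  have hint : ∀ y ∈ interior (bands ε), y ∈ Ioo (-1 - ε) (-1 + ε) ∨ y ∈ Ioo (1 - ε) (1 + ε) := by
    intro y hy
    have : interior (bands ε) = Ioo (-1 - ε) (-1 + ε) ∪ Ioo (1 - ε) (1 + ε) := by
      unfold bands
      rw [interior_union_of_disjoint_closure, interior_Icc, interior_Icc]
      rw [isClosed_Icc.closure_eq, isClosed_Icc.closure_eq, Set.disjoint_left]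
      rintro x ⟨_, h1⟩ ⟨h2, _⟩
      linarith
    rwa [this] at hy
  refine ⟨?_, ?_, ?_, ?_, ?_⟩
  · rintro x y (hy | hy)
    exacts [b1.1 x y hy, b2.1 x y hy]
  · intro x y y' hyy
    have hy := hyy left_mem_uIcc
    have hy' := hyy right_mem_uIcc
    -- An interval contained in the bands cannot meet both of them, since it would contain `0`.
    have h0 : (0 : ℝ) ∉ bands ε := by rintro (h | h) <;> linarith [h.1, h.2]
    rcases hy with hy | hy <;> rcases hy' with hy' | hy'
    · exact b1.2.1 x y hy y' hy'
    · exact absurd (hyy (mem_uIcc.2 (Or.inl ⟨by linarith [hy.2], by linarith [hy'.1]⟩))) h0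
    · exact absurd (hyy (mem_uIcc.2 (Or.inr ⟨by linarith [hy'.2], by linarith [hy.1]⟩))) h0
    · exact b2.2.1 x y hy y' hy'
  · rintro ⟨x, y⟩ ⟨-, hy⟩
    rcases hint y hy with hy | hy
    exacts [(b1.2.2 x y hy).1, (b2.2.2 x y hy).1]
  · rintro ⟨x, y⟩ ⟨-, hy⟩
    rcases hint y hy with hy | hy
    exacts [(b1.2.2 x y hy).2.1, (b2.2.2 x y hy).2.1]
  · rintro ⟨x, y⟩ ⟨-, hy⟩
    rcases hint y hy with hy | hy
    exacts [(b1.2.2 x y hy).2.2.continuousWithinAt, (b2.2.2 x y hy).2.2.continuousWithinAt]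

end

noncomputable section

/-! ### Convolution on `𝕋 × ℝ` -/

/-- One period `(-π, π] × ℝ` of `𝕋 × ℝ`. -/
def tube : Set (ℝ × ℝ) := Ioc (-Real.pi) Real.pi ×ˢ univ

lemma measurableSet_tube : MeasurableSet tube := measurableSet_Ioc.prod MeasurableSet.univ

lemma volume_restrict_tube : (volume.restrict tube : Measure (ℝ × ℝ))
    = (volume.restrict (Ioc (-Real.pi) Real.pi)).prod volume := by
  rw [tube, Measure.volume_eq_prod, ← Measure.prod_restrict, Measure.restrict_univ]

/-- The representative in `tube` of `p - q`. -/
def wrapSub (p q : ℝ × ℝ) : ℝ × ℝ :=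
  (toIocMod (by positivity : 0 < 2 * Real.pi) (-Real.pi) (p.1 - q.1), p.2 - q.2)

/-- On the circle `s ↦ x - s` preserves Haar measure; this is that map read in the fundamental
domain `(-π, π]`. -/
lemma measurePreserving_toIocMod_sub (x : ℝ) :
    MeasurePreserving (fun s => toIocMod (by positivity : 0 < 2 * Real.pi) (-Real.pi) (x - s))
      (volume.restrict (Ioc (-Real.pi) Real.pi)) (volume.restrict (Ioc (-Real.pi) Real.pi)) := by
  have : Fact (0 < 2 * Real.pi) := ⟨by positivity⟩
  have e : -Real.pi + 2 * Real.pi = Real.pi := by ring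
  have h1 := AddCircle.measurePreserving_mk (2 * Real.pi) (-Real.pi)
  have h2 : MeasurePreserving (fun s : AddCircle (2 * Real.pi) => (x : AddCircle (2 * Real.pi)) - s) :=
    Measure.measurePreserving_sub_left volume _
  have h3 := AddCircle.measurePreserving_equivIoc (2 * Real.pi) (a := -Real.pi)
  have h4 := measurePreserving_subtype_coe (μa := (volume : Measure ℝ))
    (measurableSet_Ioc (a := -Real.pi) (b := -Real.pi + 2 * Real.pi))
  have := ((h4.comp h3).comp h2).comp h1
  have h5 : ((Subtype.val ∘ ⇑(AddCircle.equivIoc (2 * Real.pi) (-Real.pi))) ∘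
      fun s : AddCircle (2 * Real.pi) => (x : AddCircle (2 * Real.pi)) - s) ∘ QuotientAddGroup.mk
      = fun s => toIocMod (by positivity : 0 < 2 * Real.pi) (-Real.pi) (x - s) := rfl
  rwa [h5, e] at this

lemma measurePreserving_wrapSub (p : ℝ × ℝ) :
    MeasurePreserving (wrapSub p) (volume.restrict tube) (volume.restrict tube) := by
  rw [volume_restrict_tube]
  exact (measurePreserving_toIocMod_sub p.1).prod (Measure.measurePreserving_sub_left volume p.2)

/-- `2π`-periodicity in the first variable. -/
def PeriodicFst (H : ℝ × ℝ → ℝ) : Prop := ∀ x y, H (x + 2 * Real.pi, y) = H (x, y)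

lemma PeriodicFst.comp_wrapSub {H : ℝ × ℝ → ℝ} (hH : PeriodicFst H) (p q : ℝ × ℝ) :
    H (wrapSub p q) = H (p - q) := by
  have : Function.Periodic (fun x => H (x, p.2 - q.2)) (2 * Real.pi) := fun x => hH x _
  unfold wrapSub
  rw [toIocMod]
  exact this.sub_zsmul_eq _

lemma integral_tube_sub {H : ℝ × ℝ → ℝ} (hH : PeriodicFst H)
    (hm : AEStronglyMeasurable H (volume.restrict tube)) (p : ℝ × ℝ) :
    ∫ q in tube, H (p - q) = ∫ q in tube, H q := by
  have h := measurePreserving_wrapSub p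
  have := integral_map h.aemeasurable (f := H) (by rwa [h.map_eq])
  rw [h.map_eq] at this
  rw [this]
  simp only [hH.comp_wrapSub]

lemma integrableOn_tube_sub {H : ℝ × ℝ → ℝ} (hH : PeriodicFst H)
    (hm : IntegrableOn H tube) (p : ℝ × ℝ) : IntegrableOn (fun q => H (p - q)) tube := by
  have := (measurePreserving_wrapSub p).integrable_comp_of_integrable hm
  simp only [Function.comp_def, hH.comp_wrapSub] at this
  exact this

/-- The part `|y| ≤ R` of the tube. -/
def box (R : ℝ) : Set (ℝ × ℝ) := Ioc (-Real.pi) Real.pi ×ˢ Icc (-R) R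

lemma measurableSet_box (R : ℝ) : MeasurableSet (box R) := measurableSet_Ioc.prod measurableSet_Icc

lemma box_subset_tube (R : ℝ) : box R ⊆ tube := prod_mono_right (subset_univ _)

/-- Convolution over `𝕋 × ℝ`. -/
def conv (K v : ℝ × ℝ → ℝ) (p : ℝ × ℝ) : ℝ := ∫ q in tube, K q * v (p - q)

/-- Periodic kernels that are integrable on bounded parts of the tube. -/
structure IsKernel (K : ℝ × ℝ → ℝ) : Prop where
  measurable : Measurable K
  periodic : PeriodicFst K
  integrableOn : ∀ R, IntegrableOn K (box R)

/-- Continuous periodic functions vanishing for `|y| > L`. -/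
structure IsDensity (L : ℝ) (v : ℝ × ℝ → ℝ) : Prop where
  continuous : Continuous v
  periodic : PeriodicFst v
  eq_zero : ∀ p : ℝ × ℝ, L < |p.2| → v p = 0

lemma IsDensity.exists_bound {L : ℝ} {v : ℝ × ℝ → ℝ} (hv : IsDensity L v) : ∃ C, 0 ≤ C ∧ ∀ p, |v p| ≤ C := by
  obtain ⟨C, hC⟩ := (isCompact_Icc.prod isCompact_Icc :
    IsCompact (Icc (-(2 * Real.pi)) (2 * Real.pi) ×ˢ Icc (-L) L)).exists_bound_of_continuousOn
    hv.continuous.continuousOn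
  refine ⟨max C 0, le_max_right _ _, fun p => ?_⟩
  by_cases hp : L < |p.2|
  · rw [hv.eq_zero p hp]; simp
  · obtain ⟨k, hk⟩ := exists_period_shift p.1
    have : Function.Periodic (fun x => v (x, p.2)) (2 * Real.pi) := fun x => hv.periodic x _
    have e : v (p.1 + k * (2 * Real.pi), p.2) = v p := by simpa using this.int_mul k p.1
    rw [← e]
    exact (hC (_, _) ⟨Ioo_subset_Icc_self hk, abs_le.1 (not_lt.1 hp)⟩).trans (le_max_left _ _)

lemma conv_eq_box {K v : ℝ × ℝ → ℝ} {L R : ℝ} (hv : IsDensity L v) {p : ℝ × ℝ}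
    (hp : |p.2| + L < R) : conv K v p = ∫ q in box R, K q * v (p - q) := by
  unfold conv
  refine setIntegral_eq_of_subset_of_forall_sdiff_eq_zero measurableSet_tube (box_subset_tube R) ?_
  rintro q ⟨hq1, hq2⟩
  rw [hv.eq_zero, mul_zero]
  have : R < |q.2| := by
    by_contra h
    exact hq2 ⟨hq1.1, abs_le.1 (not_lt.1 h)⟩
  have h2 : |q.2| ≤ |p.2| + |p.2 - q.2| := by
    calc |q.2| = |p.2 - (p.2 - q.2)| := by ring_nf
      _ ≤ _ := abs_sub _ _
  show L < |p.2 - q.2|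
  linarith

lemma integrableOn_conv {K v : ℝ × ℝ → ℝ} {L : ℝ} (hK : IsKernel K) (hv : IsDensity L v) (p : ℝ × ℝ) :
    IntegrableOn (fun q => K q * v (p - q)) tube := by
  obtain ⟨C, -, hC⟩ := hv.exists_bound
  have hvc := hv.continuous
  have h1 : IntegrableOn (fun q => K q * v (p - q)) (box (|p.2| + L + 1)) :=
    (hK.integrableOn _).mul_bdd (c := C)
      (Continuous.aestronglyMeasurable (by fun_prop)) (ae_of_all _ fun q => hC _)
  refine h1.of_forall_sdiff_eq_zero measurableSet_tube ?_
  rintro q ⟨hq1, hq2⟩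
  rw [hv.eq_zero, mul_zero]
  have : |p.2| + L + 1 < |q.2| := by
    by_contra h
    exact hq2 ⟨hq1.1, abs_le.1 (not_lt.1 h)⟩
  have h2 : |q.2| ≤ |p.2| + |p.2 - q.2| := by
    calc |q.2| = |p.2 - (p.2 - q.2)| := by ring_nf
      _ ≤ _ := abs_sub _ _
  show L < |p.2 - q.2|
  linarith

/-- The other form of the convolution. -/
lemma conv_comm {K v : ℝ × ℝ → ℝ} {L : ℝ} (hK : IsKernel K) (hv : IsDensity L v) (p : ℝ × ℝ) :
    conv K v p = ∫ q in tube, K (p - q) * v q := by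
  have hper : PeriodicFst fun q => K q * v (p - q) := by
    intro x y
    have h1 := hv.periodic (p.1 - (x + 2 * Real.pi)) (p.2 - y)
    have e : p.1 - (x + 2 * Real.pi) + 2 * Real.pi = p.1 - x := by ring
    rw [e] at h1
    simp only [hK.periodic x y]
    congr 1
    exact h1.symm
  have := integral_tube_sub hper (integrableOn_conv hK hv p).aestronglyMeasurable p
  unfold conv
  rw [← this]
  simp

lemma integrableOn_conv_comm {K v : ℝ × ℝ → ℝ} {L : ℝ} (hK : IsKernel K) (hv : IsDensity L v)
    (p : ℝ × ℝ) : IntegrableOn (fun q => K (p - q) * v q) tube := by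
  have hper : PeriodicFst fun q => K q * v (p - q) := by
    intro x y
    have h1 := hv.periodic (p.1 - (x + 2 * Real.pi)) (p.2 - y)
    have e : p.1 - (x + 2 * Real.pi) + 2 * Real.pi = p.1 - x := by ring
    rw [e] at h1
    simp only [hK.periodic x y]
    congr 1
    exact h1.symm
  simpa using integrableOn_tube_sub hper (integrableOn_conv hK hv p) p

/-- Near `p₀` only the part of `K` in a bounded box contributes, and for `q` in that box `v` is
evaluated where the cutoff `χ` equals `1`. Locally this is therefore an ordinary convolution on the
plane of an integrable kernel with a compactly supported `C^n` function. -/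
lemma contDiff_conv {K v : ℝ × ℝ → ℝ} {L : ℝ} (hK : IsKernel K) (hv : IsDensity L v) {n : ℕ}
    (hn : ContDiff ℝ n v) : ContDiff ℝ n (conv K v) := by
  rw [contDiff_iff_contDiffAt]
  intro p₀
  set R := |p₀.2| + 1 + |L| + 1 with hR
  have hR0 : 0 < R := by positivity
  have hpi := Real.pi_pos
  let χ : ContDiffBump p₀ := ⟨Real.pi + R + 1, Real.pi + R + 2, by positivity, by linarith⟩
  have hcs : HasCompactSupport fun q => χ q * v q := χ.hasCompactSupport.mul_right
  have hcd : ContDiff ℝ n fun q => χ q * v q := χ.contDiff.mul hn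
  have hint : LocallyIntegrable ((box R).indicator K) :=
    ((hK.integrableOn R).integrable_indicator (measurableSet_box R)).locallyIntegrable
  have main := (hcs.contDiff_convolution_right (n := (n : ℕ∞)) (ContinuousLinearMap.mul ℝ ℝ) hint
    (μ := volume) (by exact_mod_cast hcd)).contDiffAt (x := p₀)
  refine ContDiffAt.congr_of_eventuallyEq (by exact_mod_cast main) ?_
  filter_upwards [Metric.ball_mem_nhds p₀ one_pos] with p hp
  have hp1 : dist p p₀ < 1 := hp
  have hp2 : |p.2 - p₀.2| < 1 := by
    have := le_max_right (dist p.1 p₀.1) (dist p.2 p₀.2)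
    rw [← Prod.dist_eq] at this
    exact lt_of_le_of_lt this hp1
  have hp3 : |p.2| + L < R := by
    have := abs_sub_abs_le_abs_sub p.2 p₀.2
    have := le_abs_self L
    linarith
  rw [conv_eq_box hv hp3, convolution_def, ← integral_indicator (measurableSet_box R)]
  refine integral_congr_ae (ae_of_all _ fun q => ?_)
  simp only [ContinuousLinearMap.mul_apply']
  by_cases hq : q ∈ box R
  · rw [indicator_of_mem hq, indicator_of_mem hq, χ.one_of_mem_closedBall, one_mul]
    have hq1 : ‖q‖ ≤ Real.pi + R := by
      rw [Prod.norm_def]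
      refine max_le ?_ ?_
      · rw [Real.norm_eq_abs, abs_le]; constructor <;> linarith [hq.1.1, hq.1.2]
      · rw [Real.norm_eq_abs, abs_le]; constructor <;> linarith [hq.2.1, hq.2.2]
    rw [Metric.mem_closedBall, dist_eq_norm]
    calc ‖p - q - p₀‖ = ‖(p - p₀) - q‖ := by congr 1; abel
      _ ≤ ‖p - p₀‖ + ‖q‖ := norm_sub_le _ _
      _ ≤ 1 + (Real.pi + R) := by rw [← dist_eq_norm]; linarith
      _ = _ := by ring
  · rw [indicator_of_notMem hq, indicator_of_notMem hq, zero_mul]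

lemma continuous_conv {K v : ℝ × ℝ → ℝ} {L : ℝ} (hK : IsKernel K) (hv : IsDensity L v) :
    Continuous (conv K v) :=
  contDiff_zero.1 (by exact_mod_cast contDiff_conv (n := 0) hK hv (by exact_mod_cast contDiff_zero.2 hv.continuous))

lemma IsKernel.abs {K : ℝ × ℝ → ℝ} (hK : IsKernel K) : IsKernel fun q => |K q| :=
  ⟨hK.measurable.abs, fun x y => by simp only [hK.periodic x y], fun R => (hK.integrableOn R).abs⟩

lemma IsDensity.abs {L : ℝ} {v : ℝ × ℝ → ℝ} (hv : IsDensity L v) : IsDensity L fun q => |v q| :=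
  ⟨hv.continuous.abs, fun x y => by simp only [hv.periodic x y], fun p hp => by simp [hv.eq_zero p hp]⟩

/-- Differentiation of a convolution in a direction `e`, the derivative falling on the kernel. -/
lemma hasDerivAt_conv {K K' v : ℝ × ℝ → ℝ} {L : ℝ} (hK : IsKernel K) (hK' : IsKernel K')
    (hv : IsDensity L v) (e : ℝ × ℝ)
    (hd : ∀ᵐ q : ℝ × ℝ, ∀ s : ℝ, HasDerivAt (fun s : ℝ => K (q + s • e)) (K' (q + s • e)) s ∧
      ContinuousAt (fun s : ℝ => K' (q + s • e)) s) (p : ℝ × ℝ) (s₀ : ℝ) :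
    HasDerivAt (fun s : ℝ => conv K v (p + s • e)) (conv K' v (p + s₀ • e)) s₀ := by
  have hcont : Continuous fun s : ℝ => conv K' v (p + s • e) :=
    (continuous_conv hK' hv).comp (by fun_prop)
  have hd' : ∀ᵐ q : ℝ × ℝ, ∀ s : ℝ, HasDerivAt (fun s : ℝ => K (p - q + s • e)) (K' (p - q + s • e)) s ∧
      ContinuousAt (fun s : ℝ => K' (p - q + s • e)) s :=
    (Measure.measurePreserving_sub_left volume p).quasiMeasurePreserving.ae hd
  -- The fundamental theorem of calculus is applied to the kernel inside the integral, along the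
  -- lines that avoid its singularities, and then the integrals are exchanged. This only needs `K'`
  -- to be locally integrable, not a pointwise majorant for difference quotients.
  have key : ∀ a b, a ≤ b → conv K v (p + b • e) - conv K v (p + a • e)
      = ∫ t in a..b, conv K' v (p + t • e) := by
    intro a b hab
    have hint : Integrable (Function.uncurry fun (t : ℝ) (q : ℝ × ℝ) => K' (p + t • e - q) * v q)
        ((volume.restrict (Ioc a b)).prod (volume.restrict tube)) := by
      have hm : Measurable (Function.uncurry fun (t : ℝ) (q : ℝ × ℝ) => K' (p + t • e - q) * v q) :=
        (hK'.measurable.comp (g := K') (f := fun z : ℝ × (ℝ × ℝ) => p + z.1 • e - z.2)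
          (Continuous.measurable (by fun_prop))).mul (hv.continuous.measurable.comp measurable_snd)
      rw [integrable_prod_iff hm.aestronglyMeasurable]
      refine ⟨ae_of_all _ fun t => integrableOn_conv_comm hK' hv (p + t • e), ?_⟩
      have hc : Continuous fun t : ℝ => conv (fun q => |K' q|) (fun q => |v q|) (p + t • e) :=
        (continuous_conv hK'.abs hv.abs).comp (by fun_prop)
      refine Integrable.congr (f := fun t : ℝ => conv (fun q => |K' q|) (fun q => |v q|) (p + t • e))
        ((hc.integrableOn_Icc (a := a) (b := b)).mono_set Ioc_subset_Icc_self)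
        (ae_of_all _ fun t => ?_)
      simp only [Function.uncurry_apply_pair, norm_mul, Real.norm_eq_abs]
      exact conv_comm hK'.abs hv.abs _
    rw [conv_comm hK hv, conv_comm hK hv, ← integral_sub (integrableOn_conv_comm hK hv _)
      (integrableOn_conv_comm hK hv _), intervalIntegral.integral_of_le hab]
    calc _ = ∫ q in tube, ∫ t in Ioc a b, K' (p + t • e - q) * v q := by
          refine integral_congr_ae ((ae_restrict_of_ae hd').mono fun q hq => ?_)
          simp only
          rw [← intervalIntegral.integral_of_le hab, intervalIntegral.integral_mul_const, ← sub_mul]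
          congr 1
          have e1 : ∀ t : ℝ, p + t • e - q = p - q + t • e := fun t => by abel
          simp only [e1]
          exact (intervalIntegral.integral_eq_sub_of_hasDerivAt (fun t _ => (hq t).1)
            (Continuous.intervalIntegrable (continuous_iff_continuousAt.2 fun t => (hq t).2) _ _)).symm
      _ = ∫ t in Ioc a b, ∫ q in tube, K' (p + t • e - q) * v q := (integral_integral_swap hint).symm
      _ = _ := by simp only [← conv_comm hK' hv]
  have key' : ∀ s, conv K v (p + s • e) = conv K v (p + (s₀ - 1) • e)
      + ∫ t in (s₀ - 1)..s, conv K' v (p + t • e) := by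
    intro s
    rcases le_total (s₀ - 1) s with h | h
    · rw [← key _ _ h]; ring
    · rw [intervalIntegral.integral_symm, ← key _ _ h]; ring
  rw [show (fun s : ℝ => conv K v (p + s • e)) = _ from funext key']
  have := intervalIntegral.integral_hasDerivAt_right (a := s₀ - 1) (b := s₀)
    (hcont.intervalIntegrable _ _)
    hcont.stronglyMeasurable.stronglyMeasurableAtFilter hcont.continuousAt
  simpa using this.const_add (conv K v (p + (s₀ - 1) • e))

end

noncomputable section

/-! ### The logarithmic kernel and its derivatives -/

/-- `cosh y - cos x`. -/
def den (q : ℝ × ℝ) : ℝ := Real.cosh q.2 - Real.cos q.1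

/-- `log (cosh y - cos x)`, which is `4π` times the Green function of `𝕋 × ℝ`. -/
def logKer (q : ℝ × ℝ) : ℝ := Real.log (den q)

/-- `∂ₓ logKer`. -/
def logKerX (q : ℝ × ℝ) : ℝ := Real.sin q.1 / den q

/-- `∂ᵧ logKer`. -/
def logKerY (q : ℝ × ℝ) : ℝ := Real.sinh q.2 / den q

lemma continuous_den : Continuous den := by unfold den; fun_prop

lemma den_nonneg (q : ℝ × ℝ) : 0 ≤ den q := by
  have := Real.one_le_cosh q.2
  have := Real.cos_le_one q.1
  unfold den; linarith

lemma den_pos_of_snd {q : ℝ × ℝ} (h : q.2 ≠ 0) : 0 < den q := by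
  have := Real.one_lt_cosh.2 h
  have := Real.cos_le_one q.1
  unfold den; linarith

lemma den_pos_of_fst {q : ℝ × ℝ} (h : Real.cos q.1 ≠ 1) : 0 < den q := by
  have := Real.one_le_cosh q.2
  have := lt_of_le_of_ne (Real.cos_le_one q.1) h
  unfold den; linarith

lemma den_periodic : PeriodicFst den := fun x y => by simp [den]

lemma sq_half_le_cosh_sub_one (z : ℝ) : z ^ 2 / 2 ≤ Real.cosh z - 1 := by
  have h1 : Real.cosh z = 1 + 2 * Real.sinh (z / 2) ^ 2 := by
    have := Real.cosh_two_mul (z / 2)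
    rw [mul_div_cancel₀ _ (two_ne_zero)] at this
    rw [this, Real.cosh_sq]; ring
  have h2 : |z / 2| ≤ |Real.sinh (z / 2)| := by
    rw [Real.abs_sinh]
    exact Real.self_le_sinh_iff.2 (abs_nonneg _)
  have := sq_le_sq.2 h2
  nlinarith

/-- Quadratic lower bounds for `1 - cos` and `cosh - 1`: in one period the denominator is comparable
from below to the squared distance to the singularity. -/
lemma le_den {q : ℝ × ℝ} (hq : |q.1| ≤ Real.pi) :
    2 / Real.pi ^ 2 * (q.1 ^ 2 + q.2 ^ 2) ≤ den q := by
  have h1 := Real.cos_le_one_sub_mul_cos_sq hq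
  have h2 := sq_half_le_cosh_sub_one q.2
  have h3 : 2 / Real.pi ^ 2 ≤ 1 / 2 := by
    have := Real.pi_gt_three
    rw [div_le_div_iff₀ (by positivity) (by norm_num)]
    nlinarith
  unfold den
  nlinarith [sq_nonneg q.2]

lemma den_le {q : ℝ × ℝ} {R : ℝ} (hq : |q.2| ≤ R) : den q ≤ Real.cosh R + 1 := by
  have h1 := Real.neg_one_le_cos q.1
  have h2 : Real.cosh q.2 ≤ Real.cosh R := Real.cosh_le_cosh.2 (hq.trans (le_abs_self R))
  unfold den; linarith

lemma integrableOn_inv_sqrt (R : ℝ) : IntegrableOn (fun x : ℝ => (√|x|)⁻¹) (Icc (-R) R) := by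
  have h0 : ∀ t, IntervalIntegrable (fun x : ℝ => (√|x|)⁻¹) volume 0 t := by
    refine fun t => (intervalIntegrable_of_even (fun x => by simp) (fun u hu => ?_) (a := 0) (b := t))
    have := intervalIntegral.intervalIntegrable_rpow' (a := 0) (b := u) (r := -(1 / 2)) (by norm_num)
    refine this.congr_ae ?_
    refine (ae_restrict_iff' measurableSet_uIoc).2 (ae_of_all _ fun x hx => ?_)
    rw [uIoc_of_le hu.le] at hx
    simp only
    rw [Real.rpow_neg hx.1.le, ← Real.sqrt_eq_rpow, abs_of_pos hx.1]
  by_cases hR : -R ≤ R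
  · have := ((h0 (-R)).symm.trans (h0 R))
    rwa [intervalIntegrable_iff_integrableOn_Icc_of_le hR] at this
  · rw [Icc_eq_empty hR]; exact integrableOn_empty

lemma integrableOn_inv_sqrt_mul (R : ℝ) :
    IntegrableOn (fun q : ℝ × ℝ => (√|q.1|)⁻¹ * (√|q.2|)⁻¹) (box R) := by
  unfold IntegrableOn box
  rw [Measure.volume_eq_prod, ← Measure.prod_restrict]
  exact ((integrableOn_inv_sqrt Real.pi).mono_set Ioc_subset_Icc_self).mul_prod
    (integrableOn_inv_sqrt R)

/-- With `u = √|x|` and `v = √|y|` this is `u³ v ≤ u⁴ + v⁴`, or the same with `u` and `v` exchanged.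
It bounds a singularity of the type `|q| / |q|²` by the product `|x|^(-1/2) |y|^(-1/2)` of
integrable functions of one variable. -/
lemma abs_div_le_inv_sqrt {a x y : ℝ} (ha : |a| ≤ |x| ∨ |a| ≤ |y|) :
    |a| ≤ (x ^ 2 + y ^ 2) * ((√|x|)⁻¹ * (√|y|)⁻¹) ∨ x = 0 ∨ y = 0 := by
  by_cases hx : x = 0
  · exact Or.inr (Or.inl hx)
  by_cases hy : y = 0
  · exact Or.inr (Or.inr hy)
  left
  have h1 : 0 < √|x| := Real.sqrt_pos.2 (abs_pos.2 hx)
  have h2 : 0 < √|y| := Real.sqrt_pos.2 (abs_pos.2 hy)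
  have e1 : |x| = √|x| ^ 2 := (Real.sq_sqrt (abs_nonneg x)).symm
  have e2 : |y| = √|y| ^ 2 := (Real.sq_sqrt (abs_nonneg y)).symm
  rw [← mul_inv, ← div_eq_mul_inv, le_div_iff₀ (mul_pos h1 h2), ← sq_abs x, ← sq_abs y]
  set u := √|x|
  set v := √|y|
  rw [e1, e2]
  rw [e1, e2] at ha
  have huv := mul_pos h1 h2
  have hm : |a| * (u * v) ≤ u ^ 2 * (u * v) ∨ |a| * (u * v) ≤ v ^ 2 * (u * v) :=
    ha.imp (fun h => mul_le_mul_of_nonneg_right h huv.le)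
      (fun h => mul_le_mul_of_nonneg_right h huv.le)
  rcases hm with h | h <;>
    nlinarith [sq_nonneg (u ^ 2 - v ^ 2), sq_nonneg (u - v), sq_nonneg (u ^ 2 - u * v),
      sq_nonneg (v ^ 2 - u * v), mul_nonneg huv.le (sq_nonneg (u - v))]

lemma isKernel_of_bound {K : ℝ × ℝ → ℝ} (hm : Measurable K) (hp : PeriodicFst K)
    (hb : ∀ R : ℝ, ∃ C, 0 ≤ C ∧ ∀ q ∈ box R, ∃ a, (|a| ≤ |q.1| ∨ |a| ≤ |q.2|) ∧ |K q| ≤ C * |a| / den q) :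
    IsKernel K := by
  refine ⟨hm, hp, fun R => ?_⟩
  obtain ⟨C, hC0, hC⟩ := hb R
  refine Integrable.mono' ((integrableOn_inv_sqrt_mul R).const_mul (C * (Real.pi ^ 2 / 2)))
    hm.aestronglyMeasurable ?_
  have hnull : ∀ᵐ q : ℝ × ℝ, q.1 ≠ 0 ∧ q.2 ≠ 0 := by
    have h1 : ∀ᵐ x : ℝ, x ≠ 0 := by simp [ae_iff]
    exact (Measure.quasiMeasurePreserving_fst.ae h1).and (Measure.quasiMeasurePreserving_snd.ae h1)
  refine (ae_restrict_iff' (measurableSet_box R)).2 (hnull.mono fun q hq hqb => ?_)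
  obtain ⟨a, ha, hKa⟩ := hC q hqb
  have hq1 : |q.1| ≤ Real.pi := abs_le.2 ⟨hqb.1.1.le, hqb.1.2⟩
  have hd := le_den hq1
  have hpi := Real.pi_pos
  have hdpos := den_pos_of_snd hq.2
  rw [Real.norm_eq_abs]
  refine hKa.trans ?_
  rw [div_le_iff₀ hdpos]
  rcases abs_div_le_inv_sqrt ha with h | h | h
  · have hs : 0 ≤ (√|q.1|)⁻¹ * (√|q.2|)⁻¹ := by positivity
    set S := (√|q.1|)⁻¹ * (√|q.2|)⁻¹
    calc C * |a| ≤ C * ((q.1 ^ 2 + q.2 ^ 2) * S) := by gcongr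
      _ = C * (Real.pi ^ 2 / 2) * S * (2 / Real.pi ^ 2 * (q.1 ^ 2 + q.2 ^ 2)) := by
        field_simp
      _ ≤ _ := by gcongr
  · exact absurd h hq.1
  · exact absurd h hq.2

lemma isKernel_logKerX : IsKernel logKerX := by
  refine isKernel_of_bound ?_ (fun x y => by simp [logKerX, den_periodic x y]) fun R => ?_
  · exact (Real.measurable_sin.comp measurable_fst).div continuous_den.measurable
  · refine ⟨1, zero_le_one, fun q _ => ⟨q.1, Or.inl le_rfl, ?_⟩⟩
    rw [logKerX, abs_div, abs_of_nonneg (den_nonneg q), one_mul]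
    exact div_le_div_of_nonneg_right Real.abs_sin_le_abs (den_nonneg q)

lemma abs_sinh_le {z R : ℝ} (hz : |z| ≤ R) : |Real.sinh z| ≤ Real.cosh R * |z| := by
  have := abs_sub_le_of_hasDerivAt (v := Real.sinh) (v' := Real.cosh) (s := 0) (t := z)
    (C := Real.cosh R) (fun r _ => Real.hasDerivAt_sinh r) (fun r hr => by
      rw [abs_of_pos (Real.cosh_pos r), Real.cosh_le_cosh]
      have : |r| ≤ |z| := by
        have := abs_sub_left_of_mem_uIcc hr
        simpa using this
      exact this.trans (hz.trans (le_abs_self R)))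
  simpa using this

lemma isKernel_logKerY : IsKernel logKerY := by
  refine isKernel_of_bound ?_ (fun x y => by simp [logKerY, den_periodic x y]) fun R => ?_
  · exact (Real.continuous_sinh.measurable.comp measurable_snd).div continuous_den.measurable
  · refine ⟨Real.cosh R, (Real.cosh_pos R).le, fun q hq => ⟨q.2, Or.inr le_rfl, ?_⟩⟩
    rw [logKerY, abs_div, abs_of_nonneg (den_nonneg q)]
    exact div_le_div_of_nonneg_right (abs_sinh_le (abs_le.2 hq.2)) (den_nonneg q)

lemma abs_log_le_add {a b c : ℝ} (ha : 0 < a) (hab : a ≤ b) (hbc : b ≤ c) :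
    |Real.log b| ≤ |Real.log a| + |Real.log c| := by
  have h1 := Real.log_le_log ha hab
  have h2 := Real.log_le_log (ha.trans_le hab) hbc
  have := neg_abs_le (Real.log a)
  have := le_abs_self (Real.log c)
  have := abs_nonneg (Real.log a)
  have := abs_nonneg (Real.log c)
  rw [abs_le]; constructor <;> linarith

/-- A logarithm is controlled by the logarithms of a lower and an upper bound of its argument. Here
these are a multiple of `x²` and the constant `cosh R + 1`, so the majorant depends on `x` alone. -/
lemma isKernel_logKer : IsKernel logKer := by
  have hm : Measurable logKer := Real.measurable_log.comp continuous_den.measurable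
  refine ⟨hm, fun x y => by simp [logKer, den_periodic x y], fun R => ?_⟩
  have hpi := Real.pi_pos
  have hlog : IntegrableOn Real.log (Ioc (-Real.pi) Real.pi) := by
    have := intervalIntegral.intervalIntegrable_log' (a := -Real.pi) (b := Real.pi)
    rwa [intervalIntegrable_iff_integrableOn_Ioc_of_le (by linarith)] at this
  have hb : Integrable (fun q : ℝ × ℝ => (|Real.log (2 / Real.pi ^ 2)| + 2 * |Real.log q.1|
      + |Real.log (Real.cosh R + 1)|) * 1) (volume.restrict (box R)) := by
    unfold box
    rw [Measure.volume_eq_prod, ← Measure.prod_restrict]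
    refine Integrable.mul_prod (f := fun x : ℝ => |Real.log (2 / Real.pi ^ 2)| + 2 * |Real.log x|
      + |Real.log (Real.cosh R + 1)|) (g := fun _ => (1 : ℝ)) ?_ (by simp)
    exact (((integrable_const _).add ((Integrable.abs hlog).const_mul 2)).add (integrable_const _))
  refine Integrable.mono' hb hm.aestronglyMeasurable ?_
  have hnull : ∀ᵐ q : ℝ × ℝ, q.1 ≠ 0 := by
    have h1 : ∀ᵐ x : ℝ, x ≠ 0 := by simp [ae_iff]
    exact Measure.quasiMeasurePreserving_fst.ae h1
  refine (ae_restrict_iff' (measurableSet_box R)).2 (hnull.mono fun q hq hqb => ?_)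
  have hd := le_den (abs_le.2 ⟨hqb.1.1.le, hqb.1.2⟩)
  have hx : 0 < 2 / Real.pi ^ 2 * q.1 ^ 2 := by positivity
  have h1 : 2 / Real.pi ^ 2 * q.1 ^ 2 ≤ den q := by
    refine le_trans ?_ hd
    have : 0 ≤ 2 / Real.pi ^ 2 := by positivity
    nlinarith [sq_nonneg q.2]
  have := abs_log_le_add hx h1 (den_le (abs_le.2 hqb.2))
  rw [Real.norm_eq_abs, logKer, mul_one]
  refine this.trans ?_
  rw [Real.log_mul (by positivity) (by positivity), Real.log_pow]
  have h2 := abs_add_le (Real.log (2 / Real.pi ^ 2)) ((2 : ℕ) * Real.log q.1)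
  rw [abs_mul] at h2
  norm_num at h2 ⊢
  linarith

lemma hasDerivAt_logKer_fst {x y : ℝ} (h : 0 < den (x, y)) :
    HasDerivAt (fun s => logKer (s, y)) (logKerX (x, y)) x := by
  have h1 : HasDerivAt (fun s => den (s, y)) (Real.sin x) x := by
    simpa [den] using (Real.hasDerivAt_cos x).const_sub (Real.cosh y)
  exact h1.log h.ne'

lemma hasDerivAt_logKer_snd {x y : ℝ} (h : 0 < den (x, y)) :
    HasDerivAt (fun s => logKer (x, s)) (logKerY (x, y)) y := by
  have h1 : HasDerivAt (fun s => den (x, s)) (Real.sinh y) y := by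
    simpa [den] using (Real.hasDerivAt_cosh y).sub_const (Real.cos x)
  exact h1.log h.ne'

lemma continuousAt_logKerX {q : ℝ × ℝ} (h : 0 < den q) : ContinuousAt logKerX q :=
  (by fun_prop : ContinuousAt (fun q : ℝ × ℝ => Real.sin q.1) q).div continuous_den.continuousAt h.ne'

lemma continuousAt_logKerY {q : ℝ × ℝ} (h : 0 < den q) : ContinuousAt logKerY q :=
  (by fun_prop : ContinuousAt (fun q : ℝ × ℝ => Real.sinh q.2) q).div continuous_den.continuousAt h.ne'

lemma ae_cos_ne_one : ∀ᵐ x : ℝ, Real.cos x ≠ 1 := by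
  rw [ae_iff]
  refine Set.Countable.measure_zero ?_ _
  refine (Set.countable_range (fun k : ℤ => (k : ℝ) * (2 * Real.pi))).mono fun x hx => ?_
  simp only [ne_eq, not_not, mem_ofPred_eq, Real.cos_eq_one_iff] at hx
  exact hx

variable {v : ℝ × ℝ → ℝ} {L : ℝ}

/-- The kernel is singular only at the points `(2πk, 0)`, so every horizontal line with `q.2 ≠ 0`
avoids the singularities. In the vertical direction the lines with `cos q.1 ≠ 1` play this role. -/
lemma hasDerivAt_conv_logKer_fst (hv : IsDensity L v) (x y : ℝ) :
    HasDerivAt (fun s => conv logKer v (s, y)) (conv logKerX v (x, y)) x := by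
  have := hasDerivAt_conv isKernel_logKer isKernel_logKerX hv (1, 0) ?_ (0, y) x
  · simpa using this
  have h1 : ∀ᵐ y : ℝ, y ≠ 0 := by simp [ae_iff]
  filter_upwards [Measure.quasiMeasurePreserving_snd.ae h1] with q hq s
  have e : ∀ s : ℝ, q + s • ((1 : ℝ), (0 : ℝ)) = (q.1 + s, q.2) := fun s => by ext <;> simp
  simp only [e]
  have hpos : 0 < den (q.1 + s, q.2) := den_pos_of_snd hq
  exact ⟨(hasDerivAt_logKer_fst hpos).comp_const_add q.1 s,
    ContinuousAt.comp (f := fun s : ℝ => (q.1 + s, q.2)) (x := s) (continuousAt_logKerX hpos) (by fun_prop)⟩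

lemma hasDerivAt_conv_logKer_snd (hv : IsDensity L v) (x y : ℝ) :
    HasDerivAt (fun s => conv logKer v (x, s)) (conv logKerY v (x, y)) y := by
  have := hasDerivAt_conv isKernel_logKer isKernel_logKerY hv (0, 1) ?_ (x, 0) y
  · simpa using this
  filter_upwards [Measure.quasiMeasurePreserving_fst.ae ae_cos_ne_one] with q hq s
  have e : ∀ s : ℝ, q + s • ((0 : ℝ), (1 : ℝ)) = (q.1, q.2 + s) := fun s => by ext <;> simp
  simp only [e]
  have hpos : 0 < den (q.1, q.2 + s) := den_pos_of_fst hq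
  exact ⟨(hasDerivAt_logKer_snd hpos).comp_const_add q.2 s,
    ContinuousAt.comp (f := fun s : ℝ => (q.1, q.2 + s)) (x := s) (continuousAt_logKerY hpos) (by fun_prop)⟩

/-- Both partial derivatives exist everywhere and are continuous, which gives differentiability. -/
lemma hasFDerivAt_conv_logKer (hv : IsDensity L v) (p : ℝ × ℝ) :
    HasFDerivAt (conv logKer v) (conv logKerX v p • ContinuousLinearMap.fst ℝ ℝ ℝ
      + conv logKerY v p • ContinuousLinearMap.snd ℝ ℝ ℝ) p := by
  have hX := continuous_conv isKernel_logKerX hv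
  have hY := continuous_conv isKernel_logKerY hv
  have := (hasStrictFDerivAt_uncurry_coprod (𝕜 := ℝ) (u := p) (f := fun x y => conv logKer v (x, y))
    (f₁ := fun x y => (1 : ℝ →L[ℝ] ℝ).smulRight (conv logKerX v (x, y)))
    (f₂ := fun x y => (1 : ℝ →L[ℝ] ℝ).smulRight (conv logKerY v (x, y)))
    (Eventually.of_forall fun q => (hasDerivAt_conv_logKer_fst hv q.1 q.2).hasFDerivAt)
    (Eventually.of_forall fun q => (hasDerivAt_conv_logKer_snd hv q.1 q.2).hasFDerivAt)
    ?_ ?_).hasFDerivAt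
  · have e : ((1 : ℝ →L[ℝ] ℝ).smulRight (conv logKerX v p)).coprod
        ((1 : ℝ →L[ℝ] ℝ).smulRight (conv logKerY v p))
        = conv logKerX v p • ContinuousLinearMap.fst ℝ ℝ ℝ
          + conv logKerY v p • ContinuousLinearMap.snd ℝ ℝ ℝ := by
      ext <;> simp
    rw [← e]
    exact this
  · exact Continuous.continuousAt (by simp only [Function.HasUncurry.uncurry, id]; fun_prop)
  · exact Continuous.continuousAt (by simp only [Function.HasUncurry.uncurry, id]; fun_prop)

/-- The logarithmic potential gains one derivative. -/
lemma contDiff_succ_conv_logKer (hv : IsDensity L v) {n : ℕ} (hn : ContDiff ℝ n v) :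
    ContDiff ℝ (n + 1 : ℕ) (conv logKer v) := by
  rw [Nat.cast_add, Nat.cast_one, contDiff_succ_iff_hasFDerivAt]
  refine ⟨_, ?_, hasFDerivAt_conv_logKer hv⟩
  exact ((contDiff_conv isKernel_logKerX hv hn).smul contDiff_const).add
    ((contDiff_conv isKernel_logKerY hv hn).smul contDiff_const)

end

noncomputable section

/-! ### Level curves -/

/-- Smooth dependence of an integral over a period on a parameter. -/
lemma contDiffOn_integral_period {n : ℕ} {S : Set ℝ} (hS : IsOpen S) {Z : ℝ × ℝ → ℝ}
    (hZ : ContDiffOn ℝ n Z (univ ×ˢ S)) :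
    ContDiffOn ℝ n (fun s => ∫ x in (-Real.pi)..Real.pi, Z (x, s)) S := by
  have hpi := Real.pi_pos
  let χ : ContDiffBump (0 : ℝ) := ⟨Real.pi + 1, Real.pi + 2, by positivity, by linarith⟩
  have hf : LocallyIntegrable ((Ioc (-Real.pi) Real.pi).indicator fun _ => (1 : ℝ)) :=
    (integrable_indicator_iff measurableSet_Ioc |>.2 (integrableOn_const (by simp))).locallyIntegrable
  have hg : ContDiffOn ℝ n (fun q : ℝ × ℝ => χ q.2 * Z (-q.2, q.1)) (S ×ˢ univ) := by
    refine ContDiffOn.mul (χ.contDiff.comp contDiff_snd).contDiffOn ?_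
    exact hZ.comp (by fun_prop) fun q hq => ⟨mem_univ _, hq.1⟩
  -- The integral over a period is the value at `0` of the convolution with the indicator of the
  -- period; the reflected argument `-x` undoes the one in the convolution, and `χ` makes the
  -- support compact.
  have main := contDiffOn_convolution_right_with_param_comp (μ := volume) (n := (n : ℕ∞))
    (ContinuousLinearMap.mul ℝ ℝ) (v := fun _ : ℝ => (0 : ℝ)) contDiffOn_const
    (g := fun s x => χ x * Z (-x, s)) (k := tsupport χ) hS χ.hasCompactSupport
    (fun s x _ hx => by rw [image_eq_zero_of_notMem_tsupport hx, zero_mul]) hf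
    (by simpa [Function.HasUncurry.uncurry] using hg)
  refine ContDiffOn.congr (by exact_mod_cast main) fun s _ => ?_
  rw [convolution_def, intervalIntegral.integral_of_le (by linarith),
    ← integral_indicator measurableSet_Ioc]
  refine integral_congr_ae (ae_of_all _ fun t => ?_)
  simp only [ContinuousLinearMap.mul_apply', zero_sub, neg_neg]
  by_cases ht : t ∈ Ioc (-Real.pi) Real.pi
  · rw [indicator_of_mem ht, indicator_of_mem ht, one_mul, χ.one_of_mem_closedBall, one_mul]
    rw [mem_closedBall_zero_iff, Real.norm_eq_abs, abs_le]
    constructor <;> simp only [χ] <;> linarith [ht.1, ht.2]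
  · rw [indicator_of_notMem ht, indicator_of_notMem ht, zero_mul]

/-- Local smoothness of the solution of `Φ(x, Z(x, s)) = s`. -/
lemma contDiffAt_level {n : ℕ} (hn : n ≠ 0) {Φ Φz : ℝ × ℝ → ℝ} (hΦ : ContDiff ℝ n Φ)
    (hd : ∀ x z, HasDerivAt (fun s => Φ (x, s)) (Φz (x, z)) z) {J S : Set ℝ} (hJ : IsOpen J)
    (hS : IsOpen S)
    (hinj : ∀ x, InjOn (fun z => Φ (x, z)) J) {Z : ℝ × ℝ → ℝ}
    (hZ : ∀ x, ∀ s ∈ S, Z (x, s) ∈ J ∧ Φ (x, Z (x, s)) = s) {x₀ s₀ : ℝ} (hs₀ : s₀ ∈ S)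
    (hne : Φz (x₀, Z (x₀, s₀)) ≠ 0) : ContDiffAt ℝ n Z (x₀, s₀) := by
  set z₀ := Z (x₀, s₀) with hz₀
  let f : (ℝ × ℝ) × ℝ → ℝ := fun w => Φ (w.1.1, w.2) - w.1.2
  have hf : ContDiff ℝ n f := by
    refine ContDiff.sub (hΦ.comp ?_) ?_ <;> fun_prop
  have cdf : ContDiffAt ℝ n f ((x₀, s₀), z₀) := hf.contDiffAt
  have hn' : (n : WithTop ℕ∞) ≠ 0 := by exact_mod_cast hn
  have hinr : fderiv ℝ f ((x₀, s₀), z₀) ∘L .inr ℝ (ℝ × ℝ) ℝ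
      = (ContinuousLinearEquiv.unitsEquivAut ℝ (Units.mk0 _ hne) : ℝ →L[ℝ] ℝ) := by
    ext
    have h1 : HasDerivAt (fun s : ℝ => f ((x₀, s₀), s)) (Φz (x₀, z₀)) z₀ := (hd x₀ z₀).sub_const s₀
    have h2 : HasDerivAt (fun s : ℝ => ((x₀, s₀), s)) ((0 : ℝ × ℝ), (1 : ℝ)) z₀ :=
      (hasDerivAt_const _ _).prodMk (hasDerivAt_id _)
    have h3 := ((cdf.differentiableAt hn').hasFDerivAt.comp_hasDerivAt z₀ h2).unique h1
    simpa using h3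
  have hinv : (fderiv ℝ f ((x₀, s₀), z₀) ∘L .inr ℝ (ℝ × ℝ) ℝ).IsInvertible := by
    rw [hinr]; exact ContinuousLinearMap.isInvertible_equiv
  have hψ := cdf.contDiffAt_implicitFunction hn' hinv
  refine hψ.congr_of_eventuallyEq ?_
  have h0 : cdf.implicitFunction hn' hinv (x₀, s₀) = z₀ := cdf.implicitFunction_apply_self hn' hinv
  have hJn : ∀ᶠ p in 𝓝 (x₀, s₀), cdf.implicitFunction hn' hinv p ∈ J := by
    refine hψ.continuousAt.eventually_mem (hJ.mem_nhds ?_)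
    simp only
    rw [h0]
    exact (hZ x₀ s₀ hs₀).1
  have hSn : ∀ᶠ p : ℝ × ℝ in 𝓝 (x₀, s₀), p.2 ∈ S :=
    continuousAt_snd.eventually_mem (hS.mem_nhds hs₀)
  filter_upwards [cdf.eventually_apply_implicitFunction hn' hinv, hJn, hSn] with p hp hpJ hpS
  have e0 : f ((x₀, s₀), z₀) = 0 := by simp [f, hz₀, (hZ x₀ s₀ hs₀).2]
  rw [e0] at hp
  have h1 := hZ p.1 p.2 hpS
  -- Both `Z p` and the implicit function solve the equation inside `J`, where the solution is
  -- unique. No continuity of `Z` has been assumed.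
  refine hinj p.1 h1.1 hpJ ?_
  simp only
  rw [h1.2]
  simp only [f] at hp
  linarith

/-- Near a band of level curves `z = Y(x, y)`, `a ≤ y ≤ b`, of a `C^n` function `Φ` with nonzero
`z`-derivative, the label `y` is a `C^n` function of `(x, z)`, provided that `Y(⬝, y)` has mean `y`. -/
lemma exists_label {n : ℕ} (hn : n ≠ 0) {Φ Φz : ℝ × ℝ → ℝ} (hΦ : ContDiff ℝ n Φ)
    (hd : ∀ x z, HasDerivAt (fun s => Φ (x, s)) (Φz (x, z)) z) {a b c δ : ℝ} (hab : a ≤ b)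
    (hc : 0 < c) (hδ : 0 < δ) (hcz : ∀ x, ∀ z ∈ Ioo (a - δ) (b + δ), c ≤ Φz (x, z))
    {Y : ℝ → ℝ → ℝ} {C : ℝ → ℝ}
    (hYmono : ∀ x, ∀ y ∈ Icc a b, ∀ y' ∈ Icc a b, y ≤ y' → Y x y ≤ Y x y')
    (hYδ : ∀ x, ∀ y ∈ Icc a b, |Y x y - y| ≤ δ / 2)
    (hYC : ∀ x, ∀ y ∈ Icc a b, Φ (x, Y x y) = C y)
    (hYmean : ∀ y ∈ Icc a b, ∫ x in (-Real.pi)..Real.pi, Y x y = 2 * Real.pi * y) :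
    ∃ (O : Set (ℝ × ℝ)) (m : ℝ × ℝ → ℝ), IsOpen O ∧ ContDiffOn ℝ n m O ∧
      (∀ p ∈ O, p.2 ∈ Ioo (a - δ) (b + δ)) ∧
      (∀ x, ∀ y ∈ Icc a b, (x, Y x y) ∈ O ∧ m (x, Y x y) = y) ∧
      (∀ x z, (x, z) ∈ O → z < Y x a → m (x, z) < a ∧ a - δ ≤ m (x, z)) ∧
      (∀ x z, (x, z) ∈ O → Y x b < z → b < m (x, z) ∧ m (x, z) ≤ b + δ) := by
  have hpi := Real.pi_pos
  set J := Ioo (a - δ) (b + δ) with hJ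
  have ha : a ∈ Icc a b := ⟨le_rfl, hab⟩
  have hb : b ∈ Icc a b := ⟨hab, le_rfl⟩
  have hgrow : ∀ x, ∀ z₁ ∈ J, ∀ z₂ ∈ J, z₁ ≤ z₂ → c * (z₂ - z₁) ≤ Φ (x, z₂) - Φ (x, z₁) := by
    intro x z₁ h₁ z₂ h₂ h12
    refine (convex_Ioo _ _).mul_sub_le_image_sub_of_le_deriv (f := fun z => Φ (x, z))
      (fun z _ => (hd x z).continuousAt.continuousWithinAt)
      (fun z _ => (hd x z).differentiableAt.differentiableWithinAt) (fun z hz => ?_) z₁ h₁ z₂ h₂ h12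
    rw [(hd x z).deriv]
    exact hcz x z (interior_subset hz)
  have hstrict : ∀ x, StrictMonoOn (fun z => Φ (x, z)) J := by
    intro x z₁ h₁ z₂ h₂ h12
    have := hgrow x z₁ h₁ z₂ h₂ h12.le
    have := mul_pos hc (sub_pos.2 h12)
    simp only
    linarith
  have hYJ : ∀ x, ∀ y ∈ Icc a b, Y x y ∈ J := by
    intro x y hy
    have := abs_le.1 (hYδ x y hy)
    constructor <;> linarith [hy.1, hy.2]
  have hCmono : ∀ y ∈ Icc a b, C a ≤ C y ∧ C y ≤ C b := by
    intro y hy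
    rw [← hYC 0 a ha, ← hYC 0 y hy, ← hYC 0 b hb]
    exact ⟨(hstrict 0).monotoneOn (hYJ 0 a ha) (hYJ 0 y hy) (hYmono 0 a ha y hy hy.1),
      (hstrict 0).monotoneOn (hYJ 0 y hy) (hYJ 0 b hb) (hYmono 0 y hy b hb hy.2)⟩
  -- The curves stay within `δ / 2` of their labels, so the extreme ones can move outwards by `δ /
  -- 4` without leaving `J`. On the way `Φ` changes by at least `c δ / 4`, hence all values in `S`
  -- are attained in `J`.
  set S := Ioo (C a - c * (δ / 4)) (C b + c * (δ / 4)) with hS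
  have hcδ : 0 < c * (δ / 4) := by positivity
  have hCS : ∀ y ∈ Icc a b, C y ∈ S := fun y hy =>
    ⟨by linarith [(hCmono y hy).1], by linarith [(hCmono y hy).2]⟩
  have hex : ∀ p : ℝ × ℝ, ∃ z, p.2 ∈ S → z ∈ J ∧ Φ (p.1, z) = p.2 := by
    rintro ⟨x, s⟩
    by_cases hs : s ∈ S
    swap; · exact ⟨0, fun h => absurd h hs⟩
    have h1 := abs_le.1 (hYδ x a ha)
    have h2 := abs_le.1 (hYδ x b hb)
    have hm := hYmono x a ha b hb hab
    have z1 : Y x a - δ / 4 ∈ J := ⟨by linarith, by linarith⟩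
    have z2 : Y x b + δ / 4 ∈ J := ⟨by linarith, by linarith⟩
    have g1 := hgrow x _ z1 _ (hYJ x a ha) (by linarith)
    have g2 := hgrow x _ (hYJ x b hb) _ z2 (by linarith)
    rw [hYC x a ha] at g1
    rw [hYC x b hb] at g2
    have hcont : ContinuousOn (fun z => Φ (x, z)) (Icc (Y x a - δ / 4) (Y x b + δ / 4)) :=
      fun z _ => (hd x z).continuousAt.continuousWithinAt
    obtain ⟨z, hz, hzs⟩ := intermediate_value_Icc (by linarith) hcont
      (show s ∈ Icc _ _ from ⟨by linarith [hs.1], by linarith [hs.2]⟩)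
    exact ⟨z, fun _ => ⟨ordConnected_Ioo.out z1 z2 hz, hzs⟩⟩
  choose Z hZ using hex
  have hZ' : ∀ x, ∀ s ∈ S, Z (x, s) ∈ J ∧ Φ (x, Z (x, s)) = s := fun x s hs => hZ (x, s) hs
  have hZY : ∀ x, ∀ y ∈ Icc a b, Z (x, C y) = Y x y := by
    intro x y hy
    have h := hZ' x (C y) (hCS y hy)
    exact (hstrict x).injOn h.1 (hYJ x y hy) (h.2.trans (hYC x y hy).symm)
  have hZmono : ∀ x, ∀ s ∈ S, ∀ s' ∈ S, s < s' → Z (x, s) < Z (x, s') := by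
    intro x s hs s' hs' hss
    by_contra h
    have := (hstrict x).monotoneOn (hZ' x s' hs').1 (hZ' x s hs).1 (not_lt.1 h)
    rw [(hZ' x s hs).2, (hZ' x s' hs').2] at this
    linarith
  have hZc : ContDiffOn ℝ n Z (univ ×ˢ S) := by
    rintro ⟨x, s⟩ ⟨-, hs⟩
    refine (contDiffAt_level hn hΦ hd isOpen_Ioo isOpen_Ioo (fun x => (hstrict x).injOn) hZ' hs
      ?_).contDiffWithinAt
    exact (hc.trans_le (hcz x _ (hZ' x s hs).1)).ne'
  have hM := contDiffOn_integral_period isOpen_Ioo hZc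
  have hZx : ∀ s ∈ S, Continuous fun x => Z (x, s) := fun s hs => by
    have : ContinuousOn (fun x => Z (x, s)) univ :=
      hZc.continuousOn.comp (by fun_prop) fun x _ => ⟨mem_univ _, hs⟩
    exact continuousOn_univ.1 this
  -- The mean height of the level curve of value `s`. Since `Y(·, y)` has mean `y`, `M` is a left
  -- inverse of `C` on `[a, b]`. It inherits the regularity of `Z`, although none is known for `Y`
  -- in `y` or for `C`.
  set M : ℝ → ℝ := fun s => (2 * Real.pi)⁻¹ * ∫ x in (-Real.pi)..Real.pi, Z (x, s) with hMdef
  have hMC : ∀ y ∈ Icc a b, M (C y) = y := by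
    intro y hy
    simp only [hMdef, hZY _ y hy, hYmean y hy]
    field_simp
  have hMmono : ∀ s ∈ S, ∀ s' ∈ S, s < s' → M s < M s' := by
    intro s hs s' hs' hss
    refine mul_lt_mul_of_pos_left ?_ (by positivity)
    refine intervalIntegral.integral_lt_integral_of_continuousOn_of_le_of_exists_lt (by linarith)
      (hZx s hs).continuousOn (hZx s' hs').continuousOn (fun x _ => (hZmono x s hs s' hs' hss).le)
      ⟨0, ⟨by linarith, by linarith⟩, hZmono 0 s hs s' hs' hss⟩
  have hMJ : ∀ s ∈ S, a - δ ≤ M s ∧ M s ≤ b + δ := by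
    intro s hs
    have h1 := intervalIntegral.integral_mono_on (μ := volume) (a := -Real.pi) (b := Real.pi)
      (by linarith) (f := fun _ => a - δ) (g := fun x => Z (x, s)) (by simp)
      ((hZx s hs).intervalIntegrable _ _) (fun x _ => (hZ' x s hs).1.1.le)
    have h2 := intervalIntegral.integral_mono_on (μ := volume) (a := -Real.pi) (b := Real.pi)
      (by linarith) (f := fun x => Z (x, s)) (g := fun _ => b + δ)
      ((hZx s hs).intervalIntegrable _ _) (by simp) (fun x _ => (hZ' x s hs).1.2.le)
    simp only [intervalIntegral.integral_const, smul_eq_mul] at h1 h2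
    rw [hMdef]
    simp only
    rw [inv_mul_eq_div, le_div_iff₀ (by positivity), div_le_iff₀ (by positivity)]
    constructor <;> linarith
  refine ⟨{p | p.2 ∈ J ∧ Φ p ∈ S}, fun p => M (Φ p), ?_, ?_, fun p hp => hp.1, ?_, ?_, ?_⟩
  · exact (isOpen_Ioo.preimage continuous_snd).inter (isOpen_Ioo.preimage hΦ.continuous)
  · exact (contDiffOn_const.mul hM).comp hΦ.contDiffOn fun p hp => hp.2
  · intro x y hy
    refine ⟨⟨hYJ x y hy, ?_⟩, ?_⟩
    · show Φ (x, Y x y) ∈ S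
      rw [hYC x y hy]; exact hCS y hy
    · simp only
      rw [hYC x y hy, hMC y hy]
  · rintro x z ⟨hz, hs⟩ hlt
    have h := hstrict x hz (hYJ x a ha) hlt
    simp only [hYC x a ha] at h
    refine ⟨?_, (hMJ _ hs).1⟩
    have := hMmono _ hs _ (hCS a ha) h
    rwa [hMC a ha] at this
  · rintro x z ⟨hz, hs⟩ hlt
    have h := hstrict x (hYJ x b hb) hz hlt
    simp only [hYC x b hb] at h
    refine ⟨?_, (hMJ _ hs).2⟩
    have := hMmono _ (hCS b hb) _ hs h
    rwa [hMC b hb] at this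

end

noncomputable section

/-! ### The layers and the vorticity -/

/-- Projection to `[a, b]`. -/
def clamp (a b y : ℝ) : ℝ := max a (min y b)

lemma clamp_mem {a b : ℝ} (hab : a ≤ b) (y : ℝ) : clamp a b y ∈ Icc a b :=
  ⟨le_max_left _ _, max_le hab (min_le_right _ _)⟩

lemma continuous_clamp (a b : ℝ) : Continuous (clamp a b) := by unfold clamp; fun_prop

lemma abs_clamp_sub_le (a b y y' : ℝ) : |clamp a b y' - clamp a b y| ≤ |y' - y| := by
  unfold clamp
  refine (abs_max_sub_max_le_max _ _ _ _).trans ?_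
  rw [sub_self, abs_zero]
  refine max_le (abs_nonneg _) ((abs_min_sub_min_le_max _ _ _ _).trans ?_)
  rw [sub_self, abs_zero]
  exact max_le le_rfl (abs_nonneg _)

lemma clamp_of_mem {a b y : ℝ} (hy : y ∈ Icc a b) : clamp a b y = y := by
  unfold clamp
  rw [min_eq_left hy.2, max_eq_right hy.1]

lemma clamp_of_le {a b y : ℝ} (hab : a ≤ b) (hy : y ≤ a) : clamp a b y = a := by
  unfold clamp
  rw [min_eq_left (hy.trans hab), max_eq_left hy]

lemma clamp_of_ge {a b y : ℝ} (hab : a ≤ b) (hy : b ≤ y) : clamp a b y = b := by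
  unfold clamp
  rw [min_eq_right hy, max_eq_right hab]

/-- Extension of a function on the bands to the plane. -/
def extend (ε : ℝ) (f : ℝ × ℝ → ℝ) (p : ℝ × ℝ) : ℝ :=
  f (p.1, clamp (-1 - ε) (-1 + ε) p.2) + f (p.1, clamp (1 - ε) (1 + ε) p.2)
    - ((1 - clamp 0 1 ((p.2 + 1 - ε) / (2 - 2 * ε))) * f (p.1, 1 - ε)
      + clamp 0 1 ((p.2 + 1 - ε) / (2 - 2 * ε)) * f (p.1, -1 + ε))

variable {ε : ℝ} {f : ℝ × ℝ → ℝ}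

/-- On a band one clamp is the identity and the other is frozen at the inner edge of the opposite
band, whose value the last term removes. Between the bands the formula is linear interpolation of
the inner edge values. -/
lemma extend_eq (hε : 0 < ε) (hε1 : ε < 1) {x y : ℝ} (hy : y ∈ bands ε) :
    extend ε f (x, y) = f (x, y) := by
  unfold extend
  simp only
  rcases hy with hy | hy
  · rw [clamp_of_mem hy, clamp_of_le (by linarith) (by linarith [hy.2]),
      clamp_of_le (by norm_num) (div_nonpos_of_nonpos_of_nonneg (by linarith [hy.2]) (by linarith))]
    ring
  · rw [clamp_of_mem hy, clamp_of_ge (by linarith) (by linarith [hy.1]),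
      clamp_of_ge (by norm_num) (by rw [le_div_iff₀ (by linarith)]; linarith [hy.1])]
    ring

lemma lower_mem (hε : 0 < ε) (y : ℝ) : clamp (-1 - ε) (-1 + ε) y ∈ bands ε :=
  Or.inl (clamp_mem (by linarith) y)

lemma upper_mem (hε : 0 < ε) (y : ℝ) : clamp (1 - ε) (1 + ε) y ∈ bands ε :=
  Or.inr (clamp_mem (by linarith) y)

lemma continuous_extend (hε : 0 < ε) (hf : ContinuousOn f (univ ×ˢ bands ε)) :
    Continuous (extend ε f) := by
  have h : ∀ c : ℝ → ℝ, Continuous c → (∀ y, c y ∈ bands ε) →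
      Continuous fun p : ℝ × ℝ => f (p.1, c p.2) := fun c hc hm =>
    hf.comp_continuous (by fun_prop) fun p => ⟨mem_univ _, hm _⟩
  have h1 := h _ (continuous_clamp (-1 - ε) (-1 + ε)) (lower_mem hε)
  have h2 := h _ (continuous_clamp (1 - ε) (1 + ε)) (upper_mem hε)
  have h3 := h (fun _ => 1 - ε) continuous_const (fun _ => Or.inr ⟨le_rfl, by linarith⟩)
  have h4 := h (fun _ => -1 + ε) continuous_const (fun _ => Or.inl ⟨by linarith, le_rfl⟩)
  have h5 : Continuous fun p : ℝ × ℝ => clamp 0 1 ((p.2 + 1 - ε) / (2 - 2 * ε)) :=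
    (continuous_clamp 0 1).comp (by fun_prop)
  exact (h1.add h2).sub (((continuous_const.sub h5).mul h3).add (h5.mul h4))

lemma extend_periodic (hε : 0 < ε) (hp : ∀ x, ∀ y ∈ bands ε, f (x + 2 * Real.pi, y) = f (x, y)) :
    PeriodicFst (extend ε f) := by
  intro x y
  unfold extend
  simp only
  rw [hp _ _ (lower_mem hε y), hp _ _ (upper_mem hε y), hp _ _ (Or.inr ⟨le_rfl, by linarith⟩),
    hp _ _ (Or.inl ⟨by linarith, le_rfl⟩)]

lemma abs_extend_le (hε : 0 < ε) {s : ℝ} (hs : ∀ x, ∀ y ∈ bands ε, |f (x, y)| ≤ s) (p : ℝ × ℝ) :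
    |extend ε f p| ≤ 3 * s := by
  have h1 := abs_le.1 (hs p.1 _ (lower_mem hε p.2))
  have h2 := abs_le.1 (hs p.1 _ (upper_mem hε p.2))
  have h3 := abs_le.1 (hs p.1 (1 - ε) (Or.inr ⟨le_rfl, by linarith⟩))
  have h4 := abs_le.1 (hs p.1 (-1 + ε) (Or.inl ⟨by linarith, le_rfl⟩))
  have h5 := clamp_mem zero_le_one ((p.2 + 1 - ε) / (2 - 2 * ε))
  unfold extend
  set τ := clamp 0 1 ((p.2 + 1 - ε) / (2 - 2 * ε))
  have h6 : 0 ≤ 1 - τ := by linarith [h5.2]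
  rw [abs_le]
  constructor <;> nlinarith [h5.1, mul_nonneg h6 (sub_nonneg.2 h3.1), mul_nonneg h6 (sub_nonneg.2 h3.2),
    mul_nonneg h5.1 (sub_nonneg.2 h4.1), mul_nonneg h5.1 (sub_nonneg.2 h4.2)]

lemma abs_extend_sub_le (hε : 0 < ε) (hε1 : ε < 1) {s : ℝ} (hs : ∀ x, ∀ y ∈ bands ε, |f (x, y)| ≤ s)
    (hl : ∀ x y y', uIcc y y' ⊆ bands ε → |f (x, y') - f (x, y)| ≤ s * |y' - y|)
    (x y y' : ℝ) :
    |extend ε f (x, y') - extend ε f (x, y)| ≤ (2 * s + s / (1 - ε)) * |y' - y| := by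
  have hs0 : 0 ≤ s := (abs_nonneg _).trans (hs 0 _ (lower_mem hε 0))
  have h1 : |f (x, clamp (-1 - ε) (-1 + ε) y') - f (x, clamp (-1 - ε) (-1 + ε) y)| ≤ s * |y' - y| :=
    (hl x _ _ (fun t ht => Or.inl (ordConnected_Icc.uIcc_subset (clamp_mem (by linarith) y)
      (clamp_mem (by linarith) y') ht))).trans
      (mul_le_mul_of_nonneg_left (abs_clamp_sub_le _ _ _ _) hs0)
  have h2 : |f (x, clamp (1 - ε) (1 + ε) y') - f (x, clamp (1 - ε) (1 + ε) y)| ≤ s * |y' - y| :=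
    (hl x _ _ (fun t ht => Or.inr (ordConnected_Icc.uIcc_subset (clamp_mem (by linarith) y)
      (clamp_mem (by linarith) y') ht))).trans
      (mul_le_mul_of_nonneg_left (abs_clamp_sub_le _ _ _ _) hs0)
  have h3 := hs x (1 - ε) (Or.inr ⟨le_rfl, by linarith⟩)
  have h4 := hs x (-1 + ε) (Or.inl ⟨by linarith, le_rfl⟩)
  have h5 : |clamp 0 1 ((y' + 1 - ε) / (2 - 2 * ε)) - clamp 0 1 ((y + 1 - ε) / (2 - 2 * ε))|
      ≤ |y' - y| / (2 - 2 * ε) := by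
    refine (abs_clamp_sub_le _ _ _ _).trans (le_of_eq ?_)
    rw [← sub_div, abs_div, abs_of_pos (by linarith : 0 < 2 - 2 * ε)]
    congr 2
    ring
  have h6 : |(clamp 0 1 ((y' + 1 - ε) / (2 - 2 * ε)) - clamp 0 1 ((y + 1 - ε) / (2 - 2 * ε)))
      * (f (x, 1 - ε) - f (x, -1 + ε))| ≤ s / (1 - ε) * |y' - y| := by
    rw [abs_mul]
    calc _ ≤ |y' - y| / (2 - 2 * ε) * (s + s) :=
          mul_le_mul h5 ((abs_sub _ _).trans (add_le_add h3 h4)) (abs_nonneg _)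
            (div_nonneg (abs_nonneg _) (by linarith))
      _ = _ := by
          have : 1 - ε ≠ 0 := by linarith
          have : 2 - 2 * ε = 2 * (1 - ε) := by ring
          rw [this]; field_simp; ring
  unfold extend
  simp only
  set τ' := clamp 0 1 ((y' + 1 - ε) / (2 - 2 * ε))
  set τ := clamp 0 1 ((y + 1 - ε) / (2 - 2 * ε))
  set A' := f (x, clamp (-1 - ε) (-1 + ε) y')
  set A := f (x, clamp (-1 - ε) (-1 + ε) y)
  set B' := f (x, clamp (1 - ε) (1 + ε) y')
  set B := f (x, clamp (1 - ε) (1 + ε) y)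
  calc _ = |(A' - A) + (B' - B) + (τ' - τ) * (f (x, 1 - ε) - f (x, -1 + ε))| := by ring_nf
    _ ≤ |A' - A| + |B' - B| + |(τ' - τ) * (f (x, 1 - ε) - f (x, -1 + ε))| :=
        (abs_add_le _ _).trans (add_le_add_left (abs_add_le _ _) _)
    _ ≤ _ := by linarith

/-- `E` extends `f`, and `ζ(x, ⬝)` is the inverse of `y ↦ y + E(x, y)`. -/
structure Layering (ε s : ℝ) (f E ζ : ℝ × ℝ → ℝ) : Prop where
  continuous : Continuous E
  periodic : PeriodicFst E
  eq_on : ∀ x, ∀ y ∈ bands ε, E (x, y) = f (x, y)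
  bound : ∀ p, |E p| ≤ s
  lip : ∀ x y y', |E (x, y') - E (x, y)| ≤ 1 / 2 * |y' - y|
  add_self : ∀ x z, ζ (x, z) + E (x, ζ (x, z)) = z

lemma Layering.strictMono {s : ℝ} {E ζ : ℝ × ℝ → ℝ} (h : Layering ε s f E ζ) (x : ℝ) :
    StrictMono fun y => y + E (x, y) := by
  intro y y' hy
  have h1 := abs_le.1 (h.lip x y y')
  rw [abs_of_pos (sub_pos.2 hy)] at h1
  simp only
  linarith [h1.1]

lemma Layering.apply_add {s : ℝ} {E ζ : ℝ × ℝ → ℝ} (h : Layering ε s f E ζ) (x y : ℝ) :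
    ζ (x, y + E (x, y)) = y :=
  (h.strictMono x).injective (h.add_self x (y + E (x, y)))

lemma Layering.lt_iff {s : ℝ} {E ζ : ℝ × ℝ → ℝ} (h : Layering ε s f E ζ) (x y z : ℝ) :
    y < ζ (x, z) ↔ y + E (x, y) < z := by
  have := (h.strictMono x).lt_iff_lt (a := y) (b := ζ (x, z))
  simp only [h.add_self] at this
  exact this.symm

lemma Layering.gt_iff {s : ℝ} {E ζ : ℝ × ℝ → ℝ} (h : Layering ε s f E ζ) (x y z : ℝ) :
    ζ (x, z) < y ↔ z < y + E (x, y) := by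
  have := (h.strictMono x).lt_iff_lt (a := ζ (x, z)) (b := y)
  simp only [h.add_self] at this
  exact this.symm

lemma Layering.abs_sub_le {s : ℝ} {E ζ : ℝ × ℝ → ℝ} (h : Layering ε s f E ζ) (p : ℝ × ℝ) :
    |ζ p - p.2| ≤ s := by
  have h1 := h.add_self p.1 p.2
  have h2 := h.bound (p.1, ζ (p.1, p.2))
  calc |ζ p - p.2| = |-E (p.1, ζ (p.1, p.2))| := by congr 1; linarith
    _ ≤ s := by rwa [abs_neg]

lemma Layering.zeta_periodic {s : ℝ} {E ζ : ℝ × ℝ → ℝ} (h : Layering ε s f E ζ) : PeriodicFst ζ := by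
  intro x z
  apply (h.strictMono x).injective
  simp only
  rw [h.add_self, ← h.periodic, h.add_self]

/-- As `E` is `1/2`-Lipschitz in `y`, the maps `y ↦ y + E(x, y)` expand distances by at least `1/2`,
uniformly in `x`. An error in the equation for `ζ` is at most doubled. -/
lemma Layering.zeta_continuous {s : ℝ} {E ζ : ℝ × ℝ → ℝ} (h : Layering ε s f E ζ) : Continuous ζ := by
  rw [continuous_iff_continuousAt]
  rintro ⟨x, z⟩
  have key : ∀ q : ℝ × ℝ, |ζ q - ζ (x, z)| ≤ 2 * |q.2 - (ζ (x, z) + E (q.1, ζ (x, z)))| := by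
    intro q
    have h1 := h.lip q.1 (ζ (x, z)) (ζ q)
    have h2 := h.add_self q.1 q.2
    have h3 : |ζ q - ζ (x, z)| ≤ |q.2 - (ζ (x, z) + E (q.1, ζ (x, z)))|
        + |E (q.1, ζ q) - E (q.1, ζ (x, z))| := by
      calc _ = |(q.2 - (ζ (x, z) + E (q.1, ζ (x, z)))) - (E (q.1, ζ q) - E (q.1, ζ (x, z)))| := by
            congr 1
            change ζ q + E (q.1, ζ q) = q.2 at h2
            linarith
        _ ≤ _ := abs_sub _ _
    linarith
  have hE := h.continuous
  have hc : Continuous fun q : ℝ × ℝ => 2 * |q.2 - (ζ (x, z) + E (q.1, ζ (x, z)))| := by fun_prop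
  have h0 : 2 * |z - (ζ (x, z) + E (x, ζ (x, z)))| = 0 := by rw [h.add_self]; simp
  have hlim : Tendsto (fun q : ℝ × ℝ => 2 * |q.2 - (ζ (x, z) + E (q.1, ζ (x, z)))|) (𝓝 (x, z)) (𝓝 0) := by
    have := hc.tendsto (x, z)
    simp only [h0] at this
    exact this
  rw [ContinuousAt, tendsto_iff_dist_tendsto_zero]
  refine squeeze_zero (fun _ => dist_nonneg) (fun q => ?_) hlim
  rw [Real.dist_eq]
  exact key q

/-- A bounded continuous perturbation of the identity is onto by the intermediate value theorem. The
factor `3` is the loss in `abs_extend_le`. -/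
lemma exists_layering (hε : 0 < ε) (hε1 : ε < 1) {s : ℝ} (hs1 : s ≤ (1 - ε) / 6)
    (hf : ContinuousOn f (univ ×ˢ bands ε))
    (hp : ∀ x, ∀ y ∈ bands ε, f (x + 2 * Real.pi, y) = f (x, y))
    (hs : ∀ x, ∀ y ∈ bands ε, |f (x, y)| ≤ s)
    (hl : ∀ x y y', uIcc y y' ⊆ bands ε → |f (x, y') - f (x, y)| ≤ s * |y' - y|) :
    ∃ E ζ, Layering ε (3 * s) f E ζ := by
  have hc := continuous_extend hε hf
  have hb := abs_extend_le hε hs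
  have hex : ∀ p : ℝ × ℝ, ∃ y, y + extend ε f (p.1, y) = p.2 := by
    rintro ⟨x, z⟩
    have h1 := abs_le.1 (hb (x, z - 3 * s))
    have h2 := abs_le.1 (hb (x, z + 3 * s))
    have h0 : 0 ≤ 3 * s := (abs_nonneg _).trans (hb (0, 0))
    have hcont : ContinuousOn (fun y => y + extend ε f (x, y)) (Icc (z - 3 * s) (z + 3 * s)) := by
      fun_prop
    obtain ⟨y, -, hy⟩ := intermediate_value_Icc (by linarith) hcont
      (show z ∈ Icc _ _ from ⟨by linarith, by linarith⟩)
    exact ⟨y, hy⟩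
  choose ζ hζ using hex
  refine ⟨extend ε f, ζ, hc, extend_periodic hε hp, fun x y hy => extend_eq hε hε1 hy, hb,
    fun x y y' => (abs_extend_sub_le hε hε1 hs hl x y y').trans ?_, fun x z => hζ (x, z)⟩
  refine mul_le_mul_of_nonneg_right ?_ (abs_nonneg _)
  -- The threshold `(1 - ε) / 6` makes the Lipschitz constant at most `1/3 + 1/6 = 1/2`.
  have : s / (1 - ε) ≤ 1 / 6 := by rw [div_le_iff₀ (by linarith)]; linarith
  linarith

variable {Θ : ℝ → ℝ} {κ s : ℝ} {E ζ : ℝ × ℝ → ℝ}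

lemma Layering.isVorticity (h : Layering ε s f E ζ) (H : Admissible Θ ε κ) :
    IsVorticity Θ ε κ f fun p => profile Θ ε κ (ζ p) := by
  have he := H.ε_pos
  have m1 : (-1 + ε) ∈ bands ε := Or.inl ⟨by linarith, le_rfl⟩
  have m2 : (1 - ε) ∈ bands ε := Or.inr ⟨le_rfl, by linarith⟩
  have m3 : (1 + ε) ∈ bands ε := Or.inr ⟨by linarith, le_rfl⟩
  have m4 : (-1 - ε) ∈ bands ε := Or.inl ⟨le_rfl, by linarith⟩
  refine ⟨fun x y hy => ?_, fun x z h1 h2 => ?_, fun x z hz => ?_⟩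
  · rw [← h.eq_on x y hy, h.apply_add]
  · rw [← h.eq_on x _ m1, ← h.lt_iff] at h1
    rw [← h.eq_on x _ m2, ← h.gt_iff] at h2
    exact profile_inner H (abs_le.2 ⟨by linarith, h2.le⟩)
  · rcases hz with hz | hz
    · rw [← h.eq_on x _ m3, ← h.lt_iff] at hz
      exact profile_outer H (hz.le.trans (le_abs_self _))
    · rw [← h.eq_on x _ m4, ← h.gt_iff] at hz
      exact profile_outer H (by have := neg_le_abs (ζ (x, z)); linarith)

/-- By monotonicity of `y ↦ y + E(x, y)`, the position of `ζ(x, z)` relative to the bands decides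
which condition applies at `(x, z)`; every point falls under one of them. -/
lemma Layering.unique (h : Layering ε s f E ζ) (H : Admissible Θ ε κ) {w : ℝ × ℝ → ℝ}
    (hw : IsVorticity Θ ε κ f w) : w = fun p => profile Θ ε κ (ζ p) := by
  have he := H.ε_pos
  have m1 : (-1 + ε) ∈ bands ε := Or.inl ⟨by linarith, le_rfl⟩
  have m2 : (1 - ε) ∈ bands ε := Or.inr ⟨le_rfl, by linarith⟩
  have m3 : (1 + ε) ∈ bands ε := Or.inr ⟨by linarith, le_rfl⟩
  have m4 : (-1 - ε) ∈ bands ε := Or.inl ⟨le_rfl, by linarith⟩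
  funext ⟨x, z⟩
  by_cases hb : ζ (x, z) ∈ bands ε
  · have := hw.on_bands x _ hb
    rwa [← h.eq_on x _ hb, h.add_self] at this
  · rw [mem_bands_iff H, not_and_or, not_le, not_le] at hb
    rcases hb with hb | hb
    · rw [profile_inner H hb.le]
      rw [abs_lt] at hb
      refine hw.between x z ?_ ?_
      · rw [← h.eq_on x _ m1, ← h.lt_iff]; linarith
      · rw [← h.eq_on x _ m2, ← h.gt_iff]; exact hb.2
    · rw [profile_outer H hb.le]
      refine hw.outside x z ?_
      rw [← h.eq_on x _ m3, ← h.eq_on x _ m4, ← h.lt_iff, ← h.gt_iff]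
      rcases lt_abs.1 hb with hb | hb
      · exact Or.inl hb
      · exact Or.inr (by linarith)

lemma Layering.isDensity (h : Layering ε s f E ζ) (H : Admissible Θ ε κ) (hs : s ≤ 1) :
    IsDensity 3 fun p => profile Θ ε κ (ζ p) := by
  refine ⟨(contDiff_profile H).continuous.comp h.zeta_continuous, fun x y => ?_, fun p hp => ?_⟩
  · simp only [h.zeta_periodic x y]
  · refine profile_outer H ?_
    have h1 := h.abs_sub_le p
    have h2 := abs_sub_abs_le_abs_sub p.2 (ζ p)
    rw [abs_sub_comm] at h2
    linarith [H.ε_lt]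

end

noncomputable section

/-! ### The stream function along the level curves of the vorticity -/

/-- Integration by parts against a function of a monotone label. -/
lemma integral_mul_comp_label {k K g g' Y ζ : ℝ → ℝ} {z L R : ℝ} (hL : 0 < L)
    (hK : ∀ s, HasDerivAt K (k s) s) (hk : Continuous k) (hg : ∀ s, HasDerivAt g (g' s) s)
    (hg' : Continuous g') (hg0 : ∀ s, L ≤ |s| → g s = 0) (hY : StrictMono Y)
    (hζ : ∀ t u, t < ζ u ↔ Y t < u) (hR : ∀ t, |t| ≤ L → |z - Y t| < R) :
    ∫ s, k s * g (ζ (z - s)) = ∫ t in Ioo (-L) L, g' t * K (z - Y t) := by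
  have hgL : g L = 0 := hg0 _ (le_abs_self _)
  have hgL' : g (-L) = 0 := hg0 _ (by rw [abs_neg]; exact le_abs_self _)
  have hR0 : 0 < R := (abs_nonneg _).trans_lt (hR 0 (by simpa using hL.le))
  -- A layer-cake formula: `t < ζ u` means `Y t < u`, so `g (ζ u)` is the integral of `g'` over
  -- these `t`. Only monotonicity of the label is used, not differentiability.
  have key : ∀ u, g (ζ u) = ∫ t in Ioo (-L) L, (Ioi (0 : ℝ)).indicator 1 (u - Y t) * g' t := by
    intro u
    have e : ∀ t, (Ioi (0 : ℝ)).indicator (1 : ℝ → ℝ) (u - Y t) * g' t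
        = (Iio (ζ u)).indicator g' t := by
      intro t
      by_cases h : t < ζ u
      · rw [indicator_of_mem (mem_Iio.2 h), indicator_of_mem (mem_Ioi.2 (sub_pos.2 ((hζ t u).1 h))),
          Pi.one_apply, one_mul]
      · rw [indicator_of_notMem (by rw [mem_Ioi, sub_pos, ← hζ]; exact h),
          indicator_of_notMem (by simpa using h), zero_mul]
    simp only [e]
    rw [setIntegral_indicator measurableSet_Iio, Ioo_inter_Iio, ← integral_Ioc_eq_integral_Ioo]
    rcases le_or_gt (ζ u) (-L) with h | h
    · rw [Ioc_eq_empty (by simp [h]), setIntegral_empty]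
      exact hg0 _ (le_abs'.2 (Or.inl h))
    · rw [← intervalIntegral.integral_of_le (le_min (by linarith) h.le),
        intervalIntegral.integral_eq_sub_of_hasDerivAt (fun t _ => hg t)
          (hg'.intervalIntegrable _ _), hgL', sub_zero]
      rcases le_total L (ζ u) with h' | h'
      · rw [min_eq_left h', hgL, hg0 _ (h'.trans (le_abs_self _))]
      · rw [min_eq_right h']
  have h1 : ∫ s, k s * g (ζ (z - s)) = ∫ s in Ioo (-R) R, k s * g (ζ (z - s)) := by
    refine (setIntegral_eq_integral_of_forall_compl_eq_zero fun s hs => ?_).symm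
    have a1 := abs_lt.1 (hR L (abs_of_pos hL).le)
    have a2 := abs_lt.1 (hR (-L) (by rw [abs_neg, abs_of_pos hL]))
    rw [hg0, mul_zero]
    rw [mem_Ioo, not_and_or, not_lt, not_lt] at hs
    rcases hs with hs | hs
    · exact ((hζ L (z - s)).2 (by linarith)).le.trans (le_abs_self _)
    · refine le_abs'.2 (Or.inl (not_lt.1 fun h => ?_))
      have := (hζ (-L) (z - s)).1 h
      linarith
  have hint : Integrable (fun p : ℝ × ℝ => k p.1 * ((Ioi (0 : ℝ)).indicator 1 (z - p.1 - Y p.2) * g' p.2))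
      ((volume.restrict (Ioo (-R) R)).prod (volume.restrict (Ioo (-L) L))) := by
    have h0 : Integrable (fun p : ℝ × ℝ => k p.1 * g' p.2)
        ((volume.restrict (Ioo (-R) R)).prod (volume.restrict (Ioo (-L) L))) :=
      Integrable.mul_prod
        ((hk.continuousOn.integrableOn_Icc (a := -R) (b := R)).mono_set Ioo_subset_Icc_self)
        ((hg'.continuousOn.integrableOn_Icc (a := -L) (b := L)).mono_set Ioo_subset_Icc_self)
    have hm : MeasurableSet {p : ℝ × ℝ | 0 < z - p.1 - Y p.2} :=
      measurableSet_lt measurable_const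
        ((measurable_const.sub measurable_fst).sub (hY.monotone.measurable.comp measurable_snd))
    refine (h0.indicator hm).congr (ae_of_all _ fun p => ?_)
    by_cases hp : 0 < z - p.1 - Y p.2
    · rw [indicator_of_mem (show p ∈ {p : ℝ × ℝ | 0 < z - p.1 - Y p.2} from hp)]
      simp only
      rw [indicator_of_mem (mem_Ioi.2 hp), Pi.one_apply, one_mul]
    · rw [indicator_of_notMem (show p ∉ {p : ℝ × ℝ | 0 < z - p.1 - Y p.2} from hp)]
      simp only
      rw [indicator_of_notMem (by rw [mem_Ioi]; exact hp), zero_mul, mul_zero]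
  rw [h1]
  have h2 : ∀ s, k s * g (ζ (z - s))
      = ∫ t in Ioo (-L) L, k s * ((Ioi (0 : ℝ)).indicator 1 (z - s - Y t) * g' t) := fun s => by
    rw [key, integral_const_mul]
  simp only [h2]
  rw [integral_integral_swap hint]
  -- Truncation at `-R` leaves the term `K (-R) * g' t`, whose integral vanishes because `g` is zero
  -- at both ends.
  have h3 : ∀ t ∈ Ioo (-L) L,
      ∫ s in Ioo (-R) R, k s * ((Ioi (0 : ℝ)).indicator 1 (z - s - Y t) * g' t)
        = g' t * K (z - Y t) - K (-R) * g' t := by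
    intro t ht
    have a := abs_lt.1 (hR t (abs_lt.2 ht).le)
    have e : ∀ s, k s * ((Ioi (0 : ℝ)).indicator (1 : ℝ → ℝ) (z - s - Y t) * g' t)
        = g' t * (Iio (z - Y t)).indicator k s := by
      intro s
      by_cases h : s < z - Y t
      · rw [indicator_of_mem (mem_Iio.2 h), indicator_of_mem (mem_Ioi.2 (by linarith)),
          Pi.one_apply, one_mul, mul_comm]
      · rw [indicator_of_notMem (by rw [mem_Ioi]; linarith), indicator_of_notMem (by simpa using h)]
        ring
    simp only [e]
    rw [integral_const_mul, setIntegral_indicator measurableSet_Iio, Ioo_inter_Iio,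
      min_eq_right a.2.le, ← integral_Ioc_eq_integral_Ioo,
      ← intervalIntegral.integral_of_le a.1.le,
      intervalIntegral.integral_eq_sub_of_hasDerivAt (fun t _ => hK t)
          (hk.intervalIntegrable _ _)]
    ring
  rw [setIntegral_congr_fun measurableSet_Ioo h3, integral_sub, integral_const_mul]
  · have : ∫ t in Ioo (-L) L, g' t = 0 := by
      rw [← integral_Ioc_eq_integral_Ioo, ← intervalIntegral.integral_of_le (by linarith),
        intervalIntegral.integral_eq_sub_of_hasDerivAt (fun t _ => hg t)
          (hg'.intervalIntegrable _ _), hgL, hgL', sub_zero]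
    rw [this, mul_zero, sub_zero]
  · have hKc : Continuous K := continuous_iff_continuousAt.2 fun s => (hK s).continuousAt
    have hb : IntegrableOn g' (Ioo (-L) L) :=
      (hg'.continuousOn.integrableOn_Icc (a := -L) (b := L)).mono_set Ioo_subset_Icc_self
    obtain ⟨C, hC⟩ := (isCompact_Icc (a := -R) (b := R)).exists_bound_of_continuousOn hKc.continuousOn
    refine hb.mul_bdd (c := C) ?_ ?_
    · exact (hKc.measurable.comp (measurable_const.sub hY.monotone.measurable)).aestronglyMeasurable
    · refine (ae_restrict_iff' measurableSet_Ioo).2 (ae_of_all _ fun t ht => hC _ ?_)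
      exact abs_le.1 (hR t (abs_lt.2 ht).le).le
  · exact ((hg'.continuousOn.integrableOn_Icc (a := -L) (b := L)).mono_set
      Ioo_subset_Icc_self).const_mul _

/-- `∫₀ᵗ log (cosh s - cos x) ds`. -/
def logPrim (q : ℝ × ℝ) : ℝ := ∫ s in (0 : ℝ)..q.2, logKer (q.1, s)

lemma measurable_logKer : Measurable logKer := isKernel_logKer.measurable

lemma continuous_logKer_snd {x : ℝ} (hx : Real.cos x ≠ 1) : Continuous fun s => logKer (x, s) :=
  continuous_iff_continuousAt.2 fun _ => (hasDerivAt_logKer_snd (den_pos_of_fst hx)).continuousAt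

lemma hasDerivAt_logPrim {x : ℝ} (hx : Real.cos x ≠ 1) (t : ℝ) :
    HasDerivAt (fun t => logPrim (x, t)) (logKer (x, t)) t :=
  intervalIntegral.integral_hasDerivAt_right ((continuous_logKer_snd hx).intervalIntegrable _ _)
    (continuous_logKer_snd hx).stronglyMeasurable.stronglyMeasurableAtFilter
    (continuous_logKer_snd hx).continuousAt

/-- Rescaling `s = q.2 u` fixes the interval of integration, so measurability of integrals depending
on a parameter applies. -/
lemma measurable_logPrim : Measurable logPrim := by
  have e : logPrim = fun q : ℝ × ℝ => q.2 * ∫ u in Ioc (0 : ℝ) 1, logKer (q.1, q.2 * u) := by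
    funext q
    have := intervalIntegral.mul_integral_comp_mul_left (f := fun s => logKer (q.1, s)) q.2
      (a := 0) (b := 1)
    rw [mul_zero, mul_one] at this
    rw [logPrim, ← this, intervalIntegral.integral_of_le zero_le_one]
  rw [e]
  refine measurable_snd.mul (StronglyMeasurable.integral_prod_right
    (f := fun (q : ℝ × ℝ) (u : ℝ) => logKer (q.1, q.2 * u)) ?_).measurable
  have : Measurable fun p : (ℝ × ℝ) × ℝ => logKer (p.1.1, p.1.2 * p.2) :=
    measurable_logKer.comp (by fun_prop)
  exact this.stronglyMeasurable

/-- A bound for `|log (cosh s - cos x)|` on `|s| ≤ R`. -/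
def logBound (R x : ℝ) : ℝ := |Real.log (1 - Real.cos x)| + |Real.log (Real.cosh R + 1)|

lemma logBound_nonneg (R x : ℝ) : 0 ≤ logBound R x := add_nonneg (abs_nonneg _) (abs_nonneg _)

lemma abs_logKer_le {x s R : ℝ} (hx : Real.cos x ≠ 1) (hs : |s| ≤ R) :
    |logKer (x, s)| ≤ logBound R x := by
  have h1 := lt_of_le_of_ne (Real.cos_le_one x) hx
  refine abs_log_le_add (by linarith) ?_ (den_le hs)
  unfold den
  linarith [Real.one_le_cosh s]

lemma abs_logPrim_le {x s R : ℝ} (hx : Real.cos x ≠ 1) (hs : |s| ≤ R) :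
    |logPrim (x, s)| ≤ R * logBound R x := by
  have := intervalIntegral.norm_integral_le_of_norm_le_const (a := 0) (b := s)
    (f := fun s => logKer (x, s)) (C := logBound R x) fun t ht => by
      refine abs_logKer_le hx (le_trans ?_ hs)
      rcases le_total 0 s with h | h
      · rw [uIoc_of_le h] at ht
        rw [abs_of_pos ht.1, abs_of_nonneg h]; exact ht.2
      · rw [uIoc_of_ge h] at ht
        rw [abs_of_nonpos ht.2, abs_of_nonpos h]; linarith [ht.1]
  rw [sub_zero, Real.norm_eq_abs] at this
  refine this.trans ?_
  rw [mul_comm]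
  exact mul_le_mul_of_nonneg_right hs (logBound_nonneg _ _)

lemma integrableOn_logBound (R : ℝ) : IntegrableOn (logBound R) (Ioc (-Real.pi) Real.pi) := by
  have h : IntervalIntegrable (fun x => Real.log ‖1 - Real.cos x‖) volume (-Real.pi) Real.pi := by
    refine MeromorphicOn.intervalIntegrable_log_norm (f := fun x => 1 - Real.cos x) fun x _ => ?_
    exact (analyticAt_const.sub Real.analyticAt_cos).meromorphicAt
  rw [intervalIntegrable_iff_integrableOn_Ioc_of_le (by linarith [Real.pi_pos])] at h
  simp only [Real.norm_eq_abs, Real.log_abs] at h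
  exact h.abs.add (integrable_const _)

end

/-! ### The stream function is constant along the level curves. -/

noncomputable section

variable {Θ : ℝ → ℝ} {ε κ s M : ℝ} {f E ζ : ℝ × ℝ → ℝ}

/-- One period of the open strips. -/
def strip (ε : ℝ) : Set (ℝ × ℝ) := Ioc (-Real.pi) Real.pi ×ˢ interior (bands ε)

lemma measurableSet_strip (ε : ℝ) : MeasurableSet (strip ε) :=
  measurableSet_Ioc.prod isOpen_interior.measurableSet

lemma volume_restrict_strip (ε : ℝ) : (volume.restrict (strip ε) : Measure (ℝ × ℝ))
    = (volume.restrict (Ioc (-Real.pi) Real.pi)).prod (volume.restrict (interior (bands ε))) := by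
  rw [strip, Measure.volume_eq_prod, ← Measure.prod_restrict]

lemma cell_ae_eq_strip : (cell ε : Set (ℝ × ℝ)) =ᵐ[volume] strip ε :=
  cell_ae_eq.trans (Measure.set_prod_ae_eq Ioo_ae_eq_Ioc (ae_eq_refl _))

lemma ae_strip_cos_ne_one : ∀ᵐ q ∂(volume.restrict (strip ε)), Real.cos q.1 ≠ 1 := by
  refine ae_restrict_of_ae ?_
  rw [Measure.volume_eq_prod]
  exact Measure.quasiMeasurePreserving_fst.ae ae_cos_ne_one

lemma integrableOn_strip_logBound (R C : ℝ) :
    IntegrableOn (fun q : ℝ × ℝ => C * logBound R q.1) (strip ε) := by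
  unfold IntegrableOn
  rw [volume_restrict_strip]
  have hfin : IsFiniteMeasure (volume.restrict (interior (bands ε))) :=
    ⟨by
      rw [Measure.restrict_apply_univ]
      exact (measure_mono interior_subset).trans_lt isCompact_bands.measure_lt_top⟩
  exact ((integrableOn_logBound R).comp_fst _).const_mul C

/-- Translations in the first variable preserve integrals over a period. -/
lemma integral_strip_sub {J : ℝ × ℝ → ℝ} (hJ : PeriodicFst J)
    (hm : AEStronglyMeasurable J (volume.restrict (strip ε))) (x : ℝ) :
    ∫ q in strip ε, J (x - q.1, q.2) = ∫ q in strip ε, J q := by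
  have h : MeasurePreserving
      (Prod.map (fun s => toIocMod (by positivity : 0 < 2 * Real.pi) (-Real.pi) (x - s)) id)
      (volume.restrict (strip ε)) (volume.restrict (strip ε)) := by
    rw [volume_restrict_strip]
    exact (measurePreserving_toIocMod_sub x).prod (MeasurePreserving.id _)
  have := integral_map h.aemeasurable (f := J) (by rwa [h.map_eq])
  rw [h.map_eq] at this
  rw [this]
  refine integral_congr_ae (ae_of_all _ fun q => ?_)
  have hp : Function.Periodic (fun x => J (x, q.2)) (2 * Real.pi) := fun x => hJ x _
  exact (hp.sub_zsmul_eq _).symm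

lemma Layering.abs_arg_le (h : Layering ε s f E ζ) (hs : s ≤ 1) {z : ℝ} (hz : |z| ≤ 3) (x : ℝ)
    {t : ℝ} (ht : |t| ≤ 2) : |z - t - E (x, t)| ≤ 6 := by
  have h1 := abs_le.1 (h.bound (x, t))
  rw [abs_le] at *
  constructor <;> linarith

lemma abs_le_of_mem_bands (H : Admissible Θ ε κ) {t : ℝ} (ht : t ∈ bands ε) : |t| ≤ 2 := by
  have := bands_subset H ht
  exact abs_le.2 ⟨this.1.le, this.2.le⟩

lemma Layering.measurable_arg (h : Layering ε s f E ζ) (x z : ℝ) :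
    Measurable fun q : ℝ × ℝ => (q.1, z - q.2 - E (x - q.1, q.2)) := by
  have := h.continuous
  exact Continuous.measurable (by fun_prop)

lemma Layering.integrableOn_primitive (h : Layering ε s f E ζ) (H : Admissible Θ ε κ) (hs : s ≤ 1)
    {z : ℝ} (hz : |z| ≤ 3) (x : ℝ) :
    IntegrableOn (fun q : ℝ × ℝ => deriv (profile Θ ε κ) q.2
      * logPrim (q.1, z - q.2 - E (x - q.1, q.2))) (strip ε) := by
  obtain ⟨C, hC, hC', -⟩ := exists_lipschitz_profile H
  refine (integrableOn_strip_logBound 6 (C * 6)).mono' ?_ ?_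
  · exact (((continuous_deriv_profile H).measurable.comp measurable_snd).mul
      (measurable_logPrim.comp (h.measurable_arg x z))).aestronglyMeasurable
  · filter_upwards [ae_strip_cos_ne_one, ae_restrict_mem (measurableSet_strip ε)] with q hq hq2
    rw [norm_mul, mul_assoc]
    exact mul_le_mul (hC' _) (abs_logPrim_le hq (h.abs_arg_le hs hz _
      (abs_le_of_mem_bands H (interior_subset hq2.2)))) (abs_nonneg _) hC

/-- Vertical integration by parts replaces the vorticity, known only to be continuous, by the smooth
`ϖ'`, and puts the displacement `E` inside the argument of the primitive of the kernel. In this form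
the potential can be differentiated along a curve. For almost every horizontal offset the vertical
slice of the kernel is regular. -/
lemma Layering.conv_logKer_eq (h : Layering ε s f E ζ) (H : Admissible Θ ε κ) (hs : s ≤ 1)
    {z : ℝ} (hz : |z| ≤ 3) (x : ℝ) :
    conv logKer (fun p => profile Θ ε κ (ζ p)) (x, z) = ∫ q in strip ε,
      deriv (profile Θ ε κ) q.2 * logPrim (q.1, z - q.2 - E (x - q.1, q.2)) := by
  have hi := integrableOn_conv isKernel_logKer (h.isDensity H hs) (x, z)
  have hi2 := h.integrableOn_primitive H hs hz x
  unfold conv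
  unfold IntegrableOn at hi hi2
  rw [volume_restrict_tube] at hi ⊢
  rw [volume_restrict_strip] at hi2 ⊢
  rw [integral_prod _ hi, integral_prod _ hi2]
  refine integral_congr_ae ?_
  filter_upwards [ae_restrict_of_ae ae_cos_ne_one] with u hu
  simp only [Prod.mk_sub_mk]
  have hab : ∀ t : ℝ, z - (t + E (x - u, t)) = z - t - E (x - u, t) := fun t => by ring
  rw [integral_mul_comp_label (k := fun t => logKer (u, t)) (K := fun t => logPrim (u, t))
    (g := profile Θ ε κ) (g' := deriv (profile Θ ε κ)) (Y := fun t => t + E (x - u, t))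
    (ζ := fun t => ζ (x - u, t)) (L := 2) (R := 7) two_pos (hasDerivAt_logPrim hu)
    (continuous_logKer_snd hu) (hasDerivAt_profile H) (continuous_deriv_profile H)
    (fun t ht => profile_outer H (by linarith [H.ε_lt])) (h.strictMono (x - u))
    (fun t v => h.lt_iff _ _ _)
    (fun t ht => by rw [hab]; exact (h.abs_arg_le hs hz _ ht).trans_lt (by norm_num))]
  simp only [hab]
  refine (setIntegral_eq_of_subset_of_forall_sdiff_eq_zero measurableSet_Ioo
    (interior_subset.trans (bands_subset H)) fun t ht => ?_)
  rw [deriv_profile_eq_zero H ht.2, zero_mul]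

/-- The stream function in the frame moving with speed `-lam`. -/
def stream (Θ : ℝ → ℝ) (ε κ lam : ℝ) (ζ : ℝ × ℝ → ℝ) (p : ℝ × ℝ) : ℝ :=
  lam * p.2 + p.2 ^ 2 / 2 - 1 / (4 * Real.pi) * conv logKer (fun p => profile Θ ε κ (ζ p)) p

lemma hasDerivAt_slice (hf : Regular ε M f) {x y : ℝ} (hy : y ∈ interior (bands ε)) :
    HasDerivAt (fun s => f (s, y)) (dx f (x, y)) x :=
  hf.hasDerivAt (x, y) ⟨mem_univ _, hy⟩

/-- Differentiation under the integral: the argument `y + f(a, y) - q.2 - E(a - q.1, q.2)` varies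
with `a` through both displacements, which yields the difference of the `∂ₓ f`. The majorant
`logBound 6` is independent of `a`, so the moving singularity does no harm. -/
lemma Layering.hasDerivAt_conv (h : Layering ε s f E ζ) (H : Admissible Θ ε κ) (hs : s ≤ 1)
    (hf : Regular ε M f) {x y : ℝ} (hy : y ∈ interior (bands ε)) :
    HasDerivAt (fun a => conv logKer (fun p => profile Θ ε κ (ζ p)) (a, y + f (a, y)))
      (∫ q in strip ε, deriv (profile Θ ε κ) q.2
        * logKer (q.1, y + f (x, y) - q.2 - E (x - q.1, q.2))
        * (dx f (x, y) - dx f (x - q.1, q.2))) x := by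
  have hEf : ∀ a, ∀ t ∈ interior (bands ε), E (a, t) = f (a, t) := fun a t ht =>
    h.eq_on a t (interior_subset ht)
  have hz : ∀ a, |y + f (a, y)| ≤ 3 := fun a => by
    rw [← hEf a y hy]
    have h1 := abs_le.1 (h.bound (a, y))
    have h2 := abs_le.1 (abs_le_of_mem_bands H (interior_subset hy))
    rw [abs_le]; constructor <;> linarith
  obtain ⟨C, hC, hC', -⟩ := exists_lipschitz_profile H
  have e : (fun a => conv logKer (fun p => profile Θ ε κ (ζ p)) (a, y + f (a, y)))
      = fun a => ∫ q in strip ε, deriv (profile Θ ε κ) q.2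
        * logPrim (q.1, y + f (a, y) - q.2 - E (a - q.1, q.2)) :=
    funext fun a => h.conv_logKer_eq H hs (hz a) a
  rw [e]
  have hM : 0 ≤ M := (abs_nonneg _).trans (hf.dx_bound (x, y) ⟨mem_univ _, hy⟩)
  refine (hasDerivAt_integral_of_dominated_loc_of_deriv_le (s := univ) (x₀ := x)
    (bound := fun q => C * (M + M) * logBound 6 q.1)
    (F' := fun a q => deriv (profile Θ ε κ) q.2
        * logKer (q.1, y + f (a, y) - q.2 - E (a - q.1, q.2))
        * (dx f (a, y) - dx f (a - q.1, q.2))) univ_mem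
    (Eventually.of_forall fun a => (h.integrableOn_primitive H hs (hz a) a).aestronglyMeasurable)
    (h.integrableOn_primitive H hs (hz x) x) ?_ ?_ (integrableOn_strip_logBound _ _) ?_).2
  · refine AEStronglyMeasurable.mul ?_ ?_
    · exact (((continuous_deriv_profile H).measurable.comp measurable_snd).mul
        (measurable_logKer.comp (h.measurable_arg x _))).aestronglyMeasurable
    · refine ContinuousOn.aestronglyMeasurable ?_ (measurableSet_strip ε)
      refine continuousOn_const.sub (hf.dx_continuousOn.comp (by fun_prop) fun q hq => ?_)
      exact ⟨mem_univ _, hq.2⟩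
  · filter_upwards [ae_strip_cos_ne_one, ae_restrict_mem (measurableSet_strip ε)] with q hq hq2 a _
    rw [norm_mul, norm_mul, mul_assoc, mul_assoc]
    refine mul_le_mul (hC' _) ?_ (by positivity) hC
    rw [mul_comm]
    refine mul_le_mul ?_ (abs_logKer_le hq (h.abs_arg_le hs (hz a) _
      (abs_le_of_mem_bands H (interior_subset hq2.2)))) (abs_nonneg _) (by positivity)
    exact (abs_sub _ _).trans (add_le_add (hf.dx_bound (a, y) ⟨mem_univ _, hy⟩)
      (hf.dx_bound (a - q.1, q.2) ⟨mem_univ _, hq2.2⟩))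
  · filter_upwards [ae_strip_cos_ne_one, ae_restrict_mem (measurableSet_strip ε)] with q hq hq2 a _
    have h1 := hasDerivAt_slice hf (x := a) hy
    have h2 : HasDerivAt (fun a => E (a - q.1, q.2)) (dx f (a - q.1, q.2)) a := by
      simp only [hEf _ _ hq2.2]
      exact (hasDerivAt_slice hf (x := a - q.1) hq2.2).comp_sub_const a q.1
    have h3 := (hasDerivAt_logPrim hq (y + f (a, y) - q.2 - E (a - q.1, q.2))).comp a
      (((h1.const_add y).sub_const q.2).sub h2)
    have h4 := h3.const_mul (deriv (profile Θ ε κ) q.2)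
    rw [← mul_assoc] at h4
    exact h4

lemma dx_periodic (hp : ∀ x, ∀ y ∈ bands ε, f (x + 2 * Real.pi, y) = f (x, y)) (x : ℝ) {y : ℝ}
    (hy : y ∈ bands ε) : dx f (x + 2 * Real.pi, y) = dx f (x, y) := by
  unfold dx
  simp only
  rw [← deriv_comp_add_const]
  simp only [fun s => hp s y hy]

/-- The functional `F` is the derivative of the stream function along the level curves. -/
lemma Layering.hasDerivAt_stream (h : Layering ε s f E ζ) (H : Admissible Θ ε κ) (hs : s ≤ 1)
    (hf : Regular ε M f) (hp : ∀ x, ∀ y ∈ bands ε, f (x + 2 * Real.pi, y) = f (x, y)) (lam : ℝ)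
    {x y : ℝ} (hy : y ∈ interior (bands ε)) :
    HasDerivAt (fun a => stream Θ ε κ lam ζ (a, y + f (a, y))) (waveF Θ ε κ lam f (x, y)) x := by
  have h1 := hasDerivAt_slice hf (x := x) hy
  have h2 := h1.const_add y
  have h3 := ((h2.const_mul lam).add ((h2.pow 2).div_const 2)).sub
    ((h.hasDerivAt_conv H hs hf (x := x) hy).const_mul (1 / (4 * Real.pi)))
  -- Periodicity permits the substitution `q.1 ↦ x - q.1`, which turns the differentiated integral
  -- into the one in `waveF`.
  have hJp : PeriodicFst fun q : ℝ × ℝ => deriv (profile Θ ε κ) q.2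
      * logKer (x - q.1, y + f (x, y) - q.2 - E q) * (dx f (x, y) - dx f q) := by
    intro u t
    by_cases ht : t ∈ interior (bands ε)
    · have e1 : x - (u + 2 * Real.pi) = x - u - 2 * Real.pi := by ring
      have e2 := isKernel_logKer.periodic (x - u - 2 * Real.pi) (y + f (x, y) - t - E (u, t))
      rw [sub_add_cancel] at e2
      simp only [dx_periodic hp u (interior_subset ht), h.periodic u t, e1, e2]
    · simp only [deriv_profile_eq_zero H ht, zero_mul]
  have key : ∫ q in strip ε, deriv (profile Θ ε κ) q.2
        * logKer (q.1, y + f (x, y) - q.2 - E (x - q.1, q.2))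
        * (dx f (x, y) - dx f (x - q.1, q.2))
      = ∫ q in cell ε, deriv (profile Θ ε κ) q.2
        * Real.log (Real.cosh (y - q.2 + f (x, y) - f q) - Real.cos (x - q.1))
        * (dx f (x, y) - dx f q) := by
    have := integral_strip_sub (ε := ε) hJp ?_ x
    · simp only [sub_sub_cancel] at this
      rw [this, setIntegral_congr_set cell_ae_eq_strip]
      refine setIntegral_congr_fun (measurableSet_strip ε) fun q hq => ?_
      have e1 : E q = f q := h.eq_on q.1 q.2 (interior_subset hq.2)
      have e2 : y + f (x, y) - q.2 - f q = y - q.2 + f (x, y) - f q := by ring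
      simp only [e1, e2]
      rfl
    · refine AEStronglyMeasurable.mul ?_ ?_
      · have := h.continuous
        have hm : Measurable fun q : ℝ × ℝ => (x - q.1, y + f (x, y) - q.2 - E q) :=
          Continuous.measurable (by fun_prop)
        exact (((continuous_deriv_profile H).measurable.comp measurable_snd).mul
          (measurable_logKer.comp hm)).aestronglyMeasurable
      · refine ContinuousOn.aestronglyMeasurable ?_ (measurableSet_strip ε)
        exact continuousOn_const.sub (hf.dx_continuousOn.mono (prod_mono_left (subset_univ _)))
  rw [key] at h3
  refine h3.congr_deriv ?_
  unfold waveF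
  simp only
  ring

lemma bands_subset_closure (H : Admissible Θ ε κ) : bands ε ⊆ closure (interior (bands ε)) := by
  have := H.ε_pos
  rw [interior_bands H, closure_union, closure_Ioo (by linarith), closure_Ioo (by linarith)]
  exact subset_rfl

lemma Layering.continuous_stream (h : Layering ε s f E ζ) (H : Admissible Θ ε κ) (hs : s ≤ 1)
    (lam : ℝ) : Continuous (stream Θ ε κ lam ζ) := by
  have := continuous_conv isKernel_logKer (h.isDensity H hs)
  unfold stream
  fun_prop

/-- The stream function is constant along the level curves of a traveling wave. -/
lemma Layering.stream_eq (h : Layering ε s f E ζ) (H : Admissible Θ ε κ) (hs : s ≤ 1)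
    (hf : Regular ε M f) (hp : ∀ x, ∀ y ∈ bands ε, f (x + 2 * Real.pi, y) = f (x, y)) {lam : ℝ}
    (hF : ∀ p ∈ openStrips ε, waveF Θ ε κ lam f p = 0) (x x' : ℝ) {y : ℝ} (hy : y ∈ bands ε) :
    stream Θ ε κ lam ζ (x, y + f (x, y)) = stream Θ ε κ lam ζ (x', y + f (x', y)) := by
  have hint : ∀ y ∈ interior (bands ε), stream Θ ε κ lam ζ (x, y + E (x, y))
      = stream Θ ε κ lam ζ (x', y + E (x', y)) := by
    intro y hy
    rw [h.eq_on x y (interior_subset hy), h.eq_on x' y (interior_subset hy)]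
    have hd := fun x => h.hasDerivAt_stream H hs hf hp lam (x := x) hy
    exact is_const_of_deriv_eq_zero (fun x => (hd x).differentiableAt)
      (fun x => by rw [(hd x).deriv]; exact hF (x, y) ⟨mem_univ _, hy⟩) x x'
  have hc := h.continuous_stream H hs lam
  have hE := h.continuous
  have hcl : IsClosed {y | stream Θ ε κ lam ζ (x, y + E (x, y))
      = stream Θ ε κ lam ζ (x', y + E (x', y))} := isClosed_eq (by fun_prop) (by fun_prop)
  have := closure_minimal hint hcl (bands_subset_closure H hy)
  rw [← h.eq_on x y hy, ← h.eq_on x' y hy]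
  exact this

end

noncomputable section

/-! ### Fourier coefficients of the kernel -/

/-- For `z = e^{-|t| + ix}` one has `|1 - z|² = 2 e^{-|t|} (cosh t - cos x)`. The real part of the
Taylor series of `-log(1 - z)` is then the cosine series of the kernel, convergent for `t ≠ 0`. -/
lemma hasSum_logKer {t : ℝ} (ht : t ≠ 0) (x : ℝ) :
    HasSum (fun k : ℕ => Real.exp (-|t|) ^ k * Real.cos (k * x) / k)
      ((|t| - Real.log 2 - logKer (x, t)) / 2) := by
  set r := Real.exp (-|t|) with hr
  have hr0 : 0 < r := Real.exp_pos _
  have hr1 : r < 1 := Real.exp_lt_one_iff.2 (by simpa using ht)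
  set z : ℂ := r * Complex.exp (x * Complex.I) with hz
  have hzn : ‖z‖ = r := by
    rw [hz, norm_mul, Complex.norm_exp_ofReal_mul_I, mul_one, Complex.norm_real,
      Real.norm_eq_abs, abs_of_pos hr0]
  have h1 := Complex.hasSum_re (Complex.hasSum_taylorSeries_neg_log (z := z) (by rw [hzn]; exact hr1))
  have e1 : ∀ k : ℕ, (z ^ k / k).re = r ^ k * Real.cos (k * x) / k := by
    intro k
    have : z ^ k / k = ((r ^ k / k : ℝ) : ℂ) * Complex.exp ((k * x : ℝ) * Complex.I) := by
      rw [hz, mul_pow, ← Complex.exp_nat_mul]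
      push_cast
      ring_nf
    rw [this, Complex.re_ofReal_mul, Complex.exp_ofReal_mul_I_re]
    ring
  simp only [e1] at h1
  have hden : 0 < den (x, t) := den_pos_of_snd ht
  have e2 : ‖1 - z‖ ^ 2 = 2 * r * den (x, t) := by
    have hre : z.re = r * Real.cos x := by
      rw [hz, Complex.re_ofReal_mul, Complex.exp_ofReal_mul_I_re]
    have him : z.im = r * Real.sin x := by
      rw [hz, Complex.im_ofReal_mul, Complex.exp_ofReal_mul_I_im]
    have h2 : 2 * r * Real.cosh t = 1 + r ^ 2 := by
      rw [← Real.cosh_abs, Real.cosh_eq, hr]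
      have : Real.exp (-|t|) * Real.exp |t| = 1 := by rw [← Real.exp_add]; simp
      linear_combination this
    rw [Complex.sq_norm, Complex.normSq_apply, Complex.sub_re, Complex.sub_im, hre, him,
      Complex.one_re, Complex.one_im, den]
    linear_combination r ^ 2 * Real.sin_sq_add_cos_sq x - h2
  have hn : ‖1 - z‖ ≠ 0 := fun h => by
    rw [h] at e2
    have := mul_pos (mul_pos two_pos hr0) hden
    linarith
  have e3 : (-Complex.log (1 - z)).re = (|t| - Real.log 2 - logKer (x, t)) / 2 := by
    have h3 := congrArg Real.log e2
    rw [Real.log_pow, Real.log_mul (by positivity) hden.ne', Real.log_mul two_ne_zero hr0.ne', hr,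
      Real.log_exp] at h3
    push_cast at h3
    rw [Complex.neg_re, Complex.log_re, logKer]
    linarith
  rwa [e3] at h1

lemma integral_cos_int {m : ℤ} (hm : m ≠ 0) : ∫ x in (-Real.pi)..Real.pi, Real.cos (m * x) = 0 := by
  have hm' : (m : ℝ) ≠ 0 := Int.cast_ne_zero.2 hm
  rw [intervalIntegral.integral_comp_mul_left _ hm', integral_cos, mul_neg, Real.sin_neg,
    Real.sin_int_mul_pi, neg_zero, sub_zero, smul_zero]

lemma integral_cos_mul_cos (k n : ℕ) (hn : n ≠ 0) :
    ∫ x in (-Real.pi)..Real.pi, Real.cos (k * x) * Real.cos (n * x) = if k = n then Real.pi else 0 := by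
  have e : ∀ x : ℝ, Real.cos (k * x) * Real.cos (n * x)
      = (Real.cos (((k - n : ℤ) : ℝ) * x) + Real.cos (((k + n : ℤ) : ℝ) * x)) / 2 := fun x => by
    have := Real.two_mul_cos_mul_cos (k * x) (n * x)
    push_cast
    rw [sub_mul, add_mul, ← this]
    ring
  simp only [e]
  rw [intervalIntegral.integral_div, intervalIntegral.integral_add
    (Continuous.intervalIntegrable (by fun_prop) _ _) (Continuous.intervalIntegrable (by fun_prop) _ _),
    integral_cos_int (m := k + n) (by omega), add_zero]
  split_ifs with h
  · simp [h]
  · rw [integral_cos_int (by omega), zero_div]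

lemma hasSum_integral_logKer {t : ℝ} (ht : t ≠ 0) (n : ℕ) :
    HasSum (fun k : ℕ => ∫ x in (-Real.pi)..Real.pi,
        Real.exp (-|t|) ^ k * Real.cos (k * x) / k * Real.cos (n * x))
      (∫ x in (-Real.pi)..Real.pi, (|t| - Real.log 2 - logKer (x, t)) / 2 * Real.cos (n * x)) := by
  have hr1 : Real.exp (-|t|) < 1 := Real.exp_lt_one_iff.2 (by simpa using ht)
  refine intervalIntegral.hasSum_integral_of_dominated_convergence
    (fun k _ => Real.exp (-|t|) ^ k) (fun k => ?_) (fun k => ?_) ?_ ?_ ?_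
  · exact Continuous.aestronglyMeasurable (by fun_prop)
  · refine ae_of_all _ fun x _ => ?_
    rw [norm_mul, norm_div, norm_mul, Real.norm_of_nonneg (by positivity : 0 ≤ Real.exp (-|t|) ^ k)]
    have h1 := Real.abs_cos_le_one (k * x)
    have h2 := Real.abs_cos_le_one (n * x)
    simp only [Real.norm_eq_abs]
    rcases Nat.eq_zero_or_pos k with hk | hk
    · subst hk; simp
    have h3 : (1 : ℝ) ≤ |(k : ℝ)| := by rw [Nat.abs_cast]; exact_mod_cast hk
    calc Real.exp (-|t|) ^ k * |Real.cos (k * x)| / |(k : ℝ)| * |Real.cos (n * x)|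
        ≤ Real.exp (-|t|) ^ k * 1 / 1 * 1 := by gcongr
      _ = Real.exp (-|t|) ^ k := by ring
  · exact ae_of_all _ fun x _ => summable_geometric_of_lt_one (Real.exp_pos _).le hr1
  · exact intervalIntegrable_const
  · exact ae_of_all _ fun x _ => (hasSum_logKer ht x).mul_right _

lemma continuous_logKer_fst {t : ℝ} (ht : t ≠ 0) : Continuous fun x => logKer (x, t) :=
  continuous_iff_continuousAt.2 fun _ =>
    (hasDerivAt_logKer_fst (den_pos_of_snd (q := (_, t)) ht)).continuousAt

lemma integral_logKer_zero {t : ℝ} (ht : t ≠ 0) :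
    ∫ x in (-Real.pi)..Real.pi, logKer (x, t) = 2 * Real.pi * (|t| - Real.log 2) := by
  have h := hasSum_integral_logKer ht 0
  have e : ∀ k : ℕ, ∫ x in (-Real.pi)..Real.pi,
      Real.exp (-|t|) ^ k * Real.cos (k * x) / k * Real.cos ((0 : ℕ) * x) = 0 := by
    intro k
    -- The term `k = 0` is zero by the convention on division by zero, in accordance with the
    -- logarithmic series.
    rcases Nat.eq_zero_or_pos k with hk | hk
    · subst hk; simp
    · have e1 : ∀ x : ℝ, Real.exp (-|t|) ^ k * Real.cos (k * x) / k * Real.cos ((0 : ℕ) * x)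
          = Real.exp (-|t|) ^ k / k * Real.cos ((k : ℤ) * x) := fun x => by
        push_cast; rw [zero_mul, Real.cos_zero]; ring
      simp only [e1]
      rw [intervalIntegral.integral_const_mul, integral_cos_int (by omega), mul_zero]
  simp only [e] at h
  have h2 := h.unique hasSum_zero
  have hc := continuous_logKer_fst ht
  simp only [CharP.cast_eq_zero, zero_mul, Real.cos_zero, mul_one] at h2
  rw [intervalIntegral.integral_div, intervalIntegral.integral_sub intervalIntegrable_const
    (hc.intervalIntegrable _ _), intervalIntegral.integral_const, smul_eq_mul] at h2
  linarith

lemma integral_logKer_mul_cos {t : ℝ} (ht : t ≠ 0) {n : ℕ} (hn : n ≠ 0) :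
    ∫ x in (-Real.pi)..Real.pi, logKer (x, t) * Real.cos (n * x)
      = -(2 * Real.pi / n) * Real.exp (-(n * |t|)) := by
  have h := hasSum_integral_logKer ht n
  have e : ∀ k : ℕ, ∫ x in (-Real.pi)..Real.pi,
      Real.exp (-|t|) ^ k * Real.cos (k * x) / k * Real.cos (n * x)
        = if k = n then Real.exp (-|t|) ^ n / n * Real.pi else 0 := by
    intro k
    have e1 : ∀ x : ℝ, Real.exp (-|t|) ^ k * Real.cos (k * x) / k * Real.cos (n * x)
          = Real.exp (-|t|) ^ k / k * (Real.cos (k * x) * Real.cos (n * x)) := fun x => by ring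
    simp only [e1]
    rw [intervalIntegral.integral_const_mul, integral_cos_mul_cos k n hn]
    split_ifs with hk
    · rw [hk]
    · rw [mul_zero]
  simp only [e] at h
  have h2 := h.unique (hasSum_ite_eq n _)
  have hc := continuous_logKer_fst ht
  have e2 : ∀ x, (|t| - Real.log 2 - logKer (x, t)) / 2 * Real.cos (n * x)
      = (|t| - Real.log 2) / 2 * Real.cos ((n : ℤ) * x) - 1 / 2 * (logKer (x, t) * Real.cos (n * x)) :=
    fun x => by push_cast; ring
  simp only [e2] at h2
  rw [intervalIntegral.integral_sub (Continuous.intervalIntegrable (by fun_prop) _ _)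
    (Continuous.intervalIntegrable (by fun_prop) _ _), intervalIntegral.integral_const_mul,
    intervalIntegral.integral_const_mul, integral_cos_int (by omega)] at h2
  have e3 : Real.exp (-(n * |t|)) = Real.exp (-|t|) ^ n := by rw [← Real.exp_nat_mul]; ring_nf
  rw [e3]
  linear_combination (-2) * h2

lemma integral_period_shift {g : ℝ → ℝ} (hg : Function.Periodic g (2 * Real.pi)) (a : ℝ) :
    ∫ x in (-Real.pi)..Real.pi, g (x - a) = ∫ x in (-Real.pi)..Real.pi, g x := by
  rw [intervalIntegral.integral_comp_sub_right]
  have := hg.intervalIntegral_add_eq (-Real.pi - a) (-Real.pi)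
  rwa [show -Real.pi - a + 2 * Real.pi = Real.pi - a by ring,
    show -Real.pi + 2 * Real.pi = Real.pi by ring] at this

lemma logKer_neg_fst (x t : ℝ) : logKer (-x, t) = logKer (x, t) := by simp [logKer, den]

lemma integral_logKer_sub {t : ℝ} (ht : t ≠ 0) (a : ℝ) :
    ∫ x in (-Real.pi)..Real.pi, logKer (x - a, t) = 2 * Real.pi * (|t| - Real.log 2) := by
  rw [integral_period_shift (g := fun x => logKer (x, t)) (fun x => isKernel_logKer.periodic x t),
    integral_logKer_zero ht]

lemma integral_odd {g : ℝ → ℝ} (hg : ∀ x, g (-x) = -g x) (a : ℝ) : ∫ x in (-a)..a, g x = 0 := by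
  have h := intervalIntegral.integral_comp_neg (a := -a) (b := a) g
  simp only [hg, neg_neg] at h
  rw [intervalIntegral.integral_neg] at h
  linarith

/-- After a translation, the addition formula splits the sine: the part odd in `x` integrates to
zero and the even part is a cosine coefficient of the kernel. -/
lemma integral_logKer_sub_mul_sin {t : ℝ} (ht : t ≠ 0) {n : ℕ} (hn : n ≠ 0) (a : ℝ) :
    ∫ x in (-Real.pi)..Real.pi, logKer (x - a, t) * Real.sin (n * x)
      = -(2 * Real.pi / n) * Real.exp (-(n * |t|)) * Real.sin (n * a) := by
  have hc := continuous_logKer_fst ht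
  have h := integral_period_shift (g := fun x => logKer (x, t) * Real.sin (n * (x + a)))
    (fun x => by
      have : (n : ℝ) * (x + 2 * Real.pi + a) = n * (x + a) + n * (2 * Real.pi) := by ring
      simp only [isKernel_logKer.periodic x t, this, Real.sin_add_nat_mul_two_pi]) a
  simp only [sub_add_cancel] at h
  rw [h]
  have e : ∀ x, logKer (x, t) * Real.sin (n * (x + a))
      = logKer (x, t) * Real.sin (n * x) * Real.cos (n * a)
        + logKer (x, t) * Real.cos (n * x) * Real.sin (n * a) := fun x => by
    rw [mul_add, Real.sin_add]; ring
  simp only [e]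
  rw [intervalIntegral.integral_add (Continuous.intervalIntegrable (by fun_prop) _ _)
    (Continuous.intervalIntegrable (by fun_prop) _ _), intervalIntegral.integral_mul_const,
    intervalIntegral.integral_mul_const, integral_logKer_mul_cos ht hn, integral_odd, zero_mul,
    zero_add]
  intro x
  rw [logKer_neg_fst, mul_neg, Real.sin_neg, mul_neg]

end

noncomputable section

/-! ### Fourier modes of the linearized equation -/

variable {Θ : ℝ → ℝ} {ε κ M : ℝ} {h : ℝ × ℝ → ℝ}

/-- A bound for `|log (cosh (y - t) - cos x)|`, uniform in `x`. -/
def logBoundSnd (y t : ℝ) : ℝ := |Real.log (Real.cosh (y - t) - 1)| + |Real.log (Real.cosh 4 + 1)|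

lemma logBoundSnd_nonneg (y t : ℝ) : 0 ≤ logBoundSnd y t := add_nonneg (abs_nonneg _) (abs_nonneg _)

lemma abs_logKer_le_snd {y t : ℝ} (hy : |y| ≤ 2) (ht : |t| ≤ 2) (hne : t ≠ y) (u : ℝ) :
    |logKer (u, y - t)| ≤ logBoundSnd y t := by
  have h1 := Real.one_lt_cosh.2 (sub_ne_zero.2 hne.symm)
  refine abs_log_le_add (by linarith) ?_ (den_le ?_)
  · unfold den
    linarith [Real.cos_le_one u]
  · exact (abs_sub _ _).trans (by linarith)

lemma integrableOn_logBoundSnd (y : ℝ) : IntegrableOn (logBoundSnd y) (interior (bands ε)) := by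
  have h : ∀ a b, IntervalIntegrable (fun t => Real.log ‖Real.cosh (y - t) - 1‖) volume a b :=
    fun a b => by
      refine MeromorphicOn.intervalIntegrable_log_norm (f := fun t => Real.cosh (y - t) - 1)
        fun x _ => AnalyticAt.meromorphicAt ?_
      have : AnalyticAt ℝ Real.cosh (y - x) := Real.analyticAt_cosh
      exact (this.fun_comp (analyticAt_const.sub analyticAt_id)).sub analyticAt_const
  have hb : interior (bands ε) ⊆ Icc (-1 - ε) (-1 + ε) ∪ Icc (1 - ε) (1 + ε) := interior_subset
  have h' : ∀ a b, IntegrableOn (logBoundSnd y) (Icc a b) := fun a b => by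
    rcases le_or_gt a b with hab | hab
    · have := h a b
      rw [intervalIntegrable_iff_integrableOn_Icc_of_le hab] at this
      simp only [Real.norm_eq_abs, Real.log_abs] at this
      exact this.abs.add (integrable_const _)
    · rw [Icc_eq_empty (not_le.2 hab)]; exact integrableOn_empty
  exact ((h' _ _).union (h' _ _)).mono_set hb

lemma ae_strip_snd_ne (y : ℝ) : ∀ᵐ q ∂(volume.restrict (strip ε)), q.2 ≠ y := by
  refine ae_restrict_of_ae ?_
  rw [Measure.volume_eq_prod]
  exact Measure.quasiMeasurePreserving_snd.ae (Measure.ae_ne volume y)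

lemma integrableOn_strip_logBoundSnd (y C : ℝ) :
    IntegrableOn (fun q : ℝ × ℝ => C * logBoundSnd y q.2) (strip ε) := by
  unfold IntegrableOn
  rw [volume_restrict_strip]
  exact ((integrableOn_logBoundSnd y).comp_snd _).const_mul C

lemma measurable_logKer_sub (y : ℝ) :
    Measurable fun p : ℝ × ℝ × ℝ => logKer (p.1 - p.2.1, y - p.2.2) :=
  measurable_logKer.comp (by fun_prop)

/-- Products of the kernel with bounded densities on the strips. -/
lemma integrableOn_kernel_mul (H : Admissible Θ ε κ) {g : ℝ × ℝ → ℝ}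
    (hg : AEStronglyMeasurable g (volume.restrict (strip ε))) (hgM : ∀ q ∈ strip ε, |g q| ≤ M)
    {y : ℝ} (hy : y ∈ bands ε) (x : ℝ) :
    IntegrableOn (fun q : ℝ × ℝ => logKer (x - q.1, y - q.2) * g q) (strip ε) := by
  refine (integrableOn_strip_logBoundSnd y M).mono' ?_ ?_
  · exact (((measurable_logKer_sub y).comp measurable_prodMk_left).aestronglyMeasurable).mul hg
  · filter_upwards [ae_strip_snd_ne y, ae_restrict_mem (measurableSet_strip ε)] with q hq hq2
    rw [norm_mul, mul_comm]
    refine mul_le_mul (hgM q hq2) (abs_logKer_le_snd (abs_le_of_mem_bands H hy)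
      (abs_le_of_mem_bands H (interior_subset hq2.2)) hq _) (abs_nonneg _)
      ((abs_nonneg _).trans (hgM q hq2))

lemma integrable_kernel_mul_mul_sin (H : Admissible Θ ε κ) {g : ℝ × ℝ → ℝ}
    (hg : AEStronglyMeasurable g (volume.restrict (strip ε))) (hgM : ∀ q ∈ strip ε, |g q| ≤ M)
    {y : ℝ} (hy : y ∈ bands ε) (n : ℕ) :
    Integrable (fun p : ℝ × ℝ × ℝ => logKer (p.1 - p.2.1, y - p.2.2) * g p.2 * Real.sin (n * p.1))
      ((volume.restrict (Ioc (-Real.pi) Real.pi)).prod (volume.restrict (strip ε))) := by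
  have h0 : Integrable (fun p : ℝ × ℝ × ℝ => M * logBoundSnd y p.2.2)
      ((volume.restrict (Ioc (-Real.pi) Real.pi)).prod (volume.restrict (strip ε))) :=
    (integrableOn_strip_logBoundSnd y M).comp_snd _
  refine h0.mono' ?_ ?_
  · exact ((measurable_logKer_sub y).aestronglyMeasurable.mul hg.comp_snd).mul
      (Continuous.aestronglyMeasurable (by fun_prop))
  · have hq : ∀ᵐ q ∂(volume.restrict (strip ε)), q.2 ≠ y ∧ q ∈ strip ε :=
      (ae_strip_snd_ne y).and (ae_restrict_mem (measurableSet_strip ε))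
    filter_upwards [Measure.quasiMeasurePreserving_snd.ae hq] with p hp
    rw [norm_mul, norm_mul]
    have h1 := abs_logKer_le_snd (abs_le_of_mem_bands H hy)
      (abs_le_of_mem_bands H (interior_subset hp.2.2)) hp.1 (p.1 - p.2.1)
    have h2 := hgM _ hp.2
    have h3 := Real.abs_sin_le_one (n * p.1)
    simp only [Real.norm_eq_abs]
    have hM := (abs_nonneg _).trans h2
    have hB := logBoundSnd_nonneg y p.2.2
    calc |logKer (p.1 - p.2.1, y - p.2.2)| * |g p.2| * |Real.sin (n * p.1)|
        ≤ logBoundSnd y p.2.2 * M * 1 := by gcongr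
      _ = M * logBoundSnd y p.2.2 := by ring

/-- `∫ ϖ'(t) |y - t| dt`. -/
def shearPotential (Θ : ℝ → ℝ) (ε κ y : ℝ) : ℝ :=
  ∫ t in (-2 : ℝ)..2, deriv (profile Θ ε κ) t * |y - t|

lemma integral_bands_eq (H : Admissible Θ ε κ) (g : ℝ → ℝ) :
    ∫ t in interior (bands ε), deriv (profile Θ ε κ) t * g t
      = ∫ t in (-2 : ℝ)..2, deriv (profile Θ ε κ) t * g t := by
  rw [intervalIntegral.integral_of_le (by norm_num)]
  refine (setIntegral_eq_of_subset_of_forall_sdiff_eq_zero measurableSet_Ioc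
    ((interior_subset.trans (bands_subset H)).trans Ioo_subset_Ioc_self) fun t ht => ?_).symm
  rw [deriv_profile_eq_zero H ht.2, zero_mul]

lemma integral_deriv_profile (H : Admissible Θ ε κ) :
    ∫ t in (-2 : ℝ)..2, deriv (profile Θ ε κ) t = 0 := by
  rw [intervalIntegral.integral_eq_sub_of_hasDerivAt (fun t _ => hasDerivAt_profile H t)
    ((continuous_deriv_profile H).intervalIntegrable _ _),
    profile_outer H (by rw [abs_of_pos two_pos]; linarith [H.ε_lt]),
    profile_outer H (by rw [abs_neg, abs_of_pos two_pos]; linarith [H.ε_lt]), sub_zero]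

lemma aestronglyMeasurable_deriv_profile_snd (H : Admissible Θ ε κ) (μ : Measure (ℝ × ℝ)) :
    AEStronglyMeasurable (fun q : ℝ × ℝ => deriv (profile Θ ε κ) q.2) μ :=
  ((continuous_deriv_profile H).comp continuous_snd).aestronglyMeasurable

/-- The horizontal mean of the kernel is `|t| - log 2`, and the constant drops out because `∫ ϖ' =
0`. -/
lemma integral_strip_kernel (H : Admissible Θ ε κ) {y : ℝ} (hy : y ∈ bands ε) (x : ℝ) :
    ∫ q in strip ε, logKer (x - q.1, y - q.2) * deriv (profile Θ ε κ) q.2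
      = 2 * Real.pi * shearPotential Θ ε κ y := by
  obtain ⟨C, hC, hC', -⟩ := exists_lipschitz_profile H
  have hi := integrableOn_kernel_mul H (aestronglyMeasurable_deriv_profile_snd H _)
    (fun q _ => hC' q.2) hy x
  unfold IntegrableOn at hi
  rw [volume_restrict_strip] at hi ⊢
  rw [integral_prod_symm _ hi]
  have e : ∀ᵐ t ∂(volume.restrict (interior (bands ε))),
      ∫ u in Ioc (-Real.pi) Real.pi, logKer (x - u, y - t) * deriv (profile Θ ε κ) t
        = deriv (profile Θ ε κ) t * (2 * Real.pi * (|y - t| - Real.log 2)) := by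
    filter_upwards [ae_restrict_of_ae (Measure.ae_ne volume y)] with t ht
    have e1 : ∀ u, logKer (x - u, y - t) = logKer (u - x, y - t) := fun u => by
      rw [← logKer_neg_fst, neg_sub]
    simp only [e1]
    rw [integral_mul_const, ← intervalIntegral.integral_of_le (by linarith [Real.pi_pos]),
      integral_logKer_sub (sub_ne_zero.2 ht.symm), mul_comm]
  rw [integral_congr_ae e, integral_bands_eq H (fun t => 2 * Real.pi * (|y - t| - Real.log 2))]
  have e2 : ∀ t, deriv (profile Θ ε κ) t * (2 * Real.pi * (|y - t| - Real.log 2))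
      = 2 * Real.pi * (deriv (profile Θ ε κ) t * |y - t|)
        - 2 * Real.pi * Real.log 2 * deriv (profile Θ ε κ) t := fun t => by ring
  have hc := continuous_deriv_profile H
  simp only [e2]
  rw [intervalIntegral.integral_sub (Continuous.intervalIntegrable (by fun_prop) _ _)
    (Continuous.intervalIntegrable (by fun_prop) _ _), intervalIntegral.integral_const_mul,
    intervalIntegral.integral_const_mul, integral_deriv_profile H, mul_zero, sub_zero]
  rfl

/-- The cosine coefficients of the slices. -/
def cosCoeff (n : ℕ) (g : ℝ × ℝ → ℝ) (y : ℝ) : ℝ :=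
  ∫ x in (-Real.pi)..Real.pi, g (x, y) * Real.cos (n * x)

lemma continuous_cosCoeff {g : ℝ × ℝ → ℝ} (hg : Continuous g) (n : ℕ) :
    Continuous (cosCoeff n g) := by
  unfold cosCoeff
  exact intervalIntegral.continuous_parametric_intervalIntegral_of_continuous' (by fun_prop) _ _

lemma integral_dx_mul_sin (hf : Regular ε M h) {y : ℝ} (hy : y ∈ interior (bands ε)) (n : ℕ) :
    ∫ x in (-Real.pi)..Real.pi, dx h (x, y) * Real.sin (n * x) = -(n * cosCoeff n h y) := by
  have hc : Continuous fun x => dx h (x, y) := by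
    rw [← continuousOn_univ]
    exact hf.dx_continuousOn.comp (by fun_prop) fun x _ => ⟨mem_univ _, hy⟩
  have := intervalIntegral.integral_deriv_mul_eq_sub (a := -Real.pi) (b := Real.pi)
    (u := fun x => h (x, y)) (v := fun x => Real.sin (n * x)) (u' := fun x => dx h (x, y))
    (v' := fun x => n * Real.cos (n * x)) (fun x _ => hasDerivAt_slice hf hy)
    (fun x _ => by
      have := ((hasDerivAt_id x).const_mul (n : ℝ)).sin
      simpa [mul_comm] using this)
    (hc.intervalIntegrable _ _) (Continuous.intervalIntegrable (by fun_prop) _ _)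
  have hh : Continuous fun x => h (x, y) := continuous_iff_continuousAt.2 fun x =>
    (hasDerivAt_slice hf hy).continuousAt
  have i1 : IntervalIntegrable (fun x => dx h (x, y) * Real.sin (n * x)) volume (-Real.pi) Real.pi :=
    (hc.mul (by fun_prop)).intervalIntegrable _ _
  have i2 : IntervalIntegrable (fun x => h (x, y) * (n * Real.cos (n * x))) volume
      (-Real.pi) Real.pi := (hh.mul (by fun_prop)).intervalIntegrable _ _
  rw [intervalIntegral.integral_add i1 i2, mul_neg, Real.sin_neg,
    Real.sin_nat_mul_pi] at this
  have e : ∫ x in (-Real.pi)..Real.pi, h (x, y) * (n * Real.cos (n * x)) = n * cosCoeff n h y := by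
    rw [cosCoeff, ← intervalIntegral.integral_const_mul]
    congr 1 with x
    ring
  rw [e] at this
  linarith

/-- Exchanging integrals, the kernel acts on the sine mode as multiplication by `-(2π/n)
e^{-n|y-t|}`. Integration by parts turns the sine coefficient of `∂ₓ h` into `-n` times the cosine
coefficient of `h`, and the factors `n` and signs cancel. -/
lemma integral_strip_kernel_mul_dx (H : Admissible Θ ε κ) (hf : Regular ε M h) {y : ℝ}
    (hy : y ∈ bands ε) {n : ℕ} (hn : n ≠ 0) :
    ∫ x in (-Real.pi)..Real.pi, (∫ q in strip ε,
        logKer (x - q.1, y - q.2) * (deriv (profile Θ ε κ) q.2 * dx h q)) * Real.sin (n * x)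
      = 2 * Real.pi * ∫ t in (-2 : ℝ)..2, deriv (profile Θ ε κ) t
        * (Real.exp (-(n * |y - t|)) * cosCoeff n h t) := by
  obtain ⟨C, hC, hC', -⟩ := exists_lipschitz_profile H
  have hn' : (n : ℝ) ≠ 0 := Nat.cast_ne_zero.2 hn
  have hdm : AEStronglyMeasurable (dx h) (volume.restrict (strip ε)) :=
    (hf.dx_continuousOn.mono (prod_mono_left (subset_univ _))).aestronglyMeasurable
      (measurableSet_strip ε)
  have hm : AEStronglyMeasurable (fun q : ℝ × ℝ => deriv (profile Θ ε κ) q.2 * dx h q)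
      (volume.restrict (strip ε)) := (aestronglyMeasurable_deriv_profile_snd H _).mul hdm
  have hb : ∀ q ∈ strip ε, |deriv (profile Θ ε κ) q.2 * dx h q| ≤ C * M := fun q hq => by
    rw [abs_mul]
    exact mul_le_mul (hC' _) (hf.dx_bound q ⟨mem_univ _, hq.2⟩) (abs_nonneg _) hC
  have hi := integrable_kernel_mul_mul_sin H hm hb hy n
  rw [intervalIntegral.integral_of_le (by linarith [Real.pi_pos])]
  simp only [← integral_mul_const]
  rw [integral_integral_swap hi]
  have e1 : ∀ᵐ q ∂(volume.restrict (strip ε)),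
      ∫ x in Ioc (-Real.pi) Real.pi, logKer (x - q.1, y - q.2)
          * (deriv (profile Θ ε κ) q.2 * dx h q) * Real.sin (n * x)
        = deriv (profile Θ ε κ) q.2 * (-(2 * Real.pi / n) * Real.exp (-(n * |y - q.2|)))
          * (dx h q * Real.sin (n * q.1)) := by
    filter_upwards [ae_strip_snd_ne y] with q hq
    have e : ∀ x, logKer (x - q.1, y - q.2) * (deriv (profile Θ ε κ) q.2 * dx h q) * Real.sin (n * x)
        = logKer (x - q.1, y - q.2) * Real.sin (n * x) * (deriv (profile Θ ε κ) q.2 * dx h q) :=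
      fun x => by ring
    simp only [e]
    rw [integral_mul_const, ← intervalIntegral.integral_of_le (by linarith [Real.pi_pos]),
      integral_logKer_sub_mul_sin (sub_ne_zero.2 hq.symm) hn]
    ring
  rw [integral_congr_ae e1]
  have hi2 : IntegrableOn (fun q : ℝ × ℝ => deriv (profile Θ ε κ) q.2
      * (-(2 * Real.pi / n) * Real.exp (-(n * |y - q.2|))) * (dx h q * Real.sin (n * q.1)))
      (strip ε) := by
    have hfin : volume (strip ε) ≠ ⊤ := by
      refine ((measure_mono (prod_mono_right (s := Ioc (-Real.pi) Real.pi)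
        (interior_subset (s := bands ε)))).trans_lt ?_).ne
      rw [Measure.volume_eq_prod, Measure.prod_prod]
      exact ENNReal.mul_lt_top measure_Ioc_lt_top isCompact_bands.measure_lt_top
    refine (integrableOn_const (C := C * (2 * Real.pi / n) * M) hfin).mono' ?_ ?_
    · refine AEStronglyMeasurable.mul ?_ (hdm.mul ?_)
      · exact (aestronglyMeasurable_deriv_profile_snd H _).mul
          (Continuous.aestronglyMeasurable (by fun_prop))
      · exact Continuous.aestronglyMeasurable (by fun_prop)
    · filter_upwards [ae_restrict_mem (measurableSet_strip ε)] with q hq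
      simp only [norm_mul, Real.norm_eq_abs, abs_neg]
      have h1 : |Real.exp (-(n * |y - q.2|))| ≤ 1 := by
        rw [Real.abs_exp]
        exact Real.exp_le_one_iff.2 (neg_nonpos.2 (by positivity))
      have h2 : |2 * Real.pi / n| = 2 * Real.pi / n := abs_of_nonneg (by positivity)
      have h3 := hf.dx_bound q ⟨mem_univ _, hq.2⟩
      have h4 := Real.abs_sin_le_one (n * q.1)
      have h5 := hC' q.2
      rw [h2]
      have hM := (abs_nonneg _).trans h3
      calc _ ≤ C * (2 * Real.pi / n * 1) * (M * 1) := by gcongr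
        _ = _ := by ring
  unfold IntegrableOn at hi2
  rw [volume_restrict_strip] at hi2 ⊢
  rw [integral_prod_symm _ hi2]
  have e2 : ∀ t ∈ interior (bands ε),
      ∫ u in Ioc (-Real.pi) Real.pi, deriv (profile Θ ε κ) t
        * (-(2 * Real.pi / n) * Real.exp (-(n * |y - t|))) * (dx h (u, t) * Real.sin (n * u))
      = deriv (profile Θ ε κ) t
        * (2 * Real.pi * (Real.exp (-(n * |y - t|)) * cosCoeff n h t)) := by
    intro t ht
    rw [integral_const_mul, ← intervalIntegral.integral_of_le (by linarith [Real.pi_pos]),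
      integral_dx_mul_sin hf ht n]
    field_simp
  rw [setIntegral_congr_fun isOpen_interior.measurableSet e2,
    integral_bands_eq H (fun t => 2 * Real.pi * (Real.exp (-(n * |y - t|)) * cosCoeff n h t)),
    ← intervalIntegral.integral_const_mul]
  congr 1 with t
  ring

/-- The `n`-th cosine mode of a solution of the linearized equation. -/
lemma cosCoeff_equation (H : Admissible Θ ε κ) (hf : Regular ε M h) {lam : ℝ}
    (hL : ∀ p ∈ openStrips ε, waveL Θ ε κ lam h p = 0) {y : ℝ} (hy : y ∈ interior (bands ε))
    {n : ℕ} (hn : n ≠ 0) :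
    (lam + y - 1 / 2 * shearPotential Θ ε κ y) * cosCoeff n h y
      = 1 / (2 * n) * ∫ t in (-2 : ℝ)..2, deriv (profile Θ ε κ) t
        * (Real.exp (-(n * |y - t|)) * cosCoeff n h t) := by
  obtain ⟨C, hC, hC', -⟩ := exists_lipschitz_profile H
  have hn' : (n : ℝ) ≠ 0 := Nat.cast_ne_zero.2 hn
  have hpi := Real.pi_pos
  have hdm : AEStronglyMeasurable (dx h) (volume.restrict (strip ε)) :=
    (hf.dx_continuousOn.mono (prod_mono_left (subset_univ _))).aestronglyMeasurable
      (measurableSet_strip ε)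
  have hm : AEStronglyMeasurable (fun q : ℝ × ℝ => deriv (profile Θ ε κ) q.2 * dx h q)
      (volume.restrict (strip ε)) := (aestronglyMeasurable_deriv_profile_snd H _).mul hdm
  have hb : ∀ q ∈ strip ε, |deriv (profile Θ ε κ) q.2 * dx h q| ≤ C * M := fun q hq => by
    rw [abs_mul]
    exact mul_le_mul (hC' _) (hf.dx_bound q ⟨mem_univ _, hq.2⟩) (abs_nonneg _) hC
  have hyb := interior_subset hy
  -- Splitting the difference `∂ₓ h(x, y) - ∂ₓ h(q)` separates the multiplication part, absorbed in
  -- the shear speed, from the nonlocal part.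
  have key : ∀ x, ∫ q in strip ε, logKer (x - q.1, y - q.2) * (deriv (profile Θ ε κ) q.2 * dx h q)
      = -(4 * Real.pi) * ((lam + y - 1 / 2 * shearPotential Θ ε κ y) * dx h (x, y)) := by
    intro x
    have h0 := hL (x, y) ⟨mem_univ _, hy⟩
    unfold waveL at h0
    have e : ∀ q : ℝ × ℝ, deriv (profile Θ ε κ) q.2
        * Real.log (Real.cosh (y - q.2) - Real.cos (x - q.1)) * (dx h (x, y) - dx h q)
        = logKer (x - q.1, y - q.2) * deriv (profile Θ ε κ) q.2 * dx h (x, y)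
          - logKer (x - q.1, y - q.2) * (deriv (profile Θ ε κ) q.2 * dx h q) := fun q => by
      rw [logKer, den]; ring
    simp only [e] at h0
    rw [setIntegral_congr_set cell_ae_eq_strip, integral_sub
      ((integrableOn_kernel_mul H (aestronglyMeasurable_deriv_profile_snd H _)
        (fun q _ => hC' q.2) hyb x).mul_const _) (integrableOn_kernel_mul H hm hb hyb x),
      integral_mul_const, integral_strip_kernel H hyb x] at h0
    generalize (∫ q in strip ε, logKer (x - q.1, y - q.2)
      * (deriv (profile Θ ε κ) q.2 * dx h q)) = I at h0 ⊢
    field_simp at h0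
    linear_combination h0
  have h2 := integral_strip_kernel_mul_dx H hf hyb hn
  simp only [key] at h2
  have e3 : ∀ x, -(4 * Real.pi) * ((lam + y - 1 / 2 * shearPotential Θ ε κ y) * dx h (x, y))
      * Real.sin (n * x) = -(4 * Real.pi) * (lam + y - 1 / 2 * shearPotential Θ ε κ y)
        * (dx h (x, y) * Real.sin (n * x)) := fun x => by ring
  simp only [e3] at h2
  rw [intervalIntegral.integral_const_mul, integral_dx_mul_sin hf hy n] at h2
  have h3 : (lam + y - 1 / 2 * shearPotential Θ ε κ y) * cosCoeff n h y * (4 * Real.pi * n)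
    = 2 * Real.pi * ∫ t in (-2 : ℝ)..2, deriv (profile Θ ε κ) t
        * (Real.exp (-(n * |y - t|)) * cosCoeff n h t) := by rw [← h2]; ring
  refine mul_right_cancel₀ (b := 4 * Real.pi * n) (by positivity) ?_
  rw [h3]
  field_simp
  ring

end

noncomputable section

/-! ### The linearized speed has no zero on the bands -/

/-- Sine coefficients vanish by evenness, so all complex Fourier coefficients are zero; a continuous
function on the circle with summable coefficients is the sum of its Fourier series. -/
lemma eq_zero_of_integral_mul_cos_eq_zero {g : ℝ → ℝ} (hc : Continuous g)
    (hp : Function.Periodic g (2 * Real.pi)) (he : ∀ x, g (-x) = g x)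
    (h0 : ∀ n : ℕ, ∫ x in (-Real.pi)..Real.pi, g x * Real.cos (n * x) = 0) (x : ℝ) : g x = 0 := by
  have : Fact (0 < 2 * Real.pi) := ⟨by positivity⟩
  have hcos : ∀ n : ℤ, ∫ x in (-Real.pi)..Real.pi, g x * Real.cos (n * x) = 0 := by
    intro n
    have h := h0 n.natAbs
    have e : ∀ x : ℝ, Real.cos ((n.natAbs : ℝ) * x) = Real.cos (n * x) := fun x => by
      rw [Nat.cast_natAbs, Int.cast_abs]
      rcases abs_choice (n : ℝ) with h | h <;> rw [h]
      rw [neg_mul, Real.cos_neg]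
    simpa only [e] using h
  have hsin : ∀ n : ℤ, ∫ x in (-Real.pi)..Real.pi, g x * Real.sin (n * x) = 0 := fun n =>
    integral_odd (fun x => by rw [he, mul_neg, Real.sin_neg, mul_neg]) _
  have hlc : Continuous hp.lift := continuous_coinduced_dom.2 hc
  let G : C(AddCircle (2 * Real.pi), ℂ) := ⟨fun x => (hp.lift x : ℂ), by fun_prop⟩
  have hG : ∀ n, fourierCoeff G n = 0 := by
    intro n
    rw [fourierCoeff_eq_intervalIntegral G n (-Real.pi), show -Real.pi + 2 * Real.pi = Real.pi by ring]
    have e : ∀ x : ℝ, fourier (-n) (x : AddCircle (2 * Real.pi)) • G x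
        = ((g x * Real.cos (n * x) : ℝ) : ℂ) - Complex.I * ((g x * Real.sin (n * x) : ℝ) : ℂ) := by
      intro x
      have e1 : G x = (g x : ℂ) := rfl
      rw [fourier_coe_apply, e1]
      have e2 : 2 * (Real.pi : ℂ) * Complex.I * ((-n : ℤ) : ℂ) * x / ((2 * Real.pi : ℝ) : ℂ)
          = ((-(n * x) : ℝ) : ℂ) * Complex.I := by
        have : (Real.pi : ℂ) ≠ 0 := by exact_mod_cast Real.pi_ne_zero
        push_cast
        field_simp
      rw [e2, Complex.exp_ofReal_mul_I, Real.cos_neg, Real.sin_neg, smul_eq_mul]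
      push_cast
      ring
    simp only [e]
    rw [intervalIntegral.integral_sub (Continuous.intervalIntegrable (by fun_prop) _ _)
      (Continuous.intervalIntegrable (by fun_prop) _ _), intervalIntegral.integral_const_mul,
      intervalIntegral.integral_ofReal, intervalIntegral.integral_ofReal, hcos, hsin]
    simp
  have hs := hasSum_fourier_series_of_summable (f := G) (by
    have : fourierCoeff G = fun _ => 0 := funext hG
    rw [this]; exact summable_zero)
  simp only [hG, zero_smul] at hs
  have hz : G = 0 := hs.unique hasSum_zero
  have h1 : ((g x : ℝ) : ℂ) = 0 := DFunLike.congr_fun hz (x : AddCircle (2 * Real.pi))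
  exact_mod_cast h1

/-- A Rayleigh-type criterion: a solution of `(U η' - U' η)' = k² U η` that vanishes where `U` does
and decays at `b` is zero. -/
lemma eq_zero_of_rayleigh {U U' η η' : ℝ → ℝ} {a b k : ℝ} (hk : 0 < k)
    (hU : ∀ y ∈ Icc a b, HasDerivAt U (U' y) y) (hη : ∀ y ∈ Icc a b, HasDerivAt η (η' y) y)
    (hP : ∀ y ∈ Icc a b, HasDerivAt (fun y => U y * η' y - U' y * η y) (k ^ 2 * (U y * η y)) y)
    (hU' : ∀ y ∈ Icc a b, 0 < U' y) (hUa : U a = 0) (hηa : η a = 0)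
    (hηb : η' b = -(k * η b)) : ∀ y ∈ Ioo a b, η y = 0 := by
  intro y₀ hy₀
  have hab : a < b := hy₀.1.trans hy₀.2
  have hpos : ∀ y ∈ Ioc a b, 0 < U y := by
    have hm : StrictMonoOn U (Icc a b) := by
      refine strictMonoOn_of_deriv_pos (convex_Icc a b)
        (fun y hy => (hU y hy).continuousAt.continuousWithinAt) fun y hy => ?_
      rw [interior_Icc] at hy
      rw [(hU y (Ioo_subset_Icc_self hy)).deriv]
      exact hU' y (Ioo_subset_Icc_self hy)
    intro y hy
    rw [← hUa]
    exact hm (left_mem_Icc.2 hab.le) (Ioc_subset_Icc_self hy) hy.1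
  set P := fun y => U y * η' y - U' y * η y with hPdef
  -- Since `P = U² (η / U)'` and `P' = k² U η`, the derivative of `P η / U` is the sum of squares
  -- `k² η² + (P / U)²`.
  set En := fun y => P y * (η y / U y) with hE
  have hEd : ∀ y ∈ Ioc a b, HasDerivAt En (k ^ 2 * η y ^ 2 + (P y / U y) ^ 2) y := by
    intro y hy
    have hy' := Ioc_subset_Icc_self hy
    have := (hP y hy').mul ((hη y hy').div (hU y hy') (hpos y hy).ne')
    refine this.congr_deriv ?_
    have := (hpos y hy).ne'
    simp only [hPdef, Pi.div_apply]
    field_simp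
  have hmono : MonotoneOn En (Ioc a b) := by
    refine monotoneOn_of_deriv_nonneg (convex_Ioc a b)
      (fun y hy => (hEd y hy).continuousAt.continuousWithinAt) (fun y hy => ?_) fun y hy => ?_
    · rw [interior_Ioc] at hy
      exact (hEd y (Ioo_subset_Ioc_self hy)).differentiableAt.differentiableWithinAt
    · rw [interior_Ioc] at hy
      rw [(hEd y (Ioo_subset_Ioc_self hy)).deriv]
      positivity
  have ha : a ∈ Icc a b := left_mem_Icc.2 hab.le
  -- At the zero `a` of `U` the quotient `η / U` stays bounded, with limit `η' a / U' a`, because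
  -- `U' a > 0`, while `P` tends to `0`.
  have hlim : Tendsto En (𝓝[>] a) (𝓝 0) := by
    have h1 : Tendsto P (𝓝[>] a) (𝓝 0) := by
      have := (hP a ha).continuousAt.tendsto
      rw [show P a = 0 by simp only [hPdef, hUa, hηa]; ring] at this
      exact this.mono_left nhdsWithin_le_nhds
    have h2 : Tendsto (fun y => η y / U y) (𝓝[>] a) (𝓝 (η' a / U' a)) := by
      have s1 := (hasDerivAt_iff_tendsto_slope.1 (hη a ha)).mono_left
        (nhdsWithin_mono a fun y (hy : a < y) => hy.ne')
      have s2 := (hasDerivAt_iff_tendsto_slope.1 (hU a ha)).mono_left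
        (nhdsWithin_mono a fun y (hy : a < y) => hy.ne')
      refine (s1.div s2 (hU' a ha).ne').congr' ?_
      filter_upwards [self_mem_nhdsWithin] with y hy
      have hya : y - a ≠ 0 := sub_ne_zero.2 (ne_of_gt hy)
      simp only [Pi.div_apply, slope_def_field, hUa, hηa, sub_zero]
      rw [div_div_div_cancel_right₀ hya]
    simpa using h1.mul h2
  have hb : En b ≤ 0 := by
    have hUb := hpos b (right_mem_Ioc.2 hab)
    have hU'b := hU' b (right_mem_Icc.2 hab.le)
    have : En b = -(k * η b ^ 2 + U' b * η b ^ 2 / U b) := by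
      simp only [hE, hPdef, hηb]
      field_simp
      ring
    rw [this, neg_nonpos]
    positivity
  have hz : ∀ y ∈ Ioc a b, En y = 0 := by
    intro y hy
    refine le_antisymm ((hmono hy (right_mem_Ioc.2 hab) hy.2).trans hb) ?_
    refine le_of_tendsto hlim ?_
    filter_upwards [Ioo_mem_nhdsGT hy.1] with z hz
    exact hmono ⟨hz.1, hz.2.le.trans hy.2⟩ hy hz.2.le
  have hd0 : HasDerivAt En 0 y₀ := by
    refine (hasDerivAt_const y₀ (0 : ℝ)).congr_of_eventuallyEq ?_
    filter_upwards [Ioo_mem_nhds hy₀.1 hy₀.2] with z hz'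
    exact hz z (Ioo_subset_Ioc_self hz')
  have h := (hEd y₀ (Ioo_subset_Ioc_self hy₀)).unique hd0
  have h3 : k ^ 2 * η y₀ ^ 2 = 0 := by
    have a1 : 0 ≤ k ^ 2 * η y₀ ^ 2 := by positivity
    have a2 : 0 ≤ (P y₀ / U y₀) ^ 2 := by positivity
    linarith
  rcases mul_eq_zero.1 h3 with h4 | h4
  · exact absurd h4 (by positivity)
  · exact pow_eq_zero_iff (two_ne_zero) |>.1 h4

lemma integral_split {k₁ k₂ : ℝ → ℝ} {k : ℝ → ℝ} (hg : Continuous k) {y : ℝ} (hy : y ∈ Icc (-2 : ℝ) 2)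
    (h1 : ∀ t ≤ y, k t = k₁ t) (h2 : ∀ t, y ≤ t → k t = k₂ t) :
    ∫ t in (-2 : ℝ)..2, k t = (∫ t in (-2 : ℝ)..y, k₁ t) + ∫ t in y..2, k₂ t := by
  rw [← intervalIntegral.integral_add_adjacent_intervals (hg.intervalIntegrable (-2) y)
    (hg.intervalIntegrable y 2)]
  congr 1
  · refine intervalIntegral.integral_congr fun t ht => h1 t ?_
    rw [uIcc_of_le hy.1] at ht; exact ht.2
  · refine intervalIntegral.integral_congr fun t ht => h2 t ?_
    rw [uIcc_of_le hy.2] at ht; exact ht.1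

lemma hasDerivAt_integral_left {g : ℝ → ℝ} (hg : Continuous g) (a y : ℝ) :
    HasDerivAt (fun y => ∫ t in a..y, g t) (g y) y :=
  intervalIntegral.integral_hasDerivAt_right (hg.intervalIntegrable _ _)
    hg.stronglyMeasurable.stronglyMeasurableAtFilter hg.continuousAt

lemma hasDerivAt_integral_right {g : ℝ → ℝ} (hg : Continuous g) (b y : ℝ) :
    HasDerivAt (fun y => ∫ t in y..b, g t) (-g y) y :=
  intervalIntegral.integral_hasDerivAt_left (hg.intervalIntegrable _ _)
    hg.stronglyMeasurable.stronglyMeasurableAtFilter hg.continuousAt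

/-- Splitting at `t = y` removes the absolute value, and the contributions of the moving endpoint
cancel. -/
lemma hasDerivAt_integral_mul_abs {g : ℝ → ℝ} (hg : Continuous g) {y : ℝ} (hy : y ∈ Ioo (-2 : ℝ) 2) :
    HasDerivAt (fun y => ∫ t in (-2 : ℝ)..2, g t * |y - t|)
      ((∫ t in (-2 : ℝ)..y, g t) - ∫ t in y..2, g t) y := by
  have e : (fun y => ∫ t in (-2 : ℝ)..2, g t * |y - t|) =ᶠ[𝓝 y] fun y =>
      (y * (∫ t in (-2 : ℝ)..y, g t) - ∫ t in (-2 : ℝ)..y, t * g t)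
        + ((∫ t in y..2, t * g t) - y * ∫ t in y..2, g t) := by
    filter_upwards [Ioo_mem_nhds hy.1 hy.2] with z hz
    rw [integral_split (k := fun t => g t * |z - t|) (k₁ := fun t => z * g t - t * g t)
      (k₂ := fun t => t * g t - z * g t) (by fun_prop) (Ioo_subset_Icc_self hz),
      intervalIntegral.integral_sub, intervalIntegral.integral_sub,
      intervalIntegral.integral_const_mul, intervalIntegral.integral_const_mul]
    any_goals exact Continuous.intervalIntegrable (by fun_prop) _ _
    · intro t ht
      rw [abs_of_nonneg (sub_nonneg.2 ht)]; ring
    · intro t ht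
      rw [abs_of_nonpos (sub_nonpos.2 ht)]; ring
  have hg2 : Continuous fun t => t * g t := by fun_prop
  have h := (((hasDerivAt_id y).mul (hasDerivAt_integral_left hg (-2) y)).sub
    (hasDerivAt_integral_left hg2 (-2) y)).add ((hasDerivAt_integral_right hg2 2 y).sub
    ((hasDerivAt_id y).mul (hasDerivAt_integral_right hg 2 y)))
  refine (h.congr_deriv ?_).congr_of_eventuallyEq e
  simp only [id]
  ring

variable {Θ : ℝ → ℝ} {ε κ M lam : ℝ} {h : ℝ × ℝ → ℝ}

lemma profile_two (H : Admissible Θ ε κ) : profile Θ ε κ 2 = 0 :=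
  profile_outer H (by rw [abs_of_pos two_pos]; linarith [H.ε_lt])

lemma profile_neg_two (H : Admissible Θ ε κ) : profile Θ ε κ (-2) = 0 :=
  profile_outer H (by rw [abs_neg, abs_of_pos two_pos]; linarith [H.ε_lt])

lemma shearPotential_eq (H : Admissible Θ ε κ) {y : ℝ} (hy : y ∈ Icc (-2 : ℝ) 2) :
    shearPotential Θ ε κ y
      = (∫ t in (-2 : ℝ)..y, profile Θ ε κ t) - ∫ t in y..2, profile Θ ε κ t := by
  have hc := continuous_deriv_profile H
  have hc0 := (contDiff_profile H).continuous
  have hF : ∀ t, HasDerivAt (fun t => profile Θ ε κ t * (y - t))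
      (deriv (profile Θ ε κ) t * (y - t) - profile Θ ε κ t) t := fun t => by
    have := (hasDerivAt_profile H t).mul ((hasDerivAt_id t).const_sub y)
    refine this.congr_deriv ?_
    simp only [id]; ring
  have key : ∀ a b, ∫ t in a..b, deriv (profile Θ ε κ) t * (y - t)
      = (profile Θ ε κ b * (y - b) - profile Θ ε κ a * (y - a)) + ∫ t in a..b, profile Θ ε κ t := by
    intro a b
    have := intervalIntegral.integral_eq_sub_of_hasDerivAt (a := a) (b := b) (fun t _ => hF t)
      (Continuous.intervalIntegrable (by fun_prop) _ _)
    rw [intervalIntegral.integral_sub (Continuous.intervalIntegrable (by fun_prop) _ _)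
      (Continuous.intervalIntegrable (by fun_prop) _ _)] at this
    linarith
  unfold shearPotential
  rw [integral_split (k := fun t => deriv (profile Θ ε κ) t * |y - t|)
    (k₁ := fun t => deriv (profile Θ ε κ) t * (y - t))
    (k₂ := fun t => -(deriv (profile Θ ε κ) t * (y - t))) (by fun_prop) hy,
    intervalIntegral.integral_neg, key, key, profile_two H, profile_neg_two H]
  · ring
  · intro t ht
    rw [abs_of_nonneg (sub_nonneg.2 ht)]
  · intro t ht
    rw [abs_of_nonpos (sub_nonpos.2 ht)]; ring

/-- The speed of the shear flow in the moving frame. -/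
def shearSpeed (Θ : ℝ → ℝ) (ε κ lam y : ℝ) : ℝ := lam + y - 1 / 2 * shearPotential Θ ε κ y

lemma hasDerivAt_shearSpeed (H : Admissible Θ ε κ) {y : ℝ} (hy : y ∈ Ioo (-2 : ℝ) 2) :
    HasDerivAt (shearSpeed Θ ε κ lam) (1 - profile Θ ε κ y) y := by
  have hc := continuous_deriv_profile H
  have hd := hasDerivAt_integral_mul_abs hc hy
  have e : ∀ a b, ∫ t in a..b, deriv (profile Θ ε κ) t = profile Θ ε κ b - profile Θ ε κ a :=
    fun a b => intervalIntegral.integral_eq_sub_of_hasDerivAt (fun t _ => hasDerivAt_profile H t)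
      (hc.intervalIntegrable _ _)
  rw [e, e, profile_two H, profile_neg_two H] at hd
  have := ((hasDerivAt_id y).const_add lam).sub (hd.const_mul (1 / 2))
  refine this.congr_deriv ?_
  ring

/-- `(2 n)⁻¹ ∫ e^{-n|y-t|} g(t) dt` in terms of one-sided integrals. -/
def expPotential (g : ℝ → ℝ) (k y : ℝ) : ℝ :=
  1 / (2 * k) * (Real.exp (-(k * y)) * (∫ t in (-2 : ℝ)..y, Real.exp (k * t) * g t)
    + Real.exp (k * y) * ∫ t in y..2, Real.exp (-(k * t)) * g t)

/-- The derivative of `expPotential`. -/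
def expPotentialDeriv (g : ℝ → ℝ) (k y : ℝ) : ℝ :=
  1 / 2 * (Real.exp (k * y) * (∫ t in y..2, Real.exp (-(k * t)) * g t)
    - Real.exp (-(k * y)) * ∫ t in (-2 : ℝ)..y, Real.exp (k * t) * g t)

lemma expPotential_eq {g : ℝ → ℝ} (hg : Continuous g) (k : ℝ) {y : ℝ} (hy : y ∈ Icc (-2 : ℝ) 2) :
    1 / (2 * k) * ∫ t in (-2 : ℝ)..2, Real.exp (-(k * |y - t|)) * g t = expPotential g k y := by
  unfold expPotential
  rw [integral_split (k := fun t => Real.exp (-(k * |y - t|)) * g t)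
    (k₁ := fun t => Real.exp (-(k * y)) * (Real.exp (k * t) * g t))
    (k₂ := fun t => Real.exp (k * y) * (Real.exp (-(k * t)) * g t)) (by fun_prop) hy,
    intervalIntegral.integral_const_mul, intervalIntegral.integral_const_mul]
  · intro t ht
    rw [abs_of_nonneg (sub_nonneg.2 ht), ← mul_assoc, ← Real.exp_add]; ring_nf
  · intro t ht
    rw [abs_of_nonpos (sub_nonpos.2 ht), ← mul_assoc, ← Real.exp_add]; ring_nf

lemma hasDerivAt_exp_mul_left {g : ℝ → ℝ} (hg : Continuous g) (k y : ℝ) :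
    HasDerivAt (fun y => Real.exp (-(k * y))
      * (∫ t in (-2 : ℝ)..y, Real.exp (k * t) * g t))
      (-k * (Real.exp (-(k * y)) * (∫ t in (-2 : ℝ)..y, Real.exp (k * t) * g t)) + g y) y := by
  have h1 : HasDerivAt (fun y => Real.exp (-(k * y))) (Real.exp (-(k * y)) * -k) y := by
    have := ((hasDerivAt_id y).const_mul k).neg.exp
    simpa using this
  have h2 := h1.mul (hasDerivAt_integral_left
    (by fun_prop : Continuous fun t => Real.exp (k * t) * g t) (-2) y)
  refine h2.congr_deriv ?_
  have : Real.exp (-(k * y)) * (Real.exp (k * y) * g y) = g y := by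
    rw [← mul_assoc, ← Real.exp_add]; simp
  rw [this]; ring

lemma hasDerivAt_exp_mul_right {g : ℝ → ℝ} (hg : Continuous g) (k y : ℝ) :
    HasDerivAt (fun y => Real.exp (k * y) * ∫ t in y..2, Real.exp (-(k * t)) * g t)
      (k * (Real.exp (k * y) * ∫ t in y..2, Real.exp (-(k * t)) * g t) - g y) y := by
  have h1 : HasDerivAt (fun y => Real.exp (k * y)) (Real.exp (k * y) * k) y := by
    have := ((hasDerivAt_id y).const_mul k).exp
    simpa using this
  have h2 := h1.mul (hasDerivAt_integral_right
    (by fun_prop : Continuous fun t => Real.exp (-(k * t)) * g t) 2 y)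
  refine h2.congr_deriv ?_
  have : Real.exp (k * y) * (Real.exp (-(k * y)) * g y) = g y := by
    rw [← mul_assoc, ← Real.exp_add]; simp
  rw [mul_neg, this]; ring

lemma hasDerivAt_expPotential {g : ℝ → ℝ} (hg : Continuous g) {k : ℝ} (hk : k ≠ 0) (y : ℝ) :
    HasDerivAt (expPotential g k) (expPotentialDeriv g k y) y := by
  refine (((hasDerivAt_exp_mul_left hg k y).add (hasDerivAt_exp_mul_right hg k y)).const_mul
    (1 / (2 * k))).congr_deriv ?_
  unfold expPotentialDeriv
  field_simp
  ring

lemma hasDerivAt_expPotentialDeriv {g : ℝ → ℝ} (hg : Continuous g) (k y : ℝ) :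
    HasDerivAt (expPotentialDeriv g k) (k ^ 2 * expPotential g k y - g y) y := by
  refine (((hasDerivAt_exp_mul_right hg k y).sub (hasDerivAt_exp_mul_left hg k y)).const_mul
    (1 / 2)).congr_deriv ?_
  unfold expPotential
  field_simp
  ring

end

/-! ### Vanishing of the Fourier modes when the shear speed has a zero. -/

noncomputable section

variable {Θ : ℝ → ℝ} {ε κ M lam : ℝ} {h : ℝ × ℝ → ℝ}

lemma continuous_shearSpeed (H : Admissible Θ ε κ) : Continuous (shearSpeed Θ ε κ lam) := by
  have hc := continuous_deriv_profile H
  have : Continuous (shearPotential Θ ε κ) := by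
    unfold shearPotential
    exact intervalIntegral.continuous_parametric_intervalIntegral_of_continuous' (by fun_prop) _ _
  unfold shearSpeed
  fun_prop

lemma one_sub_profile_pos (H : Admissible Θ ε κ) (y : ℝ) : 0 < 1 - profile Θ ε κ y := by
  linarith [(profile_mem H y).2, H.ε_lt]

lemma strictMonoOn_shearSpeed (H : Admissible Θ ε κ) :
    StrictMonoOn (shearSpeed Θ ε κ lam) (Ioo (-2) 2) := by
  refine strictMonoOn_of_deriv_pos (convex_Ioo _ _) (continuous_shearSpeed H).continuousOn
    fun y hy => ?_
  rw [interior_Ioo] at hy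
  rw [(hasDerivAt_shearSpeed H hy).deriv]
  exact one_sub_profile_pos H y

lemma deriv_profile_of_ge (H : Admissible Θ ε κ) {t : ℝ} (ht : 1 + ε ≤ |t|) :
    deriv (profile Θ ε κ) t = 0 := by
  refine deriv_profile_eq_zero H ?_
  rw [interior_bands H]
  have := H.ε_pos
  have := H.ε_lt
  rintro (h | h)
  · rw [abs_of_neg (by linarith [h.2])] at ht; linarith [h.1]
  · rw [abs_of_pos (by linarith [h.1])] at ht; linarith [h.2]

lemma cosCoeff_extend (H : Admissible Θ ε κ) (n : ℕ) {y : ℝ} (hy : y ∈ bands ε) :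
    cosCoeff n (extend ε h) y = cosCoeff n h y := by
  unfold cosCoeff
  simp only [extend_eq H.ε_pos H.ε_lt hy]

/-- All cosine coefficients of a kernel element vanish when the shear speed has a zero. -/
lemma cosCoeff_eq_zero (H : Admissible Θ ε κ) (hhc : ContinuousOn h (univ ×ˢ bands ε))
    (hf : Regular ε M h) (hL : ∀ p ∈ openStrips ε, waveL Θ ε κ lam h p = 0) {y₀ : ℝ}
    (hy₀ : y₀ ∈ bands ε) (h0 : shearSpeed Θ ε κ lam y₀ = 0) {n : ℕ} (hn : n ≠ 0) :
    ∀ y ∈ bands ε, cosCoeff n h y = 0 := by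
  have hε := H.ε_pos
  have hε1 := H.ε_lt
  set U := shearSpeed Θ ε κ lam with hU
  set c := cosCoeff n (extend ε h) with hc
  have hcc : Continuous c := continuous_cosCoeff (continuous_extend hε hhc) n
  have hceq : ∀ y ∈ bands ε, c y = cosCoeff n h y := fun y hy => cosCoeff_extend H n hy
  have hn' : (n : ℝ) ≠ 0 := Nat.cast_ne_zero.2 hn
  have hnpos : (0 : ℝ) < n := by positivity
  have hpc := continuous_deriv_profile H
  set g := fun t => deriv (profile Θ ε κ) t * c t with hg
  have hgc : Continuous g := by fun_prop
  set η := expPotential g n with hη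
  set η' := expPotentialDeriv g n with hη'
  have dη : ∀ y, HasDerivAt η (η' y) y := hasDerivAt_expPotential hgc hn'
  have dη' : ∀ y, HasDerivAt η' ((n : ℝ) ^ 2 * η y - g y) y := hasDerivAt_expPotentialDeriv hgc n
  have hUc : Continuous U := continuous_shearSpeed H
  have hηc : Continuous η := continuous_iff_continuousAt.2 fun y => (dη y).continuousAt
  have hsub := bands_subset H
  have eqI : ∀ y ∈ interior (bands ε), U y * c y = η y := by
    intro y hy
    have hyb := interior_subset hy
    have := cosCoeff_equation H hf hL hy hn
    rw [hceq y hyb, hη, ← expPotential_eq hgc n (Ioo_subset_Icc_self (hsub hyb))]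
    refine this.trans ?_
    congr 1
    refine intervalIntegral.integral_congr fun t _ => ?_
    simp only [hg]
    by_cases ht : t ∈ interior (bands ε)
    · rw [hceq t (interior_subset ht)]; ring
    · rw [deriv_profile_eq_zero H ht]; ring
  have eqB : ∀ y ∈ bands ε, U y * c y = η y := by
    have hcl : IsClosed {y | U y * c y = η y} := isClosed_eq (by fun_prop) hηc
    exact fun y hy => closure_minimal eqI hcl (bands_subset_closure H hy)
  have dU : ∀ y ∈ Ioo (-2 : ℝ) 2, HasDerivAt U (1 - profile Θ ε κ y) y := fun y hy =>
    hasDerivAt_shearSpeed H hy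
  have dP : ∀ y ∈ Ioo (-2 : ℝ) 2, HasDerivAt (fun y => U y * η' y - (1 - profile Θ ε κ y) * η y)
      ((n : ℝ) ^ 2 * (U y * η y)) y := by
    intro y hy
    have := ((dU y hy).mul (dη' y)).sub (((hasDerivAt_profile H y).const_sub 1).mul (dη y))
    refine this.congr_deriv ?_
    -- The mode equation holds only on the bands, but off them `ϖ' = 0` makes both sides vanish.
    -- This extends the Rayleigh equation across the gap between the bands.
    have e : U y * g y = deriv (profile Θ ε κ) y * η y := by
      by_cases hyb : y ∈ interior (bands ε)
      · rw [← eqI y hyb]; simp only [hg]; ring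
      · simp only [hg]; rw [deriv_profile_eq_zero H hyb]; ring
    linear_combination -e
  have hη0 : η y₀ = 0 := by rw [← eqB y₀ hy₀, h0, zero_mul]
  have hgz : ∀ t, 1 + ε ≤ |t| → g t = 0 := fun t ht => by
    simp only [hg]; rw [deriv_profile_of_ge H ht, zero_mul]
  -- Beyond `1 + ε` there is no source, so `η` is a multiple of the decaying exponential.
  have hright : η' (1 + ε) = -(n * η (1 + ε)) := by
    have : ∫ t in (1 + ε)..2, Real.exp (-(n * t)) * g t = 0 := by
      rw [← intervalIntegral.integral_zero (a := 1 + ε) (b := 2)]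
      refine intervalIntegral.integral_congr fun t ht => ?_
      rw [uIcc_of_le (by linarith)] at ht
      rw [hgz t (ht.1.trans (le_abs_self _)), mul_zero]
    rw [hη', hη, expPotentialDeriv, expPotential, this]
    field_simp
    ring
  have hleft : η' (-(1 + ε)) = n * η (-(1 + ε)) := by
    have : ∫ t in (-2)..(-(1 + ε)), Real.exp (n * t) * g t = 0 := by
      rw [← intervalIntegral.integral_zero (a := -2) (b := -(1 + ε))]
      refine intervalIntegral.integral_congr fun t ht => ?_
      rw [uIcc_of_le (by linarith)] at ht
      rw [hgz t (le_abs'.2 (Or.inl ht.2)), mul_zero]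
    rw [hη', hη, expPotentialDeriv, expPotential, this]
    field_simp
    ring
  have hUmono := strictMonoOn_shearSpeed (lam := lam) H
  have hy₀' := hsub hy₀
  have hpos := one_sub_profile_pos H
  have hb : ∀ y ∈ interior (bands ε), -(1 + ε) < y ∧ y < 1 + ε := by
    intro y hy
    rw [interior_bands H] at hy
    rcases hy with hy | hy <;> constructor <;> linarith [hy.1, hy.2]
  have hηz : ∀ y ∈ interior (bands ε), y ≠ y₀ → η y = 0 := by
    intro y hy hne
    have hby := hb y hy
    rcases lt_or_gt_of_ne hne with hlt | hgt
    -- The part to the left of `y₀` is reflected. The flow `-U(-y)` is again increasing and vanishes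
    -- at `-y₀`, and decay at the lower edge becomes decay at `1 + ε`.
    · have hr : ∀ y ∈ Icc (-y₀) (1 + ε), -y ∈ Ioo (-2 : ℝ) 2 := fun y hy =>
        ⟨by linarith [hy.2], by linarith [hy.1, hy₀'.2]⟩
      have := eq_zero_of_rayleigh (U := fun y => -U (-y)) (U' := fun y => 1 - profile Θ ε κ (-y))
        (η := fun y => η (-y)) (η' := fun y => -η' (-y)) (a := -y₀) (b := 1 + ε) hnpos
        (fun y hy => ((dU _ (hr y hy)).comp y (hasDerivAt_neg y)).neg.congr_deriv (by ring))
        (fun y _ => ((dη (-y)).comp y (hasDerivAt_neg y)).congr_deriv (by ring))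
        (fun y hy => by
          have := (dP _ (hr y hy)).comp y (hasDerivAt_neg y)
          refine (this.congr_deriv (by ring)).congr_of_eventuallyEq (Eventually.of_forall fun z => ?_)
          simp only [Function.comp]
          ring)
        (fun y _ => hpos (-y)) (by simp only [neg_neg, h0, neg_zero]) (by simp only [neg_neg, hη0])
        (by rw [hleft]) (-y) ⟨by linarith, by linarith⟩
      simpa using this
    · have hr : ∀ y ∈ Icc y₀ (1 + ε), y ∈ Ioo (-2 : ℝ) 2 := fun y hy =>
        ⟨by linarith [hy.1, hy₀'.1], by linarith [hy.2]⟩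
      exact eq_zero_of_rayleigh hnpos (fun y hy => dU y (hr y hy)) (fun y _ => dη y)
        (fun y hy => dP y (hr y hy)) (fun y _ => hpos y) h0 hη0 hright y ⟨hgt, hby.2⟩
  -- From `U c = η = 0` one gets `c = 0` wherever `U ≠ 0`. As `U` is injective, only `y₀` is lost,
  -- and continuity recovers it.
  have hcz : ∀ y ∈ interior (bands ε) ∩ {y₀}ᶜ, c y = 0 := by
    rintro y ⟨hy, hne⟩
    have h1 := eqI y hy
    rw [hηz y hy hne] at h1
    refine (mul_eq_zero.1 h1).resolve_left fun h2 => hne ?_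
    exact hUmono.injOn (hsub (interior_subset hy)) hy₀' (h2.trans h0.symm)
  intro y hy
  rw [← hceq y hy]
  have hcl : IsClosed {y | c y = 0} := isClosed_eq hcc continuous_const
  have h1 : interior (bands ε) ⊆ {y | c y = 0} :=
    ((dense_compl_singleton y₀).open_subset_closure_inter isOpen_interior).trans
      (closure_minimal hcz hcl)
  exact closure_minimal h1 hcl (bands_subset_closure H hy)

/-- The shear speed does not vanish on the bands at a bifurcation point. -/
lemma shearSpeed_ne_zero (H : Admissible Θ ε κ) (hX : MemX ε h) (hf : Regular ε M h)
    (hne : ∃ x, ∃ y ∈ bands ε, h (x, y) ≠ 0)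
    (hL : ∀ p ∈ openStrips ε, waveL Θ ε κ lam h p = 0) {y₀ : ℝ} (hy₀ : y₀ ∈ bands ε) :
    shearSpeed Θ ε κ lam y₀ ≠ 0 := by
  intro h0
  obtain ⟨x, y, hy, hxy⟩ := hne
  refine hxy (eq_zero_of_integral_mul_cos_eq_zero (g := fun x => h (x, y)) ?_
    (fun x => hX.periodic x y hy) (fun x => hX.even x y hy) (fun n => ?_) x)
  · rw [← continuousOn_univ]
    exact hX.continuousOn.comp (by fun_prop) fun x _ => ⟨mem_univ _, hy⟩
  · rcases eq_or_ne n 0 with rfl | hn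
    · simpa using hX.mean_zero y hy
    · exact cosCoeff_eq_zero H hX.continuousOn hf hL hy₀ h0 hn y hy

end

noncomputable section

/-! ### Smoothness of the vorticity -/

variable {Θ : ℝ → ℝ} {ε κ s M lam : ℝ} {f E ζ : ℝ × ℝ → ℝ}

lemma layering_zero (ε : ℝ) : Layering ε 0 (fun _ => 0) (fun _ => 0) Prod.snd :=
  ⟨continuous_const, fun _ _ => rfl, fun _ _ _ => rfl, fun _ => by simp, fun x y y' => by simp,
    fun _ _ => add_zero _⟩

/-- For a vorticity depending on `z` alone, the horizontal integration leaves only the mean of the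
kernel, computed in `integral_logKer_sub`. Differentiating the outcome gives the shear velocity. -/
lemma conv_logKer_shear (H : Admissible Θ ε κ) (x z : ℝ) :
    conv logKer (fun p => profile Θ ε κ p.2) (x, z)
      = 2 * Real.pi * (∫ t in (-2 : ℝ)..2, profile Θ ε κ t * |z - t|)
        - 2 * Real.pi * Real.log 2 * ∫ t in (-2 : ℝ)..2, profile Θ ε κ t := by
  have hd := (layering_zero ε).isDensity H zero_le_one
  have hpc := (contDiff_profile H).continuous
  have hi := integrableOn_conv_comm isKernel_logKer hd (x, z)
  rw [conv_comm isKernel_logKer hd]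
  unfold IntegrableOn at hi
  rw [volume_restrict_tube] at hi ⊢
  rw [integral_prod_symm _ hi]
  have e : ∀ᵐ t : ℝ, ∫ u in Ioc (-Real.pi) Real.pi, logKer ((x, z) - (u, t)) * profile Θ ε κ t
      = profile Θ ε κ t * (2 * Real.pi * (|z - t| - Real.log 2)) := by
    filter_upwards [Measure.ae_ne volume z] with t ht
    have e1 : ∀ u, logKer ((x, z) - (u, t)) = logKer (u - x, z - t) := fun u => by
      rw [Prod.mk_sub_mk, ← logKer_neg_fst, neg_sub]
    simp only [e1]
    rw [integral_mul_const, ← intervalIntegral.integral_of_le (by linarith [Real.pi_pos]),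
      integral_logKer_sub (sub_ne_zero.2 ht.symm), mul_comm]
  rw [integral_congr_ae e, ← setIntegral_eq_integral_of_forall_compl_eq_zero (s := Ioc (-2) 2)
    (fun t ht => ?_), ← intervalIntegral.integral_of_le (by norm_num)]
  · have e2 : ∀ t, profile Θ ε κ t * (2 * Real.pi * (|z - t| - Real.log 2))
        = 2 * Real.pi * (profile Θ ε κ t * |z - t|)
          - 2 * Real.pi * Real.log 2 * profile Θ ε κ t := fun t => by ring
    simp only [e2]
    rw [intervalIntegral.integral_sub (Continuous.intervalIntegrable (by fun_prop) _ _)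
      (Continuous.intervalIntegrable (by fun_prop) _ _), intervalIntegral.integral_const_mul,
      intervalIntegral.integral_const_mul]
  · rw [profile_outer H, zero_mul]
    have : (2 : ℝ) ≤ |t| := by
      by_contra h
      rw [not_le, abs_lt] at h
      exact ht ⟨h.1, h.2.le⟩
    linarith [H.ε_lt]

lemma conv_logKerY_shear (H : Admissible Θ ε κ) (x : ℝ) {z : ℝ} (hz : z ∈ Ioo (-2 : ℝ) 2) :
    conv logKerY (fun p => profile Θ ε κ p.2) (x, z) = 2 * Real.pi * shearPotential Θ ε κ z := by
  have h1 := hasDerivAt_conv_logKer_snd ((layering_zero ε).isDensity H zero_le_one) x z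
  simp only [conv_logKer_shear H] at h1
  have h2 := ((hasDerivAt_integral_mul_abs (contDiff_profile H).continuous hz).const_mul
    (2 * Real.pi)).sub_const (2 * Real.pi * Real.log 2 * ∫ t in (-2 : ℝ)..2, profile Θ ε κ t)
  rw [shearPotential_eq H (Ioo_subset_Icc_self hz)]
  exact h1.unique h2

/-- The derivative of the stream function in the second variable. -/
def streamY (Θ : ℝ → ℝ) (ε κ lam : ℝ) (ζ : ℝ × ℝ → ℝ) (p : ℝ × ℝ) : ℝ :=
  lam + p.2 - 1 / (4 * Real.pi) * conv logKerY (fun p => profile Θ ε κ (ζ p)) p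

lemma Layering.hasDerivAt_stream_snd (h : Layering ε s f E ζ) (H : Admissible Θ ε κ) (hs : s ≤ 1)
    (lam x z : ℝ) :
    HasDerivAt (fun t => stream Θ ε κ lam ζ (x, t)) (streamY Θ ε κ lam ζ (x, z)) z := by
  have h1 := (((hasDerivAt_id z).const_mul lam).add (((hasDerivAt_id z).pow 2).div_const 2)).sub
    ((hasDerivAt_conv_logKer_snd (h.isDensity H hs) x z).const_mul (1 / (4 * Real.pi)))
  refine h1.congr_deriv ?_
  unfold streamY
  simp

/-- As `|ζ(x, z) - z| ≤ s` and `ϖ` is Lipschitz, the vorticity is within a multiple of `s` of the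
shear vorticity, uniformly; convolution with a locally integrable kernel keeps this. The box of
height `7` suffices since `|z| < 2` and the vorticities vanish beyond `3`. -/
lemma exists_streamY_bound (H : Admissible Θ ε κ) : ∃ K, 0 ≤ K ∧
    ∀ (s : ℝ) (f E ζ : ℝ × ℝ → ℝ), Layering ε s f E ζ → s ≤ 1 → ∀ lam x, ∀ z ∈ Ioo (-2 : ℝ) 2,
      |streamY Θ ε κ lam ζ (x, z) - shearSpeed Θ ε κ lam z| ≤ K * s := by
  obtain ⟨C, hC, -, hC'⟩ := exists_lipschitz_profile H
  have hpi := Real.pi_pos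
  have hkI := isKernel_logKerY.abs.integrableOn 7
  set I := ∫ q in box 7, |logKerY q| with hI
  have hI0 : 0 ≤ I := integral_nonneg fun q => abs_nonneg _
  refine ⟨1 / (4 * Real.pi) * (I * C), by positivity, fun s f E ζ h hs lam x z hz => ?_⟩
  have hd := h.isDensity H hs
  have hd0 := (layering_zero ε).isDensity H zero_le_one
  have hz' : |((x, z) : ℝ × ℝ).2| + 3 < 7 := by
    have : |z| < 2 := abs_lt.2 hz
    simp only
    linarith
  have key : |conv logKerY (fun p => profile Θ ε κ (ζ p)) (x, z)
      - conv logKerY (fun p => profile Θ ε κ p.2) (x, z)| ≤ I * (C * s) := by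
    rw [conv_eq_box hd hz', conv_eq_box hd0 hz', ← integral_sub
      ((integrableOn_conv isKernel_logKerY hd _).mono_set (box_subset_tube 7))
      ((integrableOn_conv isKernel_logKerY hd0 _).mono_set (box_subset_tube 7)), hI,
      ← integral_mul_const]
    rw [← Real.norm_eq_abs]
    refine (norm_integral_le_of_norm_le (hkI.mul_const _) (ae_of_all _ fun q => ?_))
    rw [← mul_sub, norm_mul]
    refine mul_le_mul_of_nonneg_left ((hC' _ _).trans ?_) (abs_nonneg _)
    exact mul_le_mul_of_nonneg_left (h.abs_sub_le _) hC
  rw [conv_logKerY_shear H x hz] at key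
  have e : streamY Θ ε κ lam ζ (x, z) - shearSpeed Θ ε κ lam z
      = -(1 / (4 * Real.pi)) * (conv logKerY (fun p => profile Θ ε κ (ζ p)) (x, z)
        - 2 * Real.pi * shearPotential Θ ε κ z) := by
    unfold streamY shearSpeed
    field_simp
    ring
  rw [e, abs_mul, abs_neg, abs_of_pos (by positivity : 0 < 1 / (4 * Real.pi)),
    mul_assoc (1 / (4 * Real.pi)), mul_assoc I]
  exact mul_le_mul_of_nonneg_left key (by positivity)

/-- Near the image of a closed band, the vorticity is as smooth as the stream function. -/
lemma Layering.contDiffAt_of_mem_band (h : Layering ε s f E ζ) (H : Admissible Θ ε κ)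
    (hs : s ≤ 1) {n : ℕ} (hn : n ≠ 0) (hΦ : ContDiff ℝ n (stream Θ ε κ lam ζ))
    {a b c δ σ : ℝ} (hab : a ≤ b) (hc : 0 < c) (hδ : 0 < δ)
    (hcz : ∀ x, ∀ z ∈ Ioo (a - δ) (b + δ), c ≤ σ * streamY Θ ε κ lam ζ (x, z))
    (hsδ : s ≤ δ / 2) (hbands : Icc a b ⊆ bands ε)
    (hmean : ∀ y ∈ bands ε, ∫ x in (-Real.pi)..Real.pi, f (x, y) = 0)
    (hconst : ∀ x x', ∀ y ∈ bands ε,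
      stream Θ ε κ lam ζ (x, y + f (x, y)) = stream Θ ε κ lam ζ (x', y + f (x', y)))
    (hleft : ∀ t ∈ Icc (a - 2 * δ) a, profile Θ ε κ t = profile Θ ε κ a)
    (hright : ∀ t ∈ Icc b (b + 2 * δ), profile Θ ε κ t = profile Θ ε κ b)
    {p : ℝ × ℝ} (hp : ζ p ∈ Icc a b) : ContDiffAt ℝ n (fun p => profile Θ ε κ (ζ p)) p := by
  have hEf : ∀ x, ∀ y ∈ Icc a b, E (x, y) = f (x, y) := fun x y hy => h.eq_on x y (hbands hy)
  have hEc := h.continuous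
  obtain ⟨O, m, hO, hm, hOJ, hmem, hlt, hgt⟩ := exists_label (n := n) hn
    (Φ := fun p => σ * stream Θ ε κ lam ζ p) (Φz := fun p => σ * streamY Θ ε κ lam ζ p)
    (contDiff_const.mul hΦ) (fun x z => (h.hasDerivAt_stream_snd H hs lam x z).const_mul σ) hab hc
    hδ hcz (Y := fun x y => y + E (x, y)) (C := fun y => σ * stream Θ ε κ lam ζ (0, y + f (0, y)))
    (fun x y _ y' _ hyy => (h.strictMono x).monotone hyy)
    (fun x y _ => by simp only [add_sub_cancel_left]; exact (h.bound _).trans hsδ)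
    (fun x y hy => by simp only [hEf x y hy]; rw [hconst x 0 y (hbands hy)])
    (fun y hy => by
      simp only [hEf _ y hy]
      have : Continuous fun x => f (x, y) := by
        have h1 : Continuous fun x => E (x, y) := by fun_prop
        simpa only [hEf _ y hy] using h1
      rw [intervalIntegral.integral_add intervalIntegrable_const (this.intervalIntegrable _ _),
        hmean y (hbands hy), intervalIntegral.integral_const, smul_eq_mul]
      ring)
  have hself : ∀ q : ℝ × ℝ, (q.1, ζ q + E (q.1, ζ q)) = q := fun q => by
    rw [show ζ q = ζ (q.1, q.2) from rfl, h.add_self]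
  have hpO : p ∈ O := by
    have := (hmem p.1 (ζ p) hp).1
    rwa [hself] at this
  -- Within the band `m q` is the label itself. Outside, `ζ q` and `m q` may differ, but both lie on
  -- the same side within `2δ` of the edge, where `ϖ` is constant. Hence the identity holds on a
  -- full neighbourhood, including at the edges.
  have hw : ∀ q ∈ O, profile Θ ε κ (ζ q) = profile Θ ε κ (m q) := by
    intro q hq
    have hJ := hOJ q hq
    have hζ := abs_le.1 (h.abs_sub_le q)
    rcases lt_or_ge (ζ q) a with h1 | h1
    · have h2 := hlt q.1 q.2 hq (by rw [← h.gt_iff]; exact h1)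
      rw [hleft (ζ q) ⟨by linarith [hJ.1], h1.le⟩, hleft (m q) ⟨by linarith [h2.2], h2.1.le⟩]
    rcases lt_or_ge b (ζ q) with h3 | h3
    · have h2 := hgt q.1 q.2 hq (by rw [← h.lt_iff]; exact h3)
      rw [hright (ζ q) ⟨h3.le, by linarith [hJ.2]⟩, hright (m q) ⟨h2.1.le, by linarith [h2.2]⟩]
    · have := (hmem q.1 (ζ q) ⟨h1, h3⟩).2
      rw [hself] at this
      rw [this]
  have hmp := hm.contDiffAt (hO.mem_nhds hpO)
  have hpn : ContDiff ℝ n (profile Θ ε κ) := (contDiff_profile H).of_le (by exact_mod_cast le_top)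
  refine (hpn.contDiffAt.comp p hmp).congr_of_eventuallyEq ?_
  filter_upwards [hO.mem_nhds hpO] with q hq using hw q hq

lemma Layering.contDiffAt_of_notMem (h : Layering ε s f E ζ) (H : Admissible Θ ε κ) {n : ℕ}
    {p : ℝ × ℝ} (hp : ζ p ∉ bands ε) : ContDiffAt ℝ n (fun p => profile Θ ε κ (ζ p)) p := by
  rw [mem_bands_iff H, not_and_or, not_le, not_le] at hp
  have hc := h.zeta_continuous.abs
  rcases hp with hp | hp
  · refine (contDiffAt_const (c := ε)).congr_of_eventuallyEq ?_
    filter_upwards [hc.continuousAt.eventually_lt continuousAt_const hp] with q hq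
    exact profile_inner H hq.le
  · refine (contDiffAt_const (c := (0 : ℝ))).congr_of_eventuallyEq ?_
    filter_upwards [continuousAt_const.eventually_lt hc.continuousAt hp] with q hq
    exact profile_outer H hq.le

/-- The vorticity of a traveling wave is smooth when the vertical derivative of the stream function
is bounded away from zero near the bands. -/
lemma Layering.contDiff_profile (h : Layering ε s f E ζ) (H : Admissible Θ ε κ) (hs : s ≤ 1)
    {c δ σ₁ σ₂ : ℝ} (hc : 0 < c) (hδ : 0 < δ) (hδε : δ ≤ (1 - ε) / 2) (hsδ : s ≤ δ / 2)
    (h₁ : ∀ x, ∀ z ∈ Ioo (-1 - ε - δ) (-1 + ε + δ), c ≤ σ₁ * streamY Θ ε κ lam ζ (x, z))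
    (h₂ : ∀ x, ∀ z ∈ Ioo (1 - ε - δ) (1 + ε + δ), c ≤ σ₂ * streamY Θ ε κ lam ζ (x, z))
    (hmean : ∀ y ∈ bands ε, ∫ x in (-Real.pi)..Real.pi, f (x, y) = 0)
    (hconst : ∀ x x', ∀ y ∈ bands ε,
      stream Θ ε κ lam ζ (x, y + f (x, y)) = stream Θ ε κ lam ζ (x', y + f (x', y))) :
    ContDiff ℝ ∞ fun p => profile Θ ε κ (ζ p) := by
  have hε := H.ε_pos
  have hin : ∀ t, -1 + ε ≤ t → t ≤ 1 - ε → profile Θ ε κ t = ε := fun t h1 h2 =>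
    profile_inner H (abs_le.2 ⟨by linarith, h2⟩)
  have hup : ∀ t, 1 + ε ≤ t → profile Θ ε κ t = 0 := fun t ht =>
    profile_outer H (ht.trans (le_abs_self t))
  have hlow : ∀ t, t ≤ -1 - ε → profile Θ ε κ t = 0 := fun t ht =>
    profile_outer H (by linarith [neg_le_abs t])
  rw [contDiff_infty]
  intro n
  induction n with
  | zero => exact contDiff_zero.2 (h.isDensity H hs).continuous
  | succ n ih =>
    -- The bootstrap: the potential gains one derivative over the vorticity, and the labels return
    -- it to the vorticity.
    have hΦ : ContDiff ℝ (n + 1 : ℕ) (stream Θ ε κ lam ζ) := by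
      have := contDiff_succ_conv_logKer (h.isDensity H hs) ih
      unfold stream
      fun_prop
    rw [contDiff_iff_contDiffAt]
    intro p
    by_cases hp : ζ p ∈ bands ε
    · rcases hp with hp | hp
      · refine h.contDiffAt_of_mem_band H hs n.succ_ne_zero hΦ (by linarith) hc hδ h₁ hsδ
          subset_union_left hmean hconst (fun t ht => ?_) (fun t ht => ?_) hp
        · rw [hlow t ht.2, hlow _ le_rfl]
        · rw [hin t ht.1 (by linarith [ht.2]), hin _ le_rfl (by linarith)]
      · refine h.contDiffAt_of_mem_band H hs n.succ_ne_zero hΦ (by linarith) hc hδ h₂ hsδ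
          subset_union_right hmean hconst (fun t ht => ?_) (fun t ht => ?_) hp
        · rw [hin t (by linarith [ht.1]) ht.2, hin _ (by linarith) le_rfl]
        · rw [hup t ht.1, hup _ le_rfl]
    · exact h.contDiffAt_of_notMem H hp

end

/-! ### Uniform sign of the shear speed near a band, and finite norm bounds. -/

noncomputable section

/-- A continuous nonvanishing function has constant sign on the interval and attains its minimal
modulus `m` there. Half of `m` remains a lower bound on a neighbourhood, and `c = m / 4` leaves room
for a perturbation of `U` by `c`. -/
lemma exists_sign_bound {U : ℝ → ℝ} (hU : Continuous U) {a b : ℝ} (hab : a ≤ b)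
    (hne : ∀ y ∈ Icc a b, U y ≠ 0) : ∃ σ c δ : ℝ, |σ| = 1 ∧ 0 < c ∧ 0 < δ ∧
      ∀ y ∈ Ioo (a - δ) (b + δ), 2 * c ≤ σ * U y := by
  obtain ⟨σ, hσ, ha⟩ : ∃ σ : ℝ, |σ| = 1 ∧ 0 < σ * U a := by
    rcases lt_or_gt_of_ne (hne a (left_mem_Icc.2 hab)) with h | h
    · exact ⟨-1, by simp, by linarith⟩
    · exact ⟨1, by simp, by linarith⟩
  have hσ0 : σ ≠ 0 := fun h => by simp [h] at hσ
  have hV : Continuous fun y => σ * U y := by fun_prop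
  have hpos : ∀ y ∈ Icc a b, 0 < σ * U y := by
    intro y hy
    by_contra! hle
    obtain ⟨z, hz, hz0⟩ := intermediate_value_Icc' hy.1 hV.continuousOn ⟨hle, ha.le⟩
    exact hne z ⟨hz.1, hz.2.trans hy.2⟩ ((mul_eq_zero.1 hz0).resolve_left hσ0)
  obtain ⟨y₁, hy₁, hmin⟩ := isCompact_Icc.exists_isMinOn (nonempty_Icc.2 hab) hV.continuousOn
  have hm := hpos y₁ hy₁
  set m := σ * U y₁
  obtain ⟨δ, hδ, hsub⟩ := (isCompact_Icc (a := a) (b := b)).exists_thickening_subset_open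
    (isOpen_lt continuous_const hV : IsOpen {y | m / 2 < σ * U y}) (fun y hy => by
      have : m ≤ σ * U y := hmin hy
      exact lt_of_lt_of_le (by linarith) this)
  refine ⟨σ, m / 4, δ, hσ, by positivity, hδ, fun y hy => ?_⟩
  have hy' : y ∈ Metric.thickening δ (Icc a b) := by
    refine Metric.mem_thickening_iff.2 ⟨clamp a b y, clamp_mem hab y, ?_⟩
    rw [Real.dist_eq]
    rcases le_total y a with h | h
    · rw [clamp_of_le hab h, abs_of_nonpos (by linarith)]; linarith [hy.1]
    rcases le_total b y with h' | h'
    · rw [clamp_of_ge hab h', abs_of_nonneg (by linarith)]; linarith [hy.2]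
    · rw [clamp_of_mem ⟨h, h'⟩, sub_self, abs_zero]; exact hδ
  have : m / 2 < σ * U y := hsub hy'
  linarith

lemma exists_norm_bound {ε : ℝ} {g : ℝ × ℝ → ℝ} (hg : h43Norm ε g < ⊤) :
    ∃ N, 0 ≤ N ∧ h43Norm ε g < ENNReal.ofReal N := by
  refine ⟨(h43Norm ε g).toReal + 1, by positivity, ?_⟩
  rw [ENNReal.lt_ofReal_iff_toReal_lt hg.ne]
  linarith

end
end CouetteWave

/-! ### Choice of the smallness parameters and conclusion. -/

open CouetteWave

theorem theorem5p3 (Θ : ℝ → ℝ) (hΘ : IsMollifier Θ)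
    (ε κ : ℝ) (hε₀ : 0 < ε) (hε₁ : ε < 1) (hκ₀ : 0 < κ) (hκ₁ : κ < 1)
    (m : ℕ) (hm : 1 ≤ m)
    (lam₀ : ℝ) (h : ℝ × ℝ → ℝ) (hpair : IsBifurcationPair Θ ε κ m lam₀ h)
    (σ₀ : ℝ) (hσ₀ : 0 < σ₀) (lam : ℝ → ℝ) (f : ℝ → ℝ × ℝ → ℝ)
    (hbranch : IsBranch Θ ε κ m lam₀ h σ₀ lam f) :
    ∃ σ₁ : ℝ, 0 < σ₁ ∧ σ₁ ≤ σ₀ ∧ ∀ σ : ℝ, |σ| < σ₁ →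
      ∃ w : ℝ × ℝ → ℝ, IsVorticity Θ ε κ (f σ) w ∧
        (∀ w' : ℝ × ℝ → ℝ, IsVorticity Θ ε κ (f σ) w' → w' = w) ∧
        (∀ x z : ℝ, w (x + 2 * Real.pi, z) = w (x, z)) ∧
        ContDiff ℝ ∞ w := by
  have H : Admissible Θ ε κ := ⟨hΘ, hε₀, hε₁, hκ₀, hκ₁⟩
  have hX := hpair.memX
  obtain ⟨C, hC, hreg⟩ := exists_regular hε₀ hε₁
  obtain ⟨N, hN, hhN⟩ := exists_norm_bound hX.norm_lt_top
  have hhr := hreg h N hX.continuousOn hX.periodic hhN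
  have hU0 : ∀ y ∈ bands ε, shearSpeed Θ ε κ lam₀ y ≠ 0 := fun y hy =>
    shearSpeed_ne_zero H hX hhr hpair.ne_zero hpair.kernel hy
  have hUc := continuous_shearSpeed (lam := lam₀) H
  obtain ⟨σa, ca, δa, hσa, hca, hδa, ha⟩ := exists_sign_bound hUc (by linarith : -1 - ε ≤ -1 + ε)
    (fun y hy => hU0 y (Or.inl hy))
  obtain ⟨σb, cb, δb, hσb, hcb, hδb, hb⟩ := exists_sign_bound hUc (by linarith : 1 - ε ≤ 1 + ε)
    (fun y hy => hU0 y (Or.inr hy))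
  obtain ⟨K, hK, hKb⟩ := exists_streamY_bound H
  set c := min ca cb with hc
  have hc0 : 0 < c := lt_min hca hcb
  set δ := min (min δa δb) ((1 - ε) / 2) with hδ
  have hδ0 : 0 < δ := lt_min (lt_min hδa hδb) (by linarith)
  have hδε : δ ≤ (1 - ε) / 2 := min_le_right _ _
  have hδa' : δ ≤ δa := (min_le_left _ _).trans (min_le_left _ _)
  have hδb' : δ ≤ δb := (min_le_left _ _).trans (min_le_right _ _)
  -- The quantity `s = τ (C N + C)` will bound `f^σ` and its Lipschitz constant in `y`. The three
  -- conditions make the layering exist, keep the curves within `δ / 2` of their labels, and keep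
  -- the vertical derivative of the stream function within `c / 2` of the shear speed; the `3` comes
  -- from the extension.
  obtain ⟨τ, hτ, hτ1, hτ2, hτ3⟩ : ∃ τ : ℝ, 0 < τ ∧ τ * (C * N + C) ≤ (1 - ε) / 6 ∧
      3 * (τ * (C * N + C)) ≤ δ / 2 ∧ K * (3 * (τ * (C * N + C))) ≤ c / 2 := by
    have hL : 0 ≤ C * N + C := by positivity
    have hr : 0 < min (min ((1 - ε) / 6) (δ / 6)) (c / 6) := by
      refine lt_min (lt_min ?_ ?_) ?_ <;> linarith
    set r := min (min ((1 - ε) / 6) (δ / 6)) (c / 6)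
    have r1 : r ≤ (1 - ε) / 6 := (min_le_left _ _).trans (min_le_left _ _)
    have r2 : r ≤ δ / 6 := (min_le_left _ _).trans (min_le_right _ _)
    have r3 : r ≤ c / 6 := min_le_right _ _
    refine ⟨r / ((C * N + C + 1) * (K + 1)), by positivity, ?_⟩
    have hq : r / ((C * N + C + 1) * (K + 1)) * (C * N + C) * (K + 1) ≤ r := by
      have e : r / ((C * N + C + 1) * (K + 1)) * (C * N + C) * (K + 1)
          = r * ((C * N + C) / (C * N + C + 1)) := by field_simp
      rw [e]
      exact mul_le_of_le_one_right hr.le ((div_le_one (by linarith)).2 (by linarith))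
    set t := r / ((C * N + C + 1) * (K + 1)) * (C * N + C)
    have ht : 0 ≤ t := by positivity
    have := mul_nonneg ht hK
    exact ⟨by linarith, by linarith, by linarith⟩
  set s := τ * (C * N + C) with hs
  -- With `η = 1` the remainder `f^σ - σ h` has norm at most `|σ| < τ`, so its regularity bounds
  -- carry the constant `C τ`; those of `σ h` carry `τ C N`.
  have hev := (hbranch.tangent 1 one_pos).and (hbranch.speed.eventually
    (Metric.ball_mem_nhds lam₀ (half_pos hc0)))
  obtain ⟨ρ, hρ, hev⟩ := Metric.eventually_nhds_iff.1 hev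
  refine ⟨min σ₀ (min τ ρ), lt_min hσ₀ (lt_min hτ hρ), min_le_left _ _, fun σ hσ => ?_⟩
  have hσ₀' : |σ| < σ₀ := hσ.trans_le (min_le_left _ _)
  have hστ : |σ| < τ := hσ.trans_le ((min_le_right _ _).trans (min_le_left _ _))
  have hσρ : |σ| < ρ := hσ.trans_le ((min_le_right _ _).trans (min_le_right _ _))
  obtain ⟨htan, hlam⟩ := hev (y := σ) (by rwa [Real.dist_eq, sub_zero])
  have hY := hbranch.memX σ hσ₀'
  have hgr := hreg (fun p => f σ p - σ * h p) τ
    (hY.continuousOn.sub (continuousOn_const.mul hX.continuousOn))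
    (fun x y hy => by rw [hY.periodic x y hy, hX.periodic x y hy])
    (htan.trans_lt ((ENNReal.ofReal_lt_ofReal_iff hτ).2 (by linarith)))
  -- The triangle inequality `|u| ≤ |u - σ v| + |σ v|` in a form used twice: for values, with `A =
  -- 1`, and for increments in `y`, with `A = |y' - y|`.
  have hsz : ∀ u v : ℝ, ∀ A : ℝ, 0 ≤ A → |u - σ * v| ≤ C * τ * A → |v| ≤ C * N * A →
      |u| ≤ s * A := by
    intro u v A hA h1 h2
    have h3 : |σ * v| ≤ τ * (C * N * A) := by
      rw [abs_mul]
      exact mul_le_mul hστ.le h2 (abs_nonneg _) hτ.le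
    have h4 : |u| ≤ |u - σ * v| + |σ * v| := by
      simpa using abs_add_le (u - σ * v) (σ * v)
    rw [hs]
    nlinarith
  obtain ⟨E, ζ, hLay⟩ := exists_layering hε₀ hε₁ hτ1 hY.continuousOn hY.periodic
    (fun x y hy => by
      simpa using hsz (f σ (x, y)) (h (x, y)) 1 zero_le_one (by simpa using hgr.bound x y hy)
        (by simpa using hhr.bound x y hy))
    (fun x y y' hyy => hsz _ (h (x, y') - h (x, y)) _ (abs_nonneg _)
      (by
        have := hgr.lip x y y' hyy
        have e : f σ (x, y') - f σ (x, y) - σ * (h (x, y') - h (x, y))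
          = f σ (x, y') - σ * h (x, y') - (f σ (x, y) - σ * h (x, y)) := by ring
        rwa [e]) (hhr.lip x y y' hyy))
  have hs1 : 3 * s ≤ 1 := by linarith
  obtain ⟨N', -, hN'⟩ := exists_norm_bound hY.norm_lt_top
  have hfr := hreg (f σ) N' hY.continuousOn hY.periodic hN'
  -- One `c / 2` pays for the deformation of the vorticity, the other for the change of speed from
  -- `λ₀` to `λ^σ`.
  have hclose : ∀ x, ∀ z ∈ Ioo (-2 : ℝ) 2,
      |streamY Θ ε κ (lam σ) ζ (x, z) - shearSpeed Θ ε κ lam₀ z| ≤ c := by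
    intro x z hz
    have h1 := hKb _ _ _ _ hLay hs1 (lam σ) x z hz
    have h2 : |lam σ - lam₀| < c / 2 := by rwa [Real.dist_eq] at hlam
    have e : streamY Θ ε κ (lam σ) ζ (x, z) - shearSpeed Θ ε κ lam₀ z
        = streamY Θ ε κ (lam σ) ζ (x, z) - shearSpeed Θ ε κ (lam σ) z + (lam σ - lam₀) := by
      unfold shearSpeed; ring
    rw [e]
    exact (abs_add_le _ _).trans (by linarith)
  have hsgn : ∀ θ c' u v : ℝ, |θ| = 1 → c ≤ c' → 2 * c' ≤ θ * v → |u - v| ≤ c → c ≤ θ * u := by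
    intro θ c' u v hθ hcc hv huv
    have h1 : |θ * (u - v)| ≤ c := by rwa [abs_mul, hθ, one_mul]
    have h2 := (abs_le.1 h1).1
    rw [mul_sub] at h2
    linarith
  refine ⟨_, hLay.isVorticity H, fun w' hw' => hLay.unique H hw',
    fun x z => (hLay.isDensity H hs1).periodic x z,
    hLay.contDiff_profile H hs1 (σ₁ := σa) (σ₂ := σb) hc0 hδ0 hδε hτ2 (fun x z hz => ?_)
      (fun x z hz => ?_) hY.mean_zero
      (fun x x' y hy => hLay.stream_eq H hs1 hfr hY.periodic (hbranch.solves σ hσ₀') x x' hy)⟩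
  · exact hsgn _ ca _ _ hσa (min_le_left _ _) (ha z ⟨by linarith [hz.1], by linarith [hz.2]⟩)
      (hclose x z ⟨by linarith [hz.1], by linarith [hz.2]⟩)
  · exact hsgn _ cb _ _ hσb (min_le_right _ _) (hb z ⟨by linarith [hz.1], by linarith [hz.2]⟩)
      (hclose x z ⟨by linarith [hz.1], by linarith [hz.2]⟩)
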